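/- Let $J\ge 1$, $\lambda>0$, $\mu_1,\dots,\mu_J>0$, $c>0$ and $z\in\mathbb R^J$ with $z_i>0$ for all $i$. Let $e_1,\dots,e_J$ be the unit vectors of $\mathbb R^J$ and $\gamma_i=e_i-e_{i+1}$ for $i<J$, $\gamma_J=e_J$. Let $$G=\{x\in\mathbb R^J: 0\le x_1<z_1,\ 0\le x_i\le z_i\ (i\ge 2)\},$$ $$\partial_cG=\{x\in G: x_i=z_i \text{ for some } i\ge 2\},\qquad \partial_oG=\{x: x_1=z_1,\ 0\le x_i\le z_i\ (i\ge2)\},$$ and $I(x)=\{i: x_i=0\}$. With $l(r)=r\log r-r+1$ ($0\log 0=0$), $U=[0,1]^J$ and $M=\{m=(\bar\lambda,\bar\mu_1,\dots,\bar\mu_J):\bar\lambda,\bar\mu_i\ge0\}$, let $$H(p)=\sup_{u\in U}\inf_{m\in M}\Big\{c+\bar\lambda p_1+\lambda\, l\Big(\frac{\bar\lambda}{\lambda}\Big)+\sum_{i=1}^J u_i\Big[-\bar\mu_i\,\gamma_i\cdot p+\mu_i\, l\Big(\frac{\bar\mu_i}{\mu_i}\Big)\Big]\Big\}.$$ For $V:\bar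 G\to\mathbb R$ and $x\in G$ let $D^+V(x)$ (respectively $D^-V(x)$) be the set of $p\in\mathbb R^J$ for which the upper limit of $\frac{V(y)-V(x)-p\cdot(y-x)}{|y-x|}$ as $y\to x$, $y\in G$, is $\le0$ (respectively the lower limit is $\ge0$). A viscosity solution of the problem "$H(DV)=0$ in the interior of $G$, $DV\cdot\gamma_i=0$ where $x_i=0$, $V=0$ on $\partial_oG$" is a function $V$ such that $$\max\{H(p),\max_{i\in I(x)}p\cdot\gamma_i\}\ge0\quad (x\in G,\ p\in D^+V(x)),$$ $$\min\{H(p),\min_{i\in I(x)}p\cdot\gamma_i\}\le0\quad (x\in G\setminus\partial_cG,\ p\in D^-V(x)),$$ and $V=0$ on $\partial_oG$ (a maximum or minimum over $I(x)=\emptyset$ is omitted). For $n\ge1$ let $G^n=n^{-1}\mathbb Z_+^J\cap G$. A controlled Markov process from $x\in G^n$ consists of a complete filtered probability space $(\Omega,\mathcal F,(\mathcal F_t)_{t\ge0},P)$, an adapted process $X^n$ with right-continuous paths with left limits in $n^{-1}\mathbb Z_+^J$ and $P(X^n(0)=x)=1$, and a measurable adapted process $u$ with values in $U$, such that for every bounded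 $f:n^{-1}\mathbb Z_+^J\to\mathbb R$ the process $f(X^n(t))-\int_0^t\mathcal L^{n,u(s)}f(X^n(s))\,ds$ is an $\mathcal F_t$-martingale, where $$\mathcal L^{n,u}f(x)=n\lambda\,[f(x+\tfrac1n e_1)-f(x)]+n\sum_{i=1}^J u_i\mu_i\,1_{\{x_i>0\}}\,[f(x-\tfrac1n\gamma_i)-f(x)].$$ Let $\sigma^n=\inf\{t: X^n(t)\notin G\}$ and $V^n(x)=-\inf\, n^{-1}\log E\,e^{-nc\sigma^n}$, the infimum being over all controlled Markov processes from $x$. Then for each $i$ the equation $c+\lambda(1-e^{\beta})+\mu_i(1-e^{-\beta})=0$ has a unique positive root $\beta_i$. Put $b_i=\beta_i(e_1+\dots+e_i)$. The function $$V(x)=\min_{1\le i\le J} b_i\cdot(z-x)$$ is a Lipschitz viscosity solution on $\bar G$ of the problem above, and every Lipschitz viscosity solution on $\bar G$ equals $V$. Moreover, if $x_n\in G^n$ for all $n\ge1$ and $x_n\to x\in G$, then $V^n(x_n)\to V(x)$. -/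

import Mathlib

open Filter Topology MeasureTheory ProbabilityTheory
open scoped NNReal ENNReal

noncomputable section

namespace TandemQueue

/-! ### Geometry of the network

Queues are indexed by `Fin J`; queue `i : Fin J` is the `(i + 1)`-st queue of the line, so the first
queue has index `0`. -/

/-- The state space `ℝ^J` with its Euclidean structure. -/
abbrev State (J : ℕ) := EuclideanSpace ℝ (Fin J)

/-- The unit coordinate vector `e_i`. -/
def unitVec {J : ℕ} (i : Fin J) : State J := EuclideanSpace.single i (1 : ℝ)

/-- `γ_i = e_i - e_{i+1}` for every queue but the last one, and `γ_J = e_J` for the last one: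
a service at queue `i` changes the state by `-γ_i`. -/
def gammaVec {J : ℕ} (i : Fin J) : State J :=
  unitVec i - if h : i.val + 1 < J then unitVec ⟨i.val + 1, h⟩ else 0

/-- The rectangle `G = {0 ≤ x_1 < z_1, 0 ≤ x_i ≤ z_i for i ≥ 2}`. -/
def domainG {J : ℕ} [NeZero J] (z : State J) : Set (State J) :=
  {x | (∀ i, 0 ≤ x i) ∧ x 0 < z 0 ∧ ∀ i, i ≠ 0 → x i ≤ z i}

/-- `∂_c G`: the part of the boundary through which exit can be blocked. -/
def boundaryC {J : ℕ} [NeZero J] (z : State J) : Set (State J) :=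
  {x | (∀ i, 0 ≤ x i ∧ x i ≤ z i) ∧ x 0 < z 0 ∧ ∃ i, i ≠ 0 ∧ x i = z i}

/-- `∂_o G`: the part of the boundary through which exit cannot be blocked. -/
def boundaryO {J : ℕ} [NeZero J] (z : State J) : Set (State J) :=
  {x | x 0 = z 0 ∧ ∀ i, i ≠ 0 → 0 ≤ x i ∧ x i ≤ z i}

/-! ### The Hamiltonian -/

/-- The control space `U = [0,1]^J`. -/
def controlSet (J : ℕ) : Set (Fin J → ℝ) := {u | ∀ i, 0 ≤ u i ∧ u i ≤ 1}

/-- The space `M` of perturbed rates `m = (lamBar, muBar)`, all of them nonnegative. -/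
def rateSet (J : ℕ) : Set (ℝ × (Fin J → ℝ)) := {m | 0 ≤ m.1 ∧ ∀ i, 0 ≤ m.2 i}

/-- `l(x) = x log x - x + 1` with `0 log 0 = 0`.  It is used only at arguments `x ≥ 0`
(the convention `l = +∞` on the negative axis never enters, as the rates in `M` are nonnegative). -/
def entropyFun (x : ℝ) : ℝ := x * Real.log x - x + 1

/-- The drift `v(u,m) = lamBar e_1 - ∑ i, u_i muBar_i γ_i`. -/
def drift {J : ℕ} [NeZero J] (u : Fin J → ℝ) (m : ℝ × (Fin J → ℝ)) : State J :=
  m.1 • unitVec 0 - ∑ i, (u i * m.2 i) • gammaVec i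

/-- The running cost `ρ(u,m) = lam l(lamBar / lam) + ∑ i, u_i mu_i l(muBar_i / mu_i)`. -/
def runningCost {J : ℕ} (lam : ℝ) (mu : Fin J → ℝ) (u : Fin J → ℝ) (m : ℝ × (Fin J → ℝ)) : ℝ :=
  lam * entropyFun (m.1 / lam) + ∑ i, u i * mu i * entropyFun (m.2 i / mu i)

/-- `H(p) = sup_{u ∈ U} inf_{m ∈ M} (c + p · v(u,m) + ρ(u,m))`. -/
def hamiltonian {J : ℕ} [NeZero J] (c lam : ℝ) (mu : Fin J → ℝ) (p : State J) : ℝ :=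
  ⨆ u : controlSet J, ⨅ m : rateSet J,
    (c + inner ℝ p (drift u.1 m.1) + runningCost lam mu u.1 m.1)

/-! ### Viscosity solutions -/

/-- The set `D⁺V(x)` of superdifferentials of `V` at `x`, relative to `G`.  The upper limit is taken
in the extended reals, over `y → x`, `y ∈ G`, `y ≠ x`. -/
def superdiff {J : ℕ} [NeZero J] (z : State J) (V : State J → ℝ) (x : State J) :
    Set (State J) :=
  {p | limsup (fun y => (((V y - V x - inner ℝ p (y - x)) / ‖y - x‖ : ℝ) : EReal))
    (𝓝[domainG z \ {x}] x) ≤ 0}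

/-- The set `D⁻V(x)` of subdifferentials of `V` at `x`, relative to `G`. -/
def subdiff {J : ℕ} [NeZero J] (z : State J) (V : State J → ℝ) (x : State J) :
    Set (State J) :=
  {p | 0 ≤ liminf (fun y => (((V y - V x - inner ℝ p (y - x)) / ‖y - x‖ : ℝ) : EReal))
    (𝓝[domainG z \ {x}] x)}

/-- `V` is a viscosity solution of `H(DV) = 0` in the interior of `G`, with reflection conditions
`DV · γ_i = 0` where `x_i = 0`, and with `V = 0` on `∂_o G`.
The disjunction `0 ≤ H(p) ∨ ∃ i ∈ I(x), 0 ≤ p · γ_i` says that the maximum of `H(p)` and of the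
numbers `p · γ_i`, `i ∈ I(x) = {i | x_i = 0}`, is nonnegative; similarly for the minimum. -/
structure IsViscositySolution {J : ℕ} [NeZero J] (c lam : ℝ) (mu : Fin J → ℝ) (z : State J)
    (V : State J → ℝ) : Prop where
  super : ∀ x ∈ domainG z, ∀ p ∈ superdiff z V x,
    0 ≤ hamiltonian c lam mu p ∨ ∃ i, x i = 0 ∧ 0 ≤ inner ℝ p (gammaVec i)
  sub : ∀ x ∈ domainG z \ boundaryC z, ∀ p ∈ subdiff z V x,
    hamiltonian c lam mu p ≤ 0 ∨ ∃ i, x i = 0 ∧ inner ℝ p (gammaVec i) ≤ 0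
  boundary : ∀ x ∈ boundaryO z, V x = 0

/-- Lipschitz continuity on the closed rectangle. -/
def IsLipschitz {J : ℕ} [NeZero J] (z : State J) (V : State J → ℝ) : Prop :=
  ∃ K : ℝ≥0, LipschitzOnWith K V (closure (domainG z))

/-! ### The explicit function -/

/-- `b` is a positive solution of `c + lam (1 - e^b) + mu (1 - e^{-b}) = 0`. -/
def IsPositiveRoot (c lam mu b : ℝ) : Prop :=
  0 < b ∧ c + lam * (1 - Real.exp b) + mu * (1 - Real.exp (-b)) = 0

/-- `b_i = β_i (e_1 + ⋯ + e_i)`. -/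
def bVec {J : ℕ} (β : Fin J → ℝ) (i : Fin J) : State J :=
  β i • ∑ j ∈ Finset.Iic i, unitVec j

/-- `x ↦ min_i b_i · (z - x)`. -/
def minFun {J : ℕ} [NeZero J] (β : Fin J → ℝ) (z x : State J) : ℝ :=
  Finset.univ.inf' Finset.univ_nonempty (fun i => inner ℝ (bVec β i) (z - x))

/-! ### The risk-sensitive control problem -/

/-- The queue lengths after an arrival at the first queue. -/
def arrive {J : ℕ} [NeZero J] (k : Fin J → ℕ) : Fin J → ℕ :=
  fun j => if j = 0 then k j + 1 else k j

/-- The queue lengths `k - γ_i` after a service at queue `i`.  It is used only when `1 ≤ k i`, which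
is equivalent to `k - γ_i` having nonnegative entries. -/
def serve {J : ℕ} (i : Fin J) (k : Fin J → ℕ) : Fin J → ℕ :=
  fun j => if j = i then k j - 1 else if j.val = i.val + 1 then k j + 1 else k j

/-- The generator `𝓛^u` of the unscaled network under the control `u`. -/
def generator {J : ℕ} [NeZero J] (lam : ℝ) (mu : Fin J → ℝ) (u : Fin J → ℝ)
    (g : (Fin J → ℕ) → ℝ) (k : Fin J → ℕ) : ℝ :=
  lam * (g (arrive k) - g k) +
    ∑ i, u i * mu i * (if 1 ≤ k i then g (serve i k) - g k else 0)

/-- The scaled state `k / n`, a point of the lattice `n⁻¹ ℤ_+^J`. -/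
def scaled {J : ℕ} (n : ℕ) (k : Fin J → ℕ) : State J :=
  WithLp.toLp 2 (fun i => (k i : ℝ) / (n : ℝ))

/-- `G^n = n⁻¹ ℤ_+^J ∩ G`. -/
def latticeG {J : ℕ} [NeZero J] (z : State J) (n : ℕ) : Set (State J) :=
  {x | x ∈ domainG z ∧ ∃ k : Fin J → ℕ, x = scaled n k}

/-- A controlled Markov process for the scaling parameter `n`, started at `x`.  The scaled state
process is `X^n(t) = scaled n (Q t)`, where `Q t` is the vector of queue lengths; through
`f(k / n) = g(k)`, bounded functions `f` on the scaled lattice correspond to bounded functions `g`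
of the queue lengths, and `𝓛^{n,u} f (k / n) = n 𝓛^u g (k)`. -/
structure ControlledProcess (J : ℕ) [NeZero J] (lam : ℝ) (mu : Fin J → ℝ) (n : ℕ)
    (x : State J) where
  Ω : Type
  mΩ : MeasurableSpace Ω
  P : Measure Ω
  isProb : IsProbabilityMeasure P
  ℱ : Filtration ℝ≥0 mΩ
  /-- The filtered probability space is complete. -/
  complete : ∀ s : Set Ω, P s = 0 → MeasurableSet[ℱ 0] s
  Q : ℝ≥0 → Ω → (Fin J → ℕ)
  u : ℝ≥0 → Ω → (Fin J → ℝ)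
  /-- Paths are right-continuous with left limits. -/
  rightCont : ∀ ω t, ContinuousWithinAt (fun s => Q s ω) (Set.Ici t) t
  leftLim : ∀ ω t, ∃ q, Tendsto (fun s => Q s ω) (𝓝[<] t) (𝓝 q)
  adapted_Q : Adapted ℱ Q
  measurable_u : Measurable (fun q : ℝ≥0 × Ω => u q.1 q.2)
  adapted_u : Adapted ℱ u
  u_mem : ∀ t ω, u t ω ∈ controlSet J
  start : ∀ᵐ ω ∂P, scaled n (Q 0 ω) = x
  /-- The martingale problem for the scaled, controlled generator. -/
  martingale : ∀ g : (Fin J → ℕ) → ℝ, (∃ C, ∀ k, |g k| ≤ C) →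
    Martingale (fun (t : ℝ≥0) ω => g (Q t ω) -
      ∫ s in (0 : ℝ)..t, (n : ℝ) * generator lam mu (u s.toNNReal ω) g (Q s.toNNReal ω)) ℱ P

/-- The exit time `σ^n = inf {t | X^n(t) ∉ G}`, equal to `⊤` if there is no exit. -/
def exitTime {J : ℕ} [NeZero J] {lam : ℝ} {mu : Fin J → ℝ} {n : ℕ} {x : State J}
    (z : State J) (A : ControlledProcess J lam mu n x) (ω : A.Ω) : ℝ≥0∞ :=
  ⨅ (t : ℝ≥0) (_ : scaled n (A.Q t ω) ∉ domainG z), (t : ℝ≥0∞)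

open scoped Classical in
/-- The cost `E exp(-n c σ^n)`, with `exp(-∞) = 0`. -/
def cost {J : ℕ} [NeZero J] {lam : ℝ} {mu : Fin J → ℝ} {n : ℕ} {x : State J}
    (c : ℝ) (z : State J) (A : ControlledProcess J lam mu n x) : ℝ≥0∞ :=
  letI := A.mΩ
  ∫⁻ ω, (if exitTime z A ω = ⊤ then 0
    else ENNReal.ofReal (Real.exp (-((n : ℝ) * c * (exitTime z A ω).toReal)))) ∂A.P

/-- `V^n(x) = - inf n⁻¹ log E exp(-n c σ^n)`, the infimum being over all controlled Markov processes
started at `x`; the logarithm and the infimum are those of the extended real line. -/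
def valueFun {J : ℕ} [NeZero J] (c lam : ℝ) (mu : Fin J → ℝ) (z : State J) (n : ℕ)
    (x : State J) : EReal :=
  -(⨅ A : ControlledProcess J lam mu n x,
      (((n : ℝ)⁻¹ : ℝ) : EReal) * ENNReal.log (cost c z A))

end TandemQueue

end

/-!
Minimizing over the perturbed rates turns the Hamiltonian into the closed form
`H(p) = c + lam (1 - exp (-p_1)) + ∑ mu_i (1 - exp (p_i - p_{i+1}))⁺`, with `p_{J+1} = 0`
(`hamiltonian_eq_hamExp`), and each `-b_i` is a zero of `H` because `β_i` solves the equation of the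
exponent.

Everything from below rests on one inequality, `le_hamExp`: at a convex combination of the vectors
`-b_i`, and at its perturbations of the kind produced by barriers at the faces, `H` is nonnegative, up
to a small error from indices of small weight, and strictly positive after a contraction towards the
origin. With `q_k = -∑_{i ≥ k} θ_i β_i`, the increase of `p` from `p_1` to `0` is distributed over the
intervals `[q_i, q_{i+1}]`, and Jensen's inequality for the exponential does the rest, since a jump of
the level `i` that takes place at a queue `k` with `β_i ≤ β_k` only sees a larger service rate. Applied to a smooth approximation of the minimum of the
affine functions `b_i · (z - x)`, with concave barriers added at the faces, it yields smooth strict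
subsolutions `SmoothSubsolution` arbitrarily close to `V`, as steep at the faces as desired.

* `V` is a viscosity solution: at a superdifferential one touches `V` by smooth subsolutions; at a
  subdifferential `p` the difference `-b_i - p`, for an active `i`, is nonnegative and supported on the
  empty queues.
* Uniqueness: a solution `W` lies below each `b_i · (z - x)`, as enlarged affine functions are strict
  supersolutions (`le_of_isViscositySolution`), and above each smooth subsolution that is steeper at
  the faces than the Lipschitz constant of `W` (`ge_of_isViscositySolution`).
* Upper bound for the value functions: for `a > β_i` the function `exp (-n a ∑_{j ≤ i} (z_j - x_j))`
  grows under every control at least at the rate `n c` in the state space, so the discounted exit time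
  has at least this expectation up to a constant factor (`valueFun_le`). The argument uses only the
  martingale problem, stopped on a fine time grid instead of at the exit time.
* Lower bound: for a smooth subsolution `φ`, serve exactly where a service decreases `φ` and does not
  leave the box. Uniform continuity of the gradient makes `exp (-n φ)` a supersolution of the discrete
  equation for large `n` (`SmoothSubsolution.exists_generator_le`), hence `φ ≤ V^n`.

The lower bound needs an actual controlled process. It is built from i.i.d. pairs of an exponential
gap and a mark: the path carries out the jump given by the mark after each gap. Events of the past
are those that, before the jump number `m + 1` and up to null sets, depend on the first `m` pairs only;
the martingale property reduces to the fact that resampling one pair preserves the law of the noise,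
which gives each compensated jump mean zero (`setIntegral_jumpIncrement_eq_zero`,
`martingale_jumpMartingale`).
-/

noncomputable section

namespace TandemQueue

/-! ### The exponents -/

theorem existsUnique_isPositiveRoot {c lam mu : ℝ} (hc : 0 < c) (hlam : 0 < lam) (hmu : 0 < mu) :
    ∃! b : ℝ, IsPositiveRoot c lam mu b := by
  have cont : Continuous fun b : ℝ => c + lam * (1 - Real.exp b) + mu * (1 - Real.exp (-b)) := by
    fun_prop
  have h0 : (0 : ℝ) ∈ Set.Icc (c + lam * (1 - Real.exp (Real.log ((c + lam + mu) / lam))) +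
      mu * (1 - Real.exp (-Real.log ((c + lam + mu) / lam))))
      (c + lam * (1 - Real.exp 0) + mu * (1 - Real.exp (-0))) := by
    constructor
    · have : 0 < (c + lam + mu) / lam := by positivity
      rw [Real.exp_log this]
      have h1 : lam * ((c + lam + mu) / lam) = c + lam + mu := by field_simp
      have := mul_pos hmu (Real.exp_pos (-Real.log ((c + lam + mu) / lam)))
      nlinarith
    · simp [hc.le]
  have hL : 0 ≤ Real.log ((c + lam + mu) / lam) := by
    apply Real.log_nonneg
    rw [le_div_iff₀ hlam]
    linarith
  obtain ⟨b, hb, hb0⟩ := intermediate_value_Icc' hL cont.continuousOn h0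
  have key : ∀ x, IsPositiveRoot c lam mu x →
      lam * Real.exp x ^ 2 - (c + lam + mu) * Real.exp x + mu = 0 := by
    rintro x ⟨-, h⟩
    have : Real.exp (-x) * Real.exp x = 1 := by rw [← Real.exp_add]; simp
    linear_combination (-Real.exp x) * h - mu * this
  refine ⟨b, ⟨lt_of_le_of_ne hb.1 ?_, hb0⟩, ?_⟩
  · rintro rfl
    simp at hb0
    exact hc.ne' hb0
  · have hb' : IsPositiveRoot c lam mu b := by
      refine ⟨lt_of_le_of_ne hb.1 ?_, hb0⟩
      rintro rfl
      simp at hb0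
      exact hc.ne' hb0
    intro y hy
    have e1 := key b hb'
    have e2 := key y hy
    have g1 : 1 < Real.exp b := Real.one_lt_exp_iff.2 hb'.1
    have g2 : 1 < Real.exp y := Real.one_lt_exp_iff.2 hy.1
    have hmul : (Real.exp y - Real.exp b) *
        (lam * (Real.exp y + Real.exp b) - (c + lam + mu)) = 0 := by
      linear_combination e2 - e1
    rcases mul_eq_zero.1 hmul with h | h
    · exact Real.exp_injective (by linarith)
    · exfalso
      -- the product of the two roots would be `mu / lam`, and `1` is not between them
      have h3 : lam * (Real.exp y * Real.exp b) = mu := by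
        linear_combination -e1 + Real.exp b * h
      nlinarith [mul_pos hlam (mul_pos (sub_pos.2 g1) (sub_pos.2 g2))]

/-- Beyond the root, the defining function of the exponent is negative. -/
theorem IsPositiveRoot.neg_of_lt {c lam mu b a : ℝ} (hc : 0 < c) (hlam : 0 < lam) (hmu : 0 < mu)
    (hb : IsPositiveRoot c lam mu b) (hab : b < a) :
    c + lam * (1 - Real.exp a) + mu * (1 - Real.exp (-a)) < 0 := by
  have e1 : lam * Real.exp b ^ 2 - (c + lam + mu) * Real.exp b + mu = 0 := by
    have : Real.exp (-b) * Real.exp b = 1 := by rw [← Real.exp_add]; simp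
    linear_combination (-Real.exp b) * hb.2 - mu * this
  have g1 : 1 < Real.exp b := Real.one_lt_exp_iff.2 hb.1
  have g2 : Real.exp b < Real.exp a := Real.exp_lt_exp.2 hab
  have e2 : 0 < lam * Real.exp a ^ 2 - (c + lam + mu) * Real.exp a + mu := by
    have h3 : c + lam + mu < 2 * lam * Real.exp b := by
      nlinarith [mul_pos hlam (mul_pos (sub_pos.2 g1) (sub_pos.2 g1))]
    nlinarith [mul_pos (sub_pos.2 g2) (sub_pos.2 h3), mul_pos hlam (mul_pos (sub_pos.2 g2) (sub_pos.2 g2))]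
  have h4 : Real.exp (-a) * Real.exp a = 1 := by rw [← Real.exp_add]; simp
  have h5 : (c + lam * (1 - Real.exp a) + mu * (1 - Real.exp (-a))) * Real.exp a < 0 := by
    nlinarith
  exact neg_of_mul_neg_left h5 (Real.exp_pos a).le

/-- The service rate is a monotone function of the exponent. -/
theorem IsPositiveRoot.mu_le {c lam mu mu' b b' : ℝ} (hlam : 0 < lam)
    (hmu' : 0 < mu') (hc : 0 < c)
    (hb : IsPositiveRoot c lam mu b) (hb' : IsPositiveRoot c lam mu' b') (h : b' ≤ b) :
    mu' ≤ mu := by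
  by_contra! hlt
  have h1 : c + lam * (1 - Real.exp b) + mu' * (1 - Real.exp (-b)) ≤ 0 := by
    rcases h.lt_or_eq with h | h
    · exact (hb'.neg_of_lt hc hlam hmu' h).le
    · exact h ▸ hb'.2.le
  have h2 : Real.exp (-b) < 1 := by
    rw [Real.exp_lt_one_iff]
    linarith [hb.1]
  nlinarith [hb.2, mul_pos (sub_pos.2 hlt) (sub_pos.2 h2)]

/-! ### Coordinates -/

/-- The coordinates of a vector of `ℝ^J`, numbered by `ℕ`, with the value `0` beyond the last. -/
def coord {J : ℕ} (p : State J) (k : ℕ) : ℝ := if h : k < J then p ⟨k, h⟩ else 0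

@[simp] theorem coord_val {J : ℕ} (p : State J) (i : Fin J) : coord p i = p i := by
  simp [coord]

@[simp] theorem coord_self {J : ℕ} (p : State J) : coord p J = 0 := by simp [coord]

theorem inner_unitVec {J : ℕ} (p : State J) (i : Fin J) : inner ℝ p (unitVec i) = p i := by
  simp [unitVec, EuclideanSpace.inner_single_right]

theorem inner_gammaVec {J : ℕ} (p : State J) (i : Fin J) :
    inner ℝ p (gammaVec i) = coord p i - coord p (i + 1) := by
  unfold gammaVec
  rw [inner_sub_right, inner_unitVec, coord_val]
  congr 1
  by_cases h : i.val + 1 < J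
  · simp [h, coord, inner_unitVec]
  · simp [h, coord]

theorem unitVec_apply {J : ℕ} (i j : Fin J) : unitVec i j = if j = i then 1 else 0 := by
  simp [unitVec]

theorem inner_eq_sum {J : ℕ} (p v : State J) : inner ℝ p v = ∑ i, p i * v i := by
  simp [PiLp.inner_apply, mul_comm]

theorem inner_bVec {J : ℕ} (β : Fin J → ℝ) (i : Fin J) (v : State J) :
    inner ℝ (bVec β i) v = β i * ∑ j ∈ Finset.Iic i, v j := by
  unfold bVec
  rw [real_inner_smul_left, sum_inner]
  simp_rw [real_inner_comm, inner_unitVec]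

theorem bVec_apply {J : ℕ} (β : Fin J → ℝ) (i k : Fin J) :
    bVec β i k = if k ≤ i then β i else 0 := by
  simp [bVec, unitVec_apply]

/-! ### The Hamiltonian in closed form -/

/-- The closed form of the Hamiltonian: minimizing over the perturbed rates turns each entropy term
into an exponential, and the maximizing control serves queue `i` if and only if `γ_i · p < 0`. -/
def hamExp {J : ℕ} [NeZero J] (c lam : ℝ) (mu : Fin J → ℝ) (p : State J) : ℝ :=
  c + lam * (1 - Real.exp (-p 0)) +
    ∑ i : Fin J, mu i * max 0 (1 - Real.exp (coord p i - coord p (i + 1)))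

/-- Legendre duality between `l` and the exponential. -/
theorem exp_le_entropy {a r s : ℝ} (ha : 0 < a) (hr : 0 ≤ r) :
    a * (1 - Real.exp (-s)) ≤ r * s + a * entropyFun (r / a) := by
  unfold entropyFun
  rcases hr.eq_or_lt with rfl | hr
  · simp
    nlinarith [Real.exp_pos (-s)]
  · set x := r / a with hx
    have hx0 : 0 < x := by positivity
    have hr' : r = a * x := by rw [hx]; field_simp
    rw [hr']
    have h1 := Real.add_one_le_exp (-s - Real.log x)
    have h2 : Real.exp (-s - Real.log x) * x = Real.exp (-s) := by
      rw [Real.exp_sub, Real.exp_log hx0]; field_simp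
    nlinarith [mul_pos ha hx0, mul_le_mul_of_nonneg_left h1 hx0.le]

theorem exp_eq_entropy {a s : ℝ} (ha : 0 < a) :
    (a * Real.exp (-s)) * s + a * entropyFun ((a * Real.exp (-s)) / a) =
      a * (1 - Real.exp (-s)) := by
  unfold entropyFun
  rw [mul_div_cancel_left₀ _ ha.ne', Real.log_exp]
  ring

theorem hamiltonian_eq_hamExp {J : ℕ} [NeZero J] {c lam : ℝ} {mu : Fin J → ℝ} (hlam : 0 < lam)
    (hmu : ∀ i, 0 < mu i) (p : State J) : hamiltonian c lam mu p = hamExp c lam mu p := by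
  have expand : ∀ (u : Fin J → ℝ) (m : ℝ × (Fin J → ℝ)),
      c + inner ℝ p (drift u m) + runningCost lam mu u m =
        c + (m.1 * p 0 + lam * entropyFun (m.1 / lam)) +
          ∑ i, u i * (m.2 i * (coord p (i + 1) - coord p i) + mu i * entropyFun (m.2 i / mu i)) := by
    intro u m
    unfold drift runningCost
    rw [inner_sub_right, real_inner_smul_right, inner_unitVec, inner_sum]
    simp_rw [real_inner_smul_right, inner_gammaVec, mul_add, Finset.sum_add_distrib]
    rw [← sub_eq_zero]
    have : ∑ x : Fin J, u x * m.2 x * (coord p x - coord p (x + 1)) =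
      - ∑ x : Fin J, u x * (m.2 x * (coord p (x + 1) - coord p x)) := by
      rw [← Finset.sum_neg_distrib]
      exact Finset.sum_congr rfl fun i _ => by ring
    rw [this]
    simp_rw [← mul_assoc]
    ring
  have inner_inf : ∀ u : controlSet J, (⨅ m : rateSet J,
      (c + inner ℝ p (drift u.1 m.1) + runningCost lam mu u.1 m.1)) =
      c + lam * (1 - Real.exp (-p 0)) +
        ∑ i, u.1 i * (mu i * (1 - Real.exp (-(coord p (i + 1) - coord p i)))) := by
    intro u
    have lower : ∀ m : rateSet J, c + lam * (1 - Real.exp (-p 0)) +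
        ∑ i, u.1 i * (mu i * (1 - Real.exp (-(coord p (i + 1) - coord p i)))) ≤
        c + inner ℝ p (drift u.1 m.1) + runningCost lam mu u.1 m.1 := by
      intro m
      rw [expand]
      gcongr with i
      · exact exp_le_entropy hlam m.2.1
      · exact (u.2 i).1
      · exact exp_le_entropy (hmu i) (m.2.2 i)
    have hm : ((lam * Real.exp (-p 0),
        fun i : Fin J => mu i * Real.exp (-(coord p (i + 1) - coord p i))) :
        ℝ × (Fin J → ℝ)) ∈ rateSet J :=
      ⟨by positivity, fun i => mul_nonneg (hmu i).le (Real.exp_pos _).le⟩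
    have : Nonempty (rateSet J) := ⟨⟨_, hm⟩⟩
    apply le_antisymm
    · refine (ciInf_le ⟨c + lam * (1 - Real.exp (-p 0)) +
        ∑ i, u.1 i * (mu i * (1 - Real.exp (-(coord p (i + 1) - coord p i)))), ?_⟩
        (⟨_, hm⟩ : rateSet J)).trans_eq ?_
      · rintro _ ⟨m, rfl⟩
        exact lower m
      · rw [expand, exp_eq_entropy hlam]
        simp_rw [exp_eq_entropy (hmu _)]
    · exact le_ciInf lower
  have upper : ∀ u : controlSet J, c + lam * (1 - Real.exp (-p 0)) +
        ∑ i, u.1 i * (mu i * (1 - Real.exp (-(coord p (i + 1) - coord p i)))) ≤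
        hamExp c lam mu p := by
    intro u
    unfold hamExp
    refine add_le_add le_rfl (Finset.sum_le_sum fun i _ => ?_)
    rw [neg_sub]
    calc u.1 i * (mu i * (1 - Real.exp (coord p i - coord p (i + 1))))
        ≤ u.1 i * (mu i * max 0 (1 - Real.exp (coord p i - coord p (i + 1)))) := by
          gcongr
          · exact (u.2 i).1
          · exact (hmu i).le
          · exact le_max_right _ _
      _ ≤ 1 * (mu i * max 0 (1 - Real.exp (coord p i - coord p (i + 1)))) := by
          gcongr
          · exact mul_nonneg (hmu i).le (le_max_left _ _)
          · exact (u.2 i).2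
      _ = _ := one_mul _
  unfold hamiltonian
  simp_rw [inner_inf]
  have hu : (fun i : Fin J => if 0 ≤ 1 - Real.exp (coord p i - coord p (i + 1)) then (1 : ℝ) else 0) ∈
      controlSet J := by
    intro i
    dsimp only
    split_ifs <;> norm_num
  have : Nonempty (controlSet J) := ⟨⟨_, hu⟩⟩
  apply le_antisymm
  · exact ciSup_le upper
  · refine le_trans ?_ (le_ciSup (f := fun u : controlSet J => c + lam * (1 - Real.exp (-p 0)) +
        ∑ i, u.1 i * (mu i * (1 - Real.exp (-(coord p (i + 1) - coord p i)))))
      ⟨hamExp c lam mu p, ?_⟩ ⟨_, hu⟩)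
    · unfold hamExp
      refine add_le_add le_rfl (Finset.sum_le_sum fun i _ => ?_)
      rw [neg_sub]
      dsimp only
      split_ifs with h
      · rw [max_eq_right h, one_mul]
      · rw [max_eq_left (not_le.1 h).le]; simp
    · rintro _ ⟨u, rfl⟩
      exact upper u

theorem continuous_coord {J : ℕ} (k : ℕ) : Continuous fun p : State J => coord p k := by
  unfold coord
  split_ifs <;> fun_prop

theorem continuous_hamExp {J : ℕ} [NeZero J] (c lam : ℝ) (mu : Fin J → ℝ) :
    Continuous (hamExp c lam mu) := by
  have := fun k => continuous_coord (J := J) k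
  unfold hamExp
  fun_prop

/-! ### The closed rectangle -/

/-- The closed rectangle `∏ [0, z_i]`, which is the closure of `G`. -/
def closedBox {J : ℕ} (z : State J) : Set (State J) := {x | ∀ i, 0 ≤ x i ∧ x i ≤ z i}

theorem isClosed_closedBox {J : ℕ} (z : State J) : IsClosed (closedBox z) := by
  have : closedBox z = ⋂ i, {x : State J | 0 ≤ x i ∧ x i ≤ z i} := by
    ext; simp [closedBox]
  rw [this]
  refine isClosed_iInter fun i => IsClosed.and ?_ ?_
  · exact isClosed_le continuous_const (by fun_prop)
  · exact isClosed_le (by fun_prop) continuous_const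

theorem isCompact_closedBox {J : ℕ} (z : State J) : IsCompact (closedBox z) := by
  have h : IsCompact (Set.Icc (0 : Fin J → ℝ) (fun i => z i)) := isCompact_Icc
  have : closedBox z = (WithLp.toLp 2) '' (Set.Icc (0 : Fin J → ℝ) (fun i => z i)) := by
    ext x
    constructor
    · intro hx
      exact ⟨x.ofLp, ⟨fun i => (hx i).1, fun i => (hx i).2⟩, rfl⟩
    · rintro ⟨y, hy, rfl⟩ i
      exact ⟨hy.1 i, hy.2 i⟩
  rw [this]
  exact h.image (PiLp.continuous_toLp 2 _)

theorem domainG_subset_closedBox {J : ℕ} [NeZero J] (z : State J) : domainG z ⊆ closedBox z := by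
  intro x hx i
  refine ⟨hx.1 i, ?_⟩
  by_cases h : i = 0
  · exact h ▸ hx.2.1.le
  · exact hx.2.2 i h

theorem mem_domainG_iff {J : ℕ} [NeZero J] {z x : State J} :
    x ∈ domainG z ↔ x ∈ closedBox z ∧ x 0 < z 0 :=
  ⟨fun h => ⟨domainG_subset_closedBox z h, h.2.1⟩,
    fun h => ⟨fun i => (h.1 i).1, h.2, fun i _ => (h.1 i).2⟩⟩

theorem closure_domainG {J : ℕ} [NeZero J] {z : State J} (hz : ∀ i, 0 < z i) :
    closure (domainG z) = closedBox z := by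
  apply subset_antisymm
  · exact closure_minimal (domainG_subset_closedBox z) (isClosed_closedBox z)
  · intro x hx
    -- shrinking towards the origin moves the rectangle into `G`
    have h1 : Tendsto (fun t : ℝ => t • x) (𝓝[<] 1) (𝓝 x) := by
      have : Tendsto (fun t : ℝ => t • x) (𝓝 1) (𝓝 ((1 : ℝ) • x)) :=
        (continuous_id.smul continuous_const).tendsto 1
      rw [one_smul] at this
      exact this.mono_left nhdsWithin_le_nhds
    refine mem_closure_of_tendsto h1 ?_
    filter_upwards [Ioo_mem_nhdsLT (show (0 : ℝ) < 1 by norm_num)] with t ht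
    have hle : ∀ i, t * x i ≤ x i := fun i => by nlinarith [(hx i).1, ht.2]
    rw [mem_domainG_iff]
    refine ⟨fun i => ⟨mul_nonneg ht.1.le (hx i).1, (hle i).trans (hx i).2⟩, ?_⟩
    show t * x 0 < z 0
    have := hx 0
    nlinarith [hz 0, ht.1, ht.2]

/-! ### The explicit function -/

theorem minFun_le {J : ℕ} [NeZero J] (β : Fin J → ℝ) (z x : State J) (i : Fin J) :
    minFun β z x ≤ β i * ∑ j ∈ Finset.Iic i, (z j - x j) := by
  have := Finset.inf'_le (s := Finset.univ) (fun i => inner ℝ (bVec β i) (z - x))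
    (Finset.mem_univ i)
  rwa [inner_bVec] at this

theorem le_minFun {J : ℕ} [NeZero J] {β : Fin J → ℝ} {z x : State J} {r : ℝ}
    (h : ∀ i, r ≤ β i * ∑ j ∈ Finset.Iic i, (z j - x j)) : r ≤ minFun β z x := by
  refine Finset.le_inf' _ _ fun i _ => ?_
  rw [inner_bVec]
  exact h i

theorem exists_minFun_eq {J : ℕ} [NeZero J] (β : Fin J → ℝ) (z x : State J) :
    ∃ i, minFun β z x = β i * ∑ j ∈ Finset.Iic i, (z j - x j) := by
  obtain ⟨i, -, hi⟩ := Finset.exists_mem_eq_inf' (s := Finset.univ) Finset.univ_nonempty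
    (fun i => inner ℝ (bVec β i) (z - x))
  refine ⟨i, hi.trans ?_⟩
  rw [inner_bVec]
  rfl

theorem Iic_zero_eq {J : ℕ} [NeZero J] : Finset.Iic (0 : Fin J) = {0} := by
  ext i
  simp

theorem minFun_nonneg {J : ℕ} [NeZero J] {β : Fin J → ℝ} {z x : State J} (hβ : ∀ i, 0 < β i)
    (hx : x ∈ closedBox z) : 0 ≤ minFun β z x :=
  le_minFun fun i => mul_nonneg (hβ i).le (Finset.sum_nonneg fun j _ => sub_nonneg.2 (hx j).2)

theorem continuous_minFun {J : ℕ} [NeZero J] (β : Fin J → ℝ) (z : State J) :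
    Continuous (minFun β z) := by
  unfold minFun
  exact Continuous.finset_inf'_apply _ fun i _ => by fun_prop

theorem isLipschitz_minFun {J : ℕ} [NeZero J] (β : Fin J → ℝ) (z : State J) :
    IsLipschitz z (minFun β z) := by
  refine ⟨∑ i, ‖bVec β i‖₊, LipschitzOnWith.of_dist_le_mul fun x _ y _ => ?_⟩
  have key : ∀ x y, minFun β z x - minFun β z y ≤ (∑ i, ‖bVec β i‖) * ‖x - y‖ := by
    intro x y
    obtain ⟨i, hi⟩ := exists_minFun_eq β z y
    have h1 := minFun_le β z x i
    replace hi : minFun β z y = inner ℝ (bVec β i) (z - y) := by rw [inner_bVec]; exact hi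
    replace h1 : minFun β z x ≤ inner ℝ (bVec β i) (z - x) := by rw [inner_bVec]; exact h1
    have h2 : inner ℝ (bVec β i) (z - x) - inner ℝ (bVec β i) (z - y) =
        inner ℝ (bVec β i) (y - x) := by
      rw [← inner_sub_right]; congr 1; abel
    calc _ ≤ inner ℝ (bVec β i) (y - x) := by linarith
      _ ≤ ‖bVec β i‖ * ‖y - x‖ := real_inner_le_norm _ _
      _ ≤ _ := by
        rw [norm_sub_rev y x]
        gcongr
        exact Finset.single_le_sum (f := fun i => ‖bVec β i‖) (fun i _ => norm_nonneg _)
          (Finset.mem_univ i)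
  have h1 := key x y
  have h2 := key y x
  rw [norm_sub_rev y x] at h2
  rw [Real.dist_eq, dist_eq_norm, abs_le]
  push_cast
  constructor <;> linarith

theorem minFun_eq_zero {J : ℕ} [NeZero J] {β : Fin J → ℝ} {z x : State J} (hβ : ∀ i, 0 < β i)
    (hx : x ∈ boundaryO z) (hz : ∀ i, 0 < z i) : minFun β z x = 0 := by
  apply le_antisymm
  · have := minFun_le β z x 0
    simpa [Iic_zero_eq, hx.1] using this
  · refine minFun_nonneg hβ fun i => ?_
    by_cases h : i = 0
    · subst h
      exact ⟨hx.1 ▸ (hz _).le, hx.1.le⟩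
    · exact hx.2 i h

/-! ### A lower bound for the Hamiltonian -/

/-- Jensen's inequality for the exponential and a sub-probability. -/
theorem exp_sum_le {ι : Type*} (s : Finset ι) {τ x : ι → ℝ} (h0 : ∀ i ∈ s, 0 ≤ τ i)
    (h1 : ∑ i ∈ s, τ i ≤ 1) :
    Real.exp (∑ i ∈ s, τ i * x i) ≤ 1 + ∑ i ∈ s, τ i * (Real.exp (x i) - 1) := by
  set m := ∑ i ∈ s, τ i * x i with hm
  have tangent : ∀ y, Real.exp m * (1 + y - m) ≤ Real.exp y := by
    intro y
    have h2 := Real.add_one_le_exp (y - m)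
    have h3 : Real.exp m * Real.exp (y - m) = Real.exp y := by rw [← Real.exp_add]; ring_nf
    nlinarith [mul_le_mul_of_nonneg_left h2 (Real.exp_pos m).le]
  have h4 : ∑ i ∈ s, τ i * (Real.exp m * (1 + x i - m)) ≤ ∑ i ∈ s, τ i * Real.exp (x i) :=
    Finset.sum_le_sum fun i hi => mul_le_mul_of_nonneg_left (tangent _) (h0 i hi)
  have h5 : ∑ i ∈ s, τ i * (Real.exp m * (1 + x i - m)) =
      Real.exp m * ((1 - m) * ∑ i ∈ s, τ i + m) := by
    conv_rhs => rw [hm, Finset.mul_sum, ← Finset.sum_add_distrib, Finset.mul_sum]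
    exact Finset.sum_congr rfl fun i _ => by ring
  have h6 : ∑ i ∈ s, τ i * (Real.exp (x i) - 1) =
      ∑ i ∈ s, τ i * Real.exp (x i) - ∑ i ∈ s, τ i := by
    rw [← Finset.sum_sub_distrib]
    exact Finset.sum_congr rfl fun i _ => by ring
  have h7 := tangent 0
  rw [Real.exp_zero] at h7
  rw [h6]
  nlinarith [mul_le_mul_of_nonneg_left h7 (sub_nonneg.2 h1)]

/-- Truncation of `x` to the interval `[a, b]`. -/
def clamp (a b x : ℝ) : ℝ := max a (min x b)

/-- Both sides are the length of `[a, b] ∩ [c, d]`. -/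
theorem clamp_sub_clamp {a b c d : ℝ} (hab : a ≤ b) (hcd : c ≤ d) :
    clamp a b d - clamp a b c = clamp c d b - clamp c d a := by
  unfold clamp
  grind

theorem clamp_mono (a b : ℝ) : Monotone (clamp a b) := by
  intro x y h
  unfold clamp
  gcongr

theorem lt_of_clamp_lt {a b c d : ℝ} (hab : a ≤ b) (h : clamp a b c < clamp a b d) :
    c < b ∧ a < d ∧ c < d := by
  unfold clamp at h
  grind

/-- The running maximum of `k ↦ min 0 (p k)`. -/
def runMax (p : ℕ → ℝ) : ℕ → ℝ
  | 0 => min 0 (p 0)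
  | k + 1 => max (runMax p k) (min 0 (p (k + 1)))

theorem runMax_nonpos (p : ℕ → ℝ) (k : ℕ) : runMax p k ≤ 0 := by
  induction k with
  | zero => exact min_le_left _ _
  | succ k ih => exact max_le ih (min_le_left _ _)

theorem monotone_runMax (p : ℕ → ℝ) : Monotone (runMax p) :=
  monotone_nat_of_le_succ fun _ => le_max_left _ _

theorem le_runMax_self (p : ℕ → ℝ) (k : ℕ) : min 0 (p k) ≤ runMax p k := by
  cases k with
  | zero => exact le_rfl
  | succ k => exact le_max_right _ _

theorem runMax_succ_sub_le (p : ℕ → ℝ) (k : ℕ) :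
    runMax p (k + 1) - runMax p k ≤ max 0 (p (k + 1) - p k) := by
  have h1 := le_runMax_self p k
  have h2 := runMax_nonpos p k
  have h3 : runMax p (k + 1) = max (runMax p k) (min 0 (p (k + 1))) := rfl
  rw [h3]
  grind

/-- The partial sums `-∑_{i ≥ k} w_i` of the gradient of a combination of the functions
`b_i · (z - x)`. -/
def tailSum {J : ℕ} (w : Fin J → ℝ) (k : ℕ) : ℝ := -∑ i : Fin J, if k ≤ i.val then w i else 0

theorem tailSum_self {J : ℕ} (w : Fin J → ℝ) : tailSum w J = 0 := by
  unfold tailSum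
  rw [neg_eq_zero]
  exact Finset.sum_eq_zero fun i _ => if_neg (not_le.2 i.2)

theorem tailSum_succ_sub {J : ℕ} (w : Fin J → ℝ) (i : Fin J) :
    tailSum w (i + 1) - tailSum w i = w i := by
  unfold tailSum
  rw [neg_sub_neg, ← Finset.sum_sub_distrib, Finset.sum_eq_single i]
  · simp
  · intro j _ hj
    have : j.val ≠ i.val := fun h => hj (Fin.ext h)
    grind
  · simp

theorem monotone_tailSum {J : ℕ} {w : Fin J → ℝ} (hw : ∀ i, 0 ≤ w i) : Monotone (tailSum w) := by
  intro k l h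
  unfold tailSum
  refine neg_le_neg (Finset.sum_le_sum fun i _ => ?_)
  have := hw i
  split_ifs <;> first | omega | linarith

theorem sum_fin_sub {J : ℕ} (f : ℕ → ℝ) : ∑ k : Fin J, (f (k + 1) - f k) = f J - f 0 := by
  rw [Fin.sum_univ_eq_sum_range (fun k => f (k + 1) - f k), Finset.sum_range_sub]

/-- Lower bound for the Hamiltonian at a perturbation `p` of the convex combination
`q = -∑ θ_i b_i`, where an index `i` is good if no perturbation can shift the jump of `q` at `i` to
an index `k` with `β_k < β_i`.

For a level `h` between `p_0` and `0`, let `i` be the index at which `q` crosses `h` and let `k` be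
the first index at which `p` does. If `k > i`, then `p < q` on `(i, k]`. So for good `i` the
exponent `β_k` is at least `β_i`. The lengths `T i k` of the sets of levels with given `i` and `k`
therefore transport the jumps of `q` to those of `p` with no loss in the exponent, and
convexity of the exponential does the rest. -/
theorem le_hamExp {J : ℕ} [NeZero J] {c lam ε : ℝ} {mu β θ : Fin J → ℝ} {p : State J}
    (hc : 0 < c) (hlam : 0 < lam) (hmu : ∀ i, 0 < mu i)
    (hβ : ∀ i, IsPositiveRoot c lam (mu i) (β i)) (hε : 0 ≤ ε)
    (hθ : ∀ i, 0 ≤ θ i) (hθ1 : ∑ i, θ i ≤ 1 - ε)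
    (h0 : tailSum (fun i => θ i * β i) 0 ≤ p 0) (good : Finset (Fin J))
    (hgood : ∀ i ∈ good, ∀ k : Fin J, (k < i ∨ (i < k ∧ ∀ j : Fin J, i < j → j ≤ k →
      p j < tailSum (fun i => θ i * β i) j)) → β i ≤ β k) :
    ε * c - ∑ i ∈ goodᶜ, θ i * (mu i * (1 - Real.exp (-β i))) ≤ hamExp c lam mu p := by
  have hβ0 : ∀ i, 0 < β i := fun i => (hβ i).1
  set M : Fin J → ℝ := fun i => mu i * (1 - Real.exp (-β i)) with hM
  have hM0 : ∀ i, 0 ≤ M i := fun i => by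
    have : Real.exp (-β i) < 1 := by rw [Real.exp_lt_one_iff]; linarith [hβ0 i]
    exact mul_nonneg (hmu i).le (by linarith)
  have hbad : 0 ≤ ∑ i ∈ goodᶜ, θ i * M i :=
    Finset.sum_nonneg fun i _ => mul_nonneg (hθ i) (hM0 i)
  have hε1 : ε ≤ 1 := by
    have := Finset.sum_nonneg fun i (_ : i ∈ Finset.univ) => hθ i
    linarith
  have hserv : ∀ k : Fin J, 0 ≤ mu k * max 0 (1 - Real.exp (coord p k - coord p (k + 1))) :=
    fun k => mul_nonneg (hmu k).le (le_max_left _ _)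
  rcases le_or_gt 0 (p 0) with hp0 | hp0
  · have h1 : Real.exp (-p 0) ≤ 1 := by rw [Real.exp_le_one_iff]; linarith
    have h2 := Finset.sum_nonneg fun k (_ : k ∈ Finset.univ) => hserv k
    unfold hamExp
    nlinarith
  set q := tailSum (fun i => θ i * β i) with hq
  have hqmono : Monotone q := monotone_tailSum fun i => mul_nonneg (hθ i) (hβ0 i).le
  set P := runMax (coord p) with hP
  have hPmono : Monotone P := monotone_runMax _
  have hP0 : P 0 = p 0 := by
    have h1 : coord p 0 = p 0 := by
      have := coord_val p 0
      simpa using this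
    show min 0 (coord p 0) = p 0
    rw [h1, min_eq_right hp0.le]
  have hPJ : P J = 0 := by
    apply le_antisymm (runMax_nonpos _ _)
    have := le_runMax_self (coord p) J
    rwa [coord_self, min_self] at this
  set T : Fin J → Fin J → ℝ := fun i k => clamp (q i) (q (i + 1)) (P (k + 1)) -
    clamp (q i) (q (i + 1)) (P k) with hT
  have hT0 : ∀ i k, 0 ≤ T i k := fun i k =>
    sub_nonneg.2 (clamp_mono _ _ (hPmono (Nat.le_succ _)))
  have hTi : ∀ i, ∑ k, T i k ≤ θ i * β i := by
    intro i
    rw [hT]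
    dsimp only
    rw [sum_fin_sub fun k => clamp (q i) (q (i + 1)) (P k)]
    rw [← tailSum_succ_sub (fun i => θ i * β i) i, ← hq]
    have : q i ≤ q (i + 1) := hqmono (Nat.le_succ _)
    unfold clamp
    grind
  have hTk : ∀ k, ∑ i, T i k = P (k + 1) - P k := by
    intro k
    have h1 : ∀ i, T i k = clamp (P k) (P (k + 1)) (q (i + 1)) - clamp (P k) (P (k + 1)) (q i) :=
      fun i => clamp_sub_clamp (hqmono (Nat.le_succ _)) (hPmono (Nat.le_succ _))
    simp_rw [h1]
    rw [sum_fin_sub fun i => clamp (P k) (P (k + 1)) (q i)]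
    have h2 : q J = 0 := tailSum_self _
    have h3 : P (k + 1) ≤ 0 := runMax_nonpos _ _
    have h4 : P 0 ≤ P k := hPmono (Nat.zero_le _)
    have h5 : P k ≤ P (k + 1) := hPmono (Nat.le_succ _)
    unfold clamp
    grind
  -- a good jump is transported only to larger exponents
  have hTβ : ∀ i ∈ good, ∀ k, 0 < T i k → mu i ≤ mu k := by
    intro i hi k hik
    obtain ⟨h1, h2, h3⟩ := lt_of_clamp_lt (hqmono (Nat.le_succ _)) (sub_pos.1 hik)
    have : β i ≤ β k := by
      rcases lt_trichotomy k i with h | h | h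
      · exact hgood i hi k (Or.inl h)
      · rw [h]
      · refine hgood i hi k (Or.inr ⟨h, fun j hij hjk => ?_⟩)
        have h4 : min 0 (coord p j) ≤ P k := (le_runMax_self _ _).trans (hPmono hjk)
        have h5 : q (i + 1) ≤ q j := hqmono hij
        have h6 : P k < 0 := h3.trans_le (runMax_nonpos _ _)
        rw [coord_val] at h4
        grind
    exact (hβ k).mu_le hlam (hmu i) hc (hβ i) this
  set τ : Fin J → Fin J → ℝ := fun i k => T i k / β i with hτ
  have hτ0 : ∀ i k, 0 ≤ τ i k := fun i k => div_nonneg (hT0 i k) (hβ0 i).le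
  have hτT : ∀ i k, τ i k * β i = T i k := fun i k => div_mul_cancel₀ _ (hβ0 i).ne'
  have hτi : ∀ i, ∑ k, τ i k ≤ θ i := by
    intro i
    rw [hτ]
    dsimp only
    rw [← Finset.sum_div, div_le_iff₀ (hβ0 i)]
    exact hTi i
  have hτ1 : ∑ i, ∑ k, τ i k ≤ 1 - ε := (Finset.sum_le_sum fun i _ => hτi i).trans hθ1
  -- the arrival term
  have arrival : Real.exp (-p 0) ≤ 1 + ∑ i, (∑ k, τ i k) * (Real.exp (β i) - 1) := by
    have h1 : -p 0 = ∑ i, (∑ k, τ i k) * β i := by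
      simp_rw [Finset.sum_mul, hτT]
      rw [Finset.sum_comm]
      simp_rw [hTk]
      rw [sum_fin_sub P, hPJ, hP0]
      ring
    rw [h1]
    exact exp_sum_le _ (fun i _ => Finset.sum_nonneg fun k _ => hτ0 i k) (by linarith)
  -- the service terms
  have service : ∀ k, ∑ i ∈ good, τ i k * M i ≤
      mu k * max 0 (1 - Real.exp (coord p k - coord p (k + 1))) := by
    intro k
    have h1 : ∑ i ∈ good, τ i k * (1 - Real.exp (-β i)) ≤
        max 0 (1 - Real.exp (coord p k - coord p (k + 1))) := by
      have h2 : ∑ i ∈ good, τ i k ≤ 1 := by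
        calc ∑ i ∈ good, τ i k ≤ ∑ i, τ i k :=
              Finset.sum_le_sum_of_subset_of_nonneg (Finset.subset_univ _) fun i _ _ => hτ0 i k
          _ ≤ ∑ i, ∑ k, τ i k := Finset.sum_le_sum fun i _ =>
              Finset.single_le_sum (fun k _ => hτ0 i k) (Finset.mem_univ k)
          _ ≤ 1 := by linarith
      have h3 := exp_sum_le good (x := fun i => -β i) (fun i _ => hτ0 i k) h2
      have h4 : ∑ i ∈ good, τ i k * β i ≤ max 0 (coord p (k + 1) - coord p k) := by
        refine le_trans ?_ (runMax_succ_sub_le (coord p) k)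
        rw [← hP, ← hTk]
        simp_rw [hτT]
        exact Finset.sum_le_sum_of_subset_of_nonneg (Finset.subset_univ _) fun i _ _ => hT0 i k
      have h5 : ∑ i ∈ good, τ i k * -β i = -∑ i ∈ good, τ i k * β i := by
        rw [← Finset.sum_neg_distrib]
        exact Finset.sum_congr rfl fun i _ => by ring
      have h6 : ∑ i ∈ good, τ i k * (1 - Real.exp (-β i)) =
          -∑ i ∈ good, τ i k * (Real.exp (-β i) - 1) := by
        rw [← Finset.sum_neg_distrib]
        exact Finset.sum_congr rfl fun i _ => by ring
      rw [h5] at h3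
      rw [h6]
      rcases le_total 0 (coord p (k + 1) - coord p k) with hd | hd
      · rw [max_eq_right hd] at h4
        refine le_trans ?_ (le_max_right _ _)
        have : Real.exp (coord p k - coord p (k + 1)) ≤
            Real.exp (-∑ i ∈ good, τ i k * β i) := Real.exp_le_exp.2 (by linarith)
        linarith
      · rw [max_eq_left hd] at h4
        refine le_trans ?_ (le_max_left _ _)
        have : 1 ≤ Real.exp (-∑ i ∈ good, τ i k * β i) := Real.one_le_exp (by linarith)
        linarith
    refine le_trans ?_ (mul_le_mul_of_nonneg_left h1 (hmu k).le)
    rw [Finset.mul_sum]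
    refine Finset.sum_le_sum fun i hi => ?_
    have h2 : 0 ≤ 1 - Real.exp (-β i) := by
      have : Real.exp (-β i) < 1 := by rw [Real.exp_lt_one_iff]; linarith [hβ0 i]
      linarith
    rcases (hT0 i k).eq_or_lt with h | h
    · have : τ i k = 0 := by rw [hτ]; simp [← h]
      rw [this]; simp
    · have := hTβ i hi k h
      calc τ i k * M i = (τ i k * (1 - Real.exp (-β i))) * mu i := by rw [hM]; ring
        _ ≤ (τ i k * (1 - Real.exp (-β i))) * mu k := by
          gcongr
          exact mul_nonneg (hτ0 i k) h2
        _ = _ := by ring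
  have hroot : ∀ i, lam * (Real.exp (β i) - 1) = c + M i := fun i => by
    have := (hβ i).2
    rw [hM]
    linarith
  have h1 : lam * (1 - Real.exp (-p 0)) ≥ -∑ i, (∑ k, τ i k) * (c + M i) := by
    have : ∑ i, (∑ k, τ i k) * (c + M i) = lam * ∑ i, (∑ k, τ i k) * (Real.exp (β i) - 1) := by
      rw [Finset.mul_sum]
      refine Finset.sum_congr rfl fun i _ => ?_
      rw [← hroot]; ring
    rw [this]
    nlinarith
  have h2 : ∑ i, (∑ k, τ i k) * (c + M i) =
      c * (∑ i, ∑ k, τ i k) + (∑ i ∈ good, (∑ k, τ i k) * M i +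
        ∑ i ∈ goodᶜ, (∑ k, τ i k) * M i) := by
    rw [Finset.sum_add_sum_compl, Finset.mul_sum, ← Finset.sum_add_distrib]
    exact Finset.sum_congr rfl fun i _ => by ring
  have h3 : ∑ i ∈ goodᶜ, (∑ k, τ i k) * M i ≤ ∑ i ∈ goodᶜ, θ i * M i :=
    Finset.sum_le_sum fun i _ => mul_le_mul_of_nonneg_right (hτi i) (hM0 i)
  have h4 : ∑ i ∈ good, (∑ k, τ i k) * M i ≤
      ∑ k : Fin J, mu k * max 0 (1 - Real.exp (coord p k - coord p (k + 1))) := by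
    simp_rw [Finset.sum_mul]
    rw [Finset.sum_comm]
    exact Finset.sum_le_sum fun k _ => service k
  unfold hamExp
  nlinarith

/-! ### Smooth strict subsolutions -/

/-- The affine functions `b_i · (z - x)` with the first edge of the rectangle moved by `κ`, which
keeps functions with different exponents apart up to the edge. -/
def shiftedLevel {J : ℕ} (β : Fin J → ℝ) (z : State J) (κ : ℝ) (i : Fin J) (x : State J) : ℝ :=
  inner ℝ (bVec β i) (z - x) + β i * κ

/-- The smooth approximation `-δ log ∑ exp (-V_i / δ)` of the minimum of the shifted levels. -/
def softMin {J : ℕ} (β : Fin J → ℝ) (z : State J) (κ δ : ℝ) (x : State J) : ℝ :=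
  -δ * Real.log (∑ i, Real.exp (-shiftedLevel β z κ i x / δ))

/-- The weights of the vectors `-b_i` in the gradient of `softMin`. -/
def softWeight {J : ℕ} (β : Fin J → ℝ) (z : State J) (κ δ : ℝ) (x : State J) (i : Fin J) : ℝ :=
  Real.exp (-shiftedLevel β z κ i x / δ) / ∑ j, Real.exp (-shiftedLevel β z κ j x / δ)

theorem sum_exp_pos {J : ℕ} [NeZero J] (β : Fin J → ℝ) (z : State J) (κ δ : ℝ) (x : State J) :
    0 < ∑ j, Real.exp (-shiftedLevel β z κ j x / δ) :=
  Finset.sum_pos (fun _ _ => Real.exp_pos _) Finset.univ_nonempty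

theorem softWeight_nonneg {J : ℕ} [NeZero J] (β : Fin J → ℝ) (z : State J) (κ δ : ℝ) (x : State J)
    (i : Fin J) : 0 ≤ softWeight β z κ δ x i :=
  div_nonneg (Real.exp_pos _).le (sum_exp_pos _ _ _ _ _).le

theorem sum_softWeight {J : ℕ} [NeZero J] (β : Fin J → ℝ) (z : State J) (κ δ : ℝ) (x : State J) :
    ∑ i, softWeight β z κ δ x i = 1 := by
  unfold softWeight
  rw [← Finset.sum_div, div_self (sum_exp_pos _ _ _ _ _).ne']

theorem softWeight_le {J : ℕ} [NeZero J] {β : Fin J → ℝ} {z : State J} {κ δ g : ℝ} (hδ : 0 < δ)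
    {x : State J} {i k : Fin J} (h : shiftedLevel β z κ k x + g ≤ shiftedLevel β z κ i x) :
    softWeight β z κ δ x i ≤ Real.exp (-g / δ) := by
  unfold softWeight
  rw [div_le_iff₀ (sum_exp_pos _ _ _ _ _)]
  calc Real.exp (-shiftedLevel β z κ i x / δ)
      ≤ Real.exp (-g / δ) * Real.exp (-shiftedLevel β z κ k x / δ) := by
        rw [← Real.exp_add, ← add_div]
        gcongr
        linarith
    _ ≤ _ := by
        gcongr
        exact Finset.single_le_sum (f := fun k => Real.exp (-shiftedLevel β z κ k x / δ))
          (fun _ _ => (Real.exp_pos _).le) (Finset.mem_univ k)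

theorem continuous_softWeight {J : ℕ} [NeZero J] (β : Fin J → ℝ) (z : State J) (κ δ : ℝ)
    (i : Fin J) : Continuous fun x => softWeight β z κ δ x i := by
  unfold softWeight shiftedLevel
  refine Continuous.div (by fun_prop) (by fun_prop) fun x => (sum_exp_pos β z κ δ x).ne'

theorem softMin_le {J : ℕ} [NeZero J] {β : Fin J → ℝ} {z : State J} {κ δ : ℝ} (hδ : 0 < δ)
    (x : State J) (i : Fin J) : softMin β z κ δ x ≤ shiftedLevel β z κ i x := by
  have h1 : -shiftedLevel β z κ i x / δ ≤ Real.log (∑ i, Real.exp (-shiftedLevel β z κ i x / δ)) := by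
    rw [Real.le_log_iff_exp_le (sum_exp_pos _ _ _ _ _)]
    exact Finset.single_le_sum (f := fun k => Real.exp (-shiftedLevel β z κ k x / δ))
          (fun _ _ => (Real.exp_pos _).le) (Finset.mem_univ i)
  rw [div_le_iff₀ hδ] at h1
  unfold softMin
  linarith

theorem le_softMin {J : ℕ} [NeZero J] {β : Fin J → ℝ} {z : State J} {κ δ r : ℝ} (hδ : 0 < δ)
    {x : State J} (h : ∀ i, r ≤ shiftedLevel β z κ i x) :
    r - δ * Real.log J ≤ softMin β z κ δ x := by
  have hJ : (0 : ℝ) < J := Nat.cast_pos.2 (Nat.pos_of_ne_zero (NeZero.ne J))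
  have h1 : Real.log (∑ i, Real.exp (-shiftedLevel β z κ i x / δ)) ≤ Real.log J + -r / δ := by
    rw [Real.log_le_iff_le_exp (sum_exp_pos _ _ _ _ _), Real.exp_add, Real.exp_log hJ]
    calc _ ≤ ∑ _i : Fin J, Real.exp (-r / δ) := by
          refine Finset.sum_le_sum fun i _ => ?_
          gcongr
          exact h i
      _ = _ := by simp
  have h2 := mul_le_mul_of_nonneg_left h1 hδ.le
  have h3 : δ * (-r / δ) = -r := by field_simp
  unfold softMin
  linarith

theorem hasFDerivAt_shiftedLevel {J : ℕ} (β : Fin J → ℝ) (z : State J) (κ : ℝ) (i : Fin J)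
    (x : State J) : HasFDerivAt (shiftedLevel β z κ i) (-innerSL ℝ (bVec β i)) x := by
  have h1 : HasFDerivAt (fun x : State J => z - x) (-ContinuousLinearMap.id ℝ (State J)) x :=
    (hasFDerivAt_id x).const_sub z
  have h2 := ((innerSL ℝ (bVec β i)).hasFDerivAt (x := z - x)).comp x h1
  have h3 := h2.add_const (β i * κ)
  refine (h3.congr_fderiv ?_)
  ext v
  simp

theorem tailSum_eq_inner {J : ℕ} (θ β : Fin J → ℝ) (v : State J) :
    ∑ k : Fin J, tailSum (fun i => θ i * β i) k * v k = -∑ i, θ i * inner ℝ (bVec β i) v := by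
  simp_rw [inner_eq_sum, bVec_apply, tailSum, Finset.mul_sum, neg_mul, Finset.sum_mul]
  rw [Finset.sum_neg_distrib, Finset.sum_comm]
  congr 1
  refine Finset.sum_congr rfl fun i _ => Finset.sum_congr rfl fun k _ => ?_
  simp only [Fin.le_def]
  split_ifs <;> ring

theorem hasFDerivAt_softMin {J : ℕ} [NeZero J] (β : Fin J → ℝ) (z : State J) {κ δ : ℝ} (hδ : 0 < δ)
    (x : State J) : HasFDerivAt (softMin β z κ δ)
      (-∑ i, softWeight β z κ δ x i • innerSL ℝ (bVec β i)) x := by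
  have h1 : ∀ i, HasFDerivAt (fun x => Real.exp (-shiftedLevel β z κ i x / δ))
      (Real.exp (-shiftedLevel β z κ i x / δ) • (δ⁻¹ • innerSL ℝ (bVec β i))) x := by
    intro i
    have h := ((hasFDerivAt_shiftedLevel β z κ i x).neg.mul_const δ⁻¹).exp
    simp only [neg_neg] at h
    exact h
  have h2 := ((HasFDerivAt.fun_sum (u := Finset.univ) fun i _ => h1 i).log
    (sum_exp_pos β z κ δ x).ne').const_mul (-δ)
  refine h2.congr_fderiv ?_
  rw [Finset.smul_sum, Finset.smul_sum, ← Finset.sum_neg_distrib]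
  refine Finset.sum_congr rfl fun i _ => ?_
  rw [smul_smul, smul_smul, smul_smul, ← neg_smul]
  congr 1
  unfold softWeight
  field_simp

theorem hasDerivAt_max_sq (t : ℝ) : HasDerivAt (fun t : ℝ => (max 0 t) ^ 2) (2 * max 0 t) t := by
  rcases lt_trichotomy t 0 with h | rfl | h
  · have : (fun t : ℝ => (max 0 t) ^ 2) =ᶠ[𝓝 t] fun _ => 0 := by
      filter_upwards [Iio_mem_nhds h] with s hs
      rw [max_eq_left (le_of_lt hs)]; simp
    rw [max_eq_left h.le, mul_zero]
    exact (hasDerivAt_const t (0 : ℝ)).congr_of_eventuallyEq this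
  · rw [hasDerivAt_iff_isLittleO]
    simp only [max_self, mul_zero, smul_zero, sub_zero, ne_eq, OfNat.ofNat_ne_zero,
      not_false_eq_true, zero_pow]
    have h1 : (fun t : ℝ => (max 0 t) ^ 2) =O[𝓝 0] fun t : ℝ => t ^ 2 := by
      refine Asymptotics.IsBigO.of_bound 1 (Eventually.of_forall fun s => ?_)
      rw [Real.norm_of_nonneg (by positivity), Real.norm_of_nonneg (by positivity), one_mul]
      rcases le_total 0 s with hs | hs
      · rw [max_eq_right hs]
      · rw [max_eq_left hs]; simp; positivity
    exact h1.trans_isLittleO (Asymptotics.isLittleO_pow_id (by norm_num))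
  · have : (fun t : ℝ => (max 0 t) ^ 2) =ᶠ[𝓝 t] fun t => t ^ 2 := by
      filter_upwards [Ioi_mem_nhds h] with s hs
      rw [max_eq_right (le_of_lt hs)]
    rw [max_eq_right h.le]
    have := (hasDerivAt_pow 2 t).congr_of_eventuallyEq this
    simpa using this

/-- A concave function on `[0, w]` whose derivative `barrierSlope` is `A` at `0` and `-B` at `w` and
vanishes at distance at least `ρ` from the endpoints. -/
def barrier (ρ A B w t : ℝ) : ℝ :=
  -(A / (2 * ρ)) * (max 0 (ρ - t)) ^ 2 - B / (2 * ρ) * (max 0 (t - (w - ρ))) ^ 2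

/-- The derivative of `barrier`. -/
def barrierSlope (ρ A B w t : ℝ) : ℝ := A / ρ * max 0 (ρ - t) - B / ρ * max 0 (t - (w - ρ))

theorem hasDerivAt_barrier {ρ : ℝ} (hρ : 0 < ρ) (A B w t : ℝ) :
    HasDerivAt (barrier ρ A B w) (barrierSlope ρ A B w t) t := by
  have h1 : HasDerivAt (fun t : ℝ => ρ - t) (-1) t := (hasDerivAt_id t).const_sub ρ
  have h2 : HasDerivAt (fun t : ℝ => t - (w - ρ)) 1 t := (hasDerivAt_id t).sub_const _
  have h3 := ((hasDerivAt_max_sq (ρ - t)).comp t h1).const_mul (-(A / (2 * ρ)))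
  have h4 := ((hasDerivAt_max_sq (t - (w - ρ))).comp t h2).const_mul (B / (2 * ρ))
  refine (h3.sub h4).congr_deriv ?_
  unfold barrierSlope
  field_simp

theorem barrier_nonpos {ρ A B : ℝ} (hρ : 0 < ρ) (hA : 0 ≤ A) (hB : 0 ≤ B) (w t : ℝ) :
    barrier ρ A B w t ≤ 0 := by
  unfold barrier
  have h1 : 0 ≤ A / (2 * ρ) * (max 0 (ρ - t)) ^ 2 := by positivity
  have h2 : 0 ≤ B / (2 * ρ) * (max 0 (t - (w - ρ))) ^ 2 := by positivity
  linarith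

theorem le_barrier {ρ A B w t : ℝ} (hρ : 0 < ρ) (hA : 0 ≤ A) (hB : 0 ≤ B) (ht : 0 ≤ t)
    (htw : t ≤ w) : -((A + B) * ρ / 2) ≤ barrier ρ A B w t := by
  have h1 : (max 0 (ρ - t)) ^ 2 ≤ ρ ^ 2 := by
    gcongr
    exact max_le hρ.le (by linarith)
  have h2 : (max 0 (t - (w - ρ))) ^ 2 ≤ ρ ^ 2 := by
    gcongr
    exact max_le hρ.le (by linarith)
  have h3 : A / (2 * ρ) * (max 0 (ρ - t)) ^ 2 ≤ A / (2 * ρ) * ρ ^ 2 := by gcongr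
  have h4 : B / (2 * ρ) * (max 0 (t - (w - ρ))) ^ 2 ≤ B / (2 * ρ) * ρ ^ 2 := by gcongr
  have h5 : A / (2 * ρ) * ρ ^ 2 + B / (2 * ρ) * ρ ^ 2 = (A + B) * ρ / 2 := by field_simp
  unfold barrier
  linarith

theorem barrierSlope_le {ρ A B w t : ℝ} (hρ : 0 < ρ) (hA : 0 ≤ A) (hB : 0 ≤ B) (ht : 0 ≤ t) :
    barrierSlope ρ A B w t ≤ A := by
  have h1 : A / ρ * max 0 (ρ - t) ≤ A / ρ * ρ := by
    gcongr
    exact max_le hρ.le (by linarith)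
  have h2 : 0 ≤ B / ρ * max 0 (t - (w - ρ)) := by positivity
  rw [div_mul_cancel₀ _ hρ.ne'] at h1
  unfold barrierSlope
  linarith

theorem le_barrierSlope {ρ A B w t : ℝ} (hρ : 0 < ρ) (hA : 0 ≤ A) (hB : 0 ≤ B) (ht : t ≤ w) :
    -B ≤ barrierSlope ρ A B w t := by
  have h1 : B / ρ * max 0 (t - (w - ρ)) ≤ B / ρ * ρ := by
    gcongr
    exact max_le hρ.le (by linarith)
  have h2 : 0 ≤ A / ρ * max 0 (ρ - t) := by positivity
  rw [div_mul_cancel₀ _ hρ.ne'] at h1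
  unfold barrierSlope
  linarith

theorem barrierSlope_zero {ρ A B w : ℝ} (hρ : 0 < ρ) (hw : ρ ≤ w) :
    barrierSlope ρ A B w 0 = A := by
  unfold barrierSlope
  rw [max_eq_left (a := (0 : ℝ)) (b := 0 - (w - ρ)) (by linarith), sub_zero, max_eq_right hρ.le]
  field_simp
  ring

theorem barrierSlope_top {ρ A B w : ℝ} (hρ : 0 < ρ) (hw : ρ ≤ w) :
    barrierSlope ρ A B w w = -B := by
  unfold barrierSlope
  rw [max_eq_left (a := (0 : ℝ)) (b := ρ - w) (by linarith), sub_sub_cancel, max_eq_right hρ.le]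
  field_simp
  ring

theorem barrierSlope_nonneg {ρ A B w t : ℝ} (hρ : 0 < ρ) (hA : 0 ≤ A) (ht : t ≤ w - ρ) :
    0 ≤ barrierSlope ρ A B w t := by
  unfold barrierSlope
  rw [max_eq_left (a := (0 : ℝ)) (b := t - (w - ρ)) (by linarith)]
  have : 0 ≤ A / ρ * max 0 (ρ - t) := by positivity
  linarith

/-- A continuously differentiable function within `e` of the explicit function from below, at which
the Hamiltonian is strictly positive. At a face `x_i = 0`, or `x_i = z_i` with
`i ≠ 0`, it increases into the rectangle with slope at least `K`, and it makes the services
that would leave the rectangle through the face unprofitable. -/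
structure SmoothSubsolution {J : ℕ} [NeZero J] (c lam : ℝ) (mu β : Fin J → ℝ) (z : State J)
    (e K : ℝ) where
  toFun : State J → ℝ
  grad : State J → State J
  hasFDerivAt : ∀ x, HasFDerivAt toFun (innerSL ℝ (grad x)) x
  continuous_grad : Continuous grad
  ge : ∀ x ∈ closedBox z, minFun β z x - e ≤ toFun x
  le : ∀ x ∈ closedBox z, toFun x ≤ minFun β z x
  nonpos : ∀ x : State J, z 0 ≤ x 0 → toFun x ≤ 0
  margin : ℝ
  margin_pos : 0 < margin
  ham_ge : ∀ x ∈ closedBox z, margin ≤ hamExp c lam mu (grad x)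
  lower_face : ∀ x ∈ closedBox z, ∀ i, x i = 0 →
    K ≤ grad x i ∧ coord (grad x) (i + 1) ≤ coord (grad x) i
  upper_face : ∀ x ∈ closedBox z, ∀ i, i ≠ 0 → x i = z i →
    grad x i ≤ -K ∧ ∀ j : Fin J, j.val + 1 = i.val → grad x i ≤ grad x j

theorem tailSum_nonpos {J : ℕ} {w : Fin J → ℝ} (hw : ∀ i, 0 ≤ w i) (k : ℕ) : tailSum w k ≤ 0 := by
  unfold tailSum
  rw [neg_nonpos]
  refine Finset.sum_nonneg fun i _ => ?_
  split_ifs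
  exacts [hw i, le_rfl]

theorem le_tailSum {J : ℕ} {w : Fin J → ℝ} (hw : ∀ i, 0 ≤ w i) (k : ℕ) :
    -∑ i, w i ≤ tailSum w k := by
  unfold tailSum
  refine neg_le_neg (Finset.sum_le_sum fun i _ => ?_)
  split_ifs
  exacts [le_rfl, hw i]

/-- If `β_k < β_i` and the jump of the gradient at `i` can be shifted to `k` by the barriers, then
the `i`-th level is far from being minimal. -/
theorem shiftedLevel_gap {J : ℕ} {β : Fin J → ℝ} {z x : State J} {κ ρ Δ B : ℝ}
    (hβ : ∀ i, 0 < β i) (hB : ∀ i, β i ≤ B) (hκ : 0 < κ) (hρ : 0 < ρ)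
    (hΔ : ∀ i k, β k < β i → Δ ≤ β i - β k) (hsmall : B * (J * ρ) ≤ Δ * κ / 2)
    (hx : x ∈ closedBox z) {i k : Fin J} (hki : β k < β i)
    (h : k < i ∨ (i < k ∧ ∀ j, i < j → j ≤ k → z j - ρ < x j)) :
    shiftedLevel β z κ k x + Δ * κ / 2 ≤ shiftedLevel β z κ i x := by
  unfold shiftedLevel
  rw [inner_bVec, inner_bVec]
  set Y : Fin J → ℝ := fun i => ∑ j ∈ Finset.Iic i, (z - x) j with hY
  have hy : ∀ j, 0 ≤ (z - x) j := fun j => sub_nonneg.2 (hx j).2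
  have hY0 : ∀ i, 0 ≤ Y i := fun i => Finset.sum_nonneg fun j _ => hy j
  change β k * Y k + β k * κ + Δ * κ / 2 ≤ β i * Y i + β i * κ
  have hd := hΔ i k hki
  have hdκ := mul_le_mul_of_nonneg_right hd hκ.le
  have hJρ : 0 ≤ B * (J * ρ) := by
    have := (hβ k).le.trans (hB k)
    positivity
  rcases h with h | ⟨h, hj⟩
  · have h1 : Y k ≤ Y i := Finset.sum_le_sum_of_subset_of_nonneg
      (Finset.Iic_subset_Iic.2 h.le) fun j _ _ => hy j
    have h2 := mul_le_mul hki.le h1 (hY0 k) (hβ i).le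
    linarith
  · have h1 : Y k ≤ Y i + J * ρ := by
      have hs : Finset.Iic k = Finset.Iic i ∪ Finset.Ioc i k := by
        ext j; simp; grind
      have hdisj : Disjoint (Finset.Iic i) (Finset.Ioc i k) := by
        rw [Finset.disjoint_left]; intro j; simp; grind
      rw [hY]
      dsimp only
      rw [hs, Finset.sum_union hdisj]
      gcongr
      calc ∑ j ∈ Finset.Ioc i k, (z - x) j ≤ ∑ _j ∈ Finset.Ioc i k, ρ := by
            refine Finset.sum_le_sum fun j hjm => ?_
            rw [Finset.mem_Ioc] at hjm
            have := hj j hjm.1 hjm.2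
            show z j - x j ≤ ρ
            linarith
        _ ≤ J * ρ := by
            rw [Finset.sum_const, nsmul_eq_mul]
            gcongr
            exact_mod_cast (Finset.card_le_univ _).trans_eq (Fintype.card_fin J)
    have h2 := mul_le_mul_of_nonneg_left h1 (hβ k).le
    have h3 := mul_le_mul_of_nonneg_right hki.le (hY0 i)
    have h4 : β k * (J * ρ) ≤ B * (J * ρ) := mul_le_mul_of_nonneg_right (hB k) (by positivity)
    linarith

theorem exists_gap {J : ℕ} (β : Fin J → ℝ) :
    ∃ Δ : ℝ, 0 < Δ ∧ ∀ i k, β k < β i → Δ ≤ β i - β k := by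
  have : ∀ᶠ Δ : ℝ in 𝓝[>] 0, ∀ i k, β k < β i → Δ ≤ β i - β k := by
    rw [eventually_all]; intro i
    rw [eventually_all]; intro k
    by_cases h : β k < β i
    · filter_upwards [Ioo_mem_nhdsGT (sub_pos.2 h)] with Δ hΔ _
      exact hΔ.2.le
    · exact Eventually.of_forall fun _ h' => absurd h' h
  obtain ⟨Δ, h1, h2⟩ := (this.and self_mem_nhdsWithin).exists
  exact ⟨Δ, h2, h1⟩

set_option maxHeartbeats 1000000 in
/-- The subsolution is a contracted smooth minimum of the shifted levels plus the barriers. The jump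
of its gradient at an index `i` can be shifted to some `k` with `β_k < β_i` only in the layers at the
faces, where the level `i` is far from being minimal and has a small weight. -/
theorem nonempty_smoothSubsolution {J : ℕ} [NeZero J] {c lam : ℝ} {mu β : Fin J → ℝ} {z : State J}
    (hc : 0 < c) (hlam : 0 < lam) (hmu : ∀ i, 0 < mu i) (hz : ∀ i, 0 < z i)
    (hβ : ∀ i, IsPositiveRoot c lam (mu i) (β i)) {e : ℝ} (he : 0 < e) (K : ℝ) :
    Nonempty (SmoothSubsolution c lam mu β z e K) := by
  have hβ0 : ∀ i, 0 < β i := fun i => (hβ i).1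
  have hJ : (0 : ℝ) < J := Nat.cast_pos.2 (Nat.pos_of_ne_zero (NeZero.ne J))
  set B := ∑ i, β i with hB
  have hBβ : ∀ i, β i ≤ B := fun i => Finset.single_le_sum (fun i _ => (hβ0 i).le) (Finset.mem_univ i)
  have hB0 : 0 < B := (hβ0 0).trans_le (hBβ 0)
  obtain ⟨Δ, hΔ0, hΔ⟩ := exists_gap β
  -- the contraction factor `1 - ε` makes the subsolution strict
  obtain ⟨ε, hε0, hε1, hεe⟩ : ∃ ε : ℝ, 0 < ε ∧ ε ≤ 1 ∧ ε * (B * z 0) ≤ e / 4 := by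
    have hR : 0 < B * z 0 := mul_pos hB0 (hz 0)
    refine ⟨min 1 (e / 4 / (B * z 0)), by positivity, min_le_left _ _, ?_⟩
    rw [← le_div_iff₀ hR]
    exact min_le_right _ _
  -- the shift by `κ` keeps the levels positive, so that a larger exponent costs at least `Δ κ`
  set κ := e / 4 / B with hκ
  have hκ0 : 0 < κ := by positivity
  have hκB : κ * B = e / 4 := by rw [hκ]; field_simp
  -- slope large enough to dominate both `K` and the gradient of the soft minimum
  set K' := max K 0 + B with hK'
  have hK'0 : 0 < K' := add_pos_of_nonneg_of_pos (le_max_right _ _) hB0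
  have hK'K : K ≤ K' - B := by rw [hK', add_sub_cancel_right]; exact le_max_left _ _
  -- width of the layers at the faces in which the barriers act
  obtain ⟨ρ, hρ0, hρz, hρe, hρB⟩ : ∃ ρ : ℝ, 0 < ρ ∧ (∀ i, ρ ≤ z i) ∧
      J * (K' * J * ρ / 2) ≤ e / 4 ∧ B * (J * ρ) ≤ Δ * κ / 2 := by
    have h1 : ∀ᶠ ρ : ℝ in 𝓝[>] 0, ∀ i, ρ ≤ z i := by
      rw [eventually_all]; intro i
      filter_upwards [Ioo_mem_nhdsGT (hz i)] with ρ hρ using hρ.2.le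
    have h2 : ∀ᶠ ρ : ℝ in 𝓝[>] 0, J * (K' * J * ρ / 2) ≤ e / 4 := by
      have : Tendsto (fun ρ : ℝ => J * (K' * J * ρ / 2)) (𝓝[>] 0) (𝓝 (J * (K' * J * 0 / 2))) :=
        (Continuous.tendsto (by fun_prop) _).mono_left nhdsWithin_le_nhds
      refine (this.eventually_lt_const ?_).mono fun _ => le_of_lt
      simp; positivity
    have h3 : ∀ᶠ ρ : ℝ in 𝓝[>] 0, B * (J * ρ) ≤ Δ * κ / 2 := by
      have : Tendsto (fun ρ : ℝ => B * (J * ρ)) (𝓝[>] 0) (𝓝 (B * (J * 0))) :=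
        (Continuous.tendsto (by fun_prop) _).mono_left nhdsWithin_le_nhds
      refine (this.eventually_lt_const ?_).mono fun _ => le_of_lt
      simp; positivity
    obtain ⟨ρ, h⟩ := (h1.and (h2.and (h3.and self_mem_nhdsWithin))).exists
    exact ⟨ρ, h.2.2.2, h.1, h.2.1, h.2.2.1⟩
  set g := Δ * κ / 2 with hg
  have hg0 : 0 < g := by positivity
  set M := ∑ i, mu i with hM
  -- smoothing parameter: indices whose level is not within `g` of the minimum get little weight
  obtain ⟨δ, hδ0, hδe, hδM⟩ : ∃ δ : ℝ, 0 < δ ∧ δ * Real.log J ≤ e / 4 ∧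
      Real.exp (-g / δ) * M ≤ ε * c / 2 := by
    have h1 : ∀ᶠ δ : ℝ in 𝓝[>] 0, δ * Real.log J ≤ e / 4 := by
      have : Tendsto (fun δ : ℝ => δ * Real.log J) (𝓝[>] 0) (𝓝 (0 * Real.log J)) :=
        (Continuous.tendsto (by fun_prop) _).mono_left nhdsWithin_le_nhds
      refine (this.eventually_lt_const ?_).mono fun _ => le_of_lt
      simp; positivity
    have h2 : ∀ᶠ δ : ℝ in 𝓝[>] 0, Real.exp (-g / δ) * M ≤ ε * c / 2 := by
      have h3 : Tendsto (fun δ : ℝ => -g * δ⁻¹) (𝓝[>] 0) atBot :=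
        tendsto_inv_nhdsGT_zero.const_mul_atTop_of_neg (neg_lt_zero.2 hg0)
      have h4 := (Real.tendsto_exp_atBot.comp h3).mul_const M
      rw [zero_mul] at h4
      exact (h4.eventually_lt_const (show 0 < ε * c / 2 by positivity)).mono fun _ => le_of_lt
    obtain ⟨δ, h⟩ := (h1.and (h2.and self_mem_nhdsWithin)).exists
    exact ⟨δ, h.2.2, h.1, h.2.1⟩
  -- weights of the barriers: increasing towards the front at `0`, towards the back at `z_i`
  set A : Fin J → ℝ := fun i => K' * (J - i.val) with hA
  set C : Fin J → ℝ := fun i => K' * i.val with hC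
  have hiJ : ∀ i : Fin J, (i.val : ℝ) + 1 ≤ J := fun i => by exact_mod_cast i.2
  have hA1 : ∀ i, K' ≤ A i := fun i => by
    rw [hA]; dsimp only; nlinarith [hiJ i]
  have hA0 : ∀ i, 0 ≤ A i := fun i => hK'0.le.trans (hA1 i)
  have hC0 : ∀ i, 0 ≤ C i := fun i => by rw [hC]; positivity
  have hAC : ∀ i, A i + C i = K' * J := fun i => by rw [hA, hC]; ring
  set w : State J → Fin J → ℝ := fun x i => ((1 - ε) * softWeight β z κ δ x i) * β i with hw
  have hw0 : ∀ x i, 0 ≤ w x i := fun x i => mul_nonneg (mul_nonneg (by linarith)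
    (softWeight_nonneg _ _ _ _ _ _)) (hβ0 i).le
  have hwB : ∀ x, ∑ i, w x i ≤ B := by
    intro x
    calc ∑ i, w x i ≤ ∑ i, softWeight β z κ δ x i * B := by
          refine Finset.sum_le_sum fun i _ => ?_
          have h1 := softWeight_nonneg β z κ δ x i
          rw [hw]
          dsimp only
          have h2 : (1 - ε) * softWeight β z κ δ x i ≤ softWeight β z κ δ x i := by nlinarith
          exact mul_le_mul h2 (hBβ i) (hβ0 i).le h1
      _ = B := by rw [← Finset.sum_mul, sum_softWeight, one_mul]
  set G : State J → State J := fun x => WithLp.toLp 2 fun k : Fin J =>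
    tailSum (w x) k + barrierSlope ρ (A k) (C k) (z k) (x k) with hG
  have hGk : ∀ x (k : Fin J), G x k =
    tailSum (w x) k + barrierSlope ρ (A k) (C k) (z k) (x k) := fun x k => rfl
  have hq_le : ∀ x k, tailSum (w x) k ≤ 0 := fun x k => tailSum_nonpos (hw0 x) k
  have hq_ge : ∀ x k, -B ≤ tailSum (w x) k := fun x k =>
    (neg_le_neg (hwB x)).trans (le_tailSum (hw0 x) k)
  have hlevel : ∀ x ∈ closedBox z, ∀ i, minFun β z x ≤ shiftedLevel β z κ i x := by
    intro x _ i
    have h1 := minFun_le β z x i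
    unfold shiftedLevel
    rw [inner_bVec]
    have h2 := mul_pos (hβ0 i) hκ0
    have h3 : ∑ j ∈ Finset.Iic i, (z - x) j = ∑ j ∈ Finset.Iic i, (z j - x j) := rfl
    rw [h3]
    linarith
  refine ⟨{
    toFun := fun x => (1 - ε) * softMin β z κ δ x +
      ∑ k, barrier ρ (A k) (C k) (z k) (x k) - κ * B
    grad := G
    hasFDerivAt := ?_
    continuous_grad := ?_
    ge := ?_
    le := ?_
    nonpos := ?_
    margin := ε * c / 2
    margin_pos := by positivity
    ham_ge := ?_
    lower_face := ?_
    upper_face := ?_ }⟩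
  · intro x
    have h1 := (hasFDerivAt_softMin β z (κ := κ) hδ0 x).const_mul (1 - ε)
    have h2 : ∀ k : Fin J, HasFDerivAt (fun x : State J => barrier ρ (A k) (C k) (z k) (x k))
        (barrierSlope ρ (A k) (C k) (z k) (x k) • (EuclideanSpace.proj k : State J →L[ℝ] ℝ)) x := by
      intro k
      exact (hasDerivAt_barrier hρ0 (A k) (C k) (z k) (x k)).comp_hasFDerivAt x
        (EuclideanSpace.proj k : State J →L[ℝ] ℝ).hasFDerivAt
    have h3 := (h1.add (HasFDerivAt.fun_sum (u := Finset.univ) fun k _ => h2 k)).sub_const (κ * B)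
    refine h3.congr_fderiv ?_
    ext v
    rw [innerSL_apply_apply, inner_eq_sum]
    simp_rw [hGk, add_mul, Finset.sum_add_distrib, hw]
    rw [tailSum_eq_inner (fun i => (1 - ε) * softWeight β z κ δ x i)]
    simp [Finset.mul_sum, mul_assoc]
  · rw [hG]
    refine (PiLp.continuous_toLp 2 _).comp (continuous_pi fun k => ?_)
    unfold tailSum barrierSlope
    refine Continuous.add (continuous_finsetSum _ fun i _ => ?_).neg (by fun_prop)
    split_ifs
    · exact (continuous_const.mul (continuous_softWeight _ _ _ _ _)).mul continuous_const
    · exact continuous_const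
  · intro x hx
    have h1 := le_softMin hδ0 (hlevel x hx)
    have h2 : -(J * (K' * J * ρ / 2)) ≤ ∑ k, barrier ρ (A k) (C k) (z k) (x k) := by
      calc -(J * (K' * J * ρ / 2)) = ∑ _k : Fin J, -(K' * J * ρ / 2) := by simp
        _ ≤ _ := Finset.sum_le_sum fun k _ => by
          rw [← hAC k]
          exact le_barrier hρ0 (hA0 k) (hC0 k) (hx k).1 (hx k).2
    have h3 : minFun β z x ≤ B * z 0 := by
      refine (minFun_le β z x 0).trans ?_
      rw [Iic_zero_eq, Finset.sum_singleton]
      exact mul_le_mul (hBβ 0) (by linarith [(hx 0).1]) (sub_nonneg.2 (hx 0).2) hB0.le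
    have h4 := minFun_nonneg hβ0 hx
    have h5 := mul_le_mul_of_nonneg_left h1 (sub_nonneg.2 hε1)
    have h6 := mul_le_mul_of_nonneg_left h3 hε0.le
    have h7 : 0 ≤ δ * Real.log J := by
      have : 0 ≤ Real.log J := Real.log_natCast_nonneg J
      positivity
    have h8 := mul_nonneg hε0.le h7
    dsimp only
    linarith
  · intro x hx
    obtain ⟨i, hi⟩ := exists_minFun_eq β z x
    have h1 := softMin_le (κ := κ) (β := β) (z := z) hδ0 x i
    have h2 : ∑ k, barrier ρ (A k) (C k) (z k) (x k) ≤ 0 :=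
      Finset.sum_nonpos fun k _ => barrier_nonpos hρ0 (hA0 k) (hC0 k) _ _
    unfold shiftedLevel at h1
    rw [inner_bVec] at h1
    have h3 : ∑ j ∈ Finset.Iic i, (z - x) j = ∑ j ∈ Finset.Iic i, (z j - x j) := rfl
    rw [h3, ← hi] at h1
    have h4 := minFun_nonneg hβ0 hx
    have h5 := mul_le_mul_of_nonneg_left h1 (sub_nonneg.2 hε1)
    have h6 := mul_le_mul_of_nonneg_right (hBβ i) hκ0.le
    have h7 := mul_nonneg hε0.le h4
    have h8 : 0 ≤ ε * (β i * κ) := by have := hβ0 i; positivity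
    dsimp only
    linarith
  · intro x hx
    have h1 := softMin_le (κ := κ) (β := β) (z := z) hδ0 x 0
    have h2 : ∑ k, barrier ρ (A k) (C k) (z k) (x k) ≤ 0 :=
      Finset.sum_nonpos fun k _ => barrier_nonpos hρ0 (hA0 k) (hC0 k) _ _
    unfold shiftedLevel at h1
    rw [inner_bVec, Iic_zero_eq, Finset.sum_singleton] at h1
    have h3 : (z - x) 0 ≤ 0 := sub_nonpos.2 hx
    have h4 : softMin β z κ δ x ≤ κ * B := by
      nlinarith [hβ0 0, hBβ 0]
    have h5 := mul_le_mul_of_nonneg_left h4 (sub_nonneg.2 hε1)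
    have h6 : 0 ≤ ε * (κ * B) := by positivity
    dsimp only
    linarith
  · intro x hx
    set good : Finset (Fin J) := {i | ∀ k, β k < β i →
      ¬ (k < i ∨ (i < k ∧ ∀ j, i < j → j ≤ k → z j - ρ < x j))} with hgood
    have h1 := le_hamExp (p := G x) (θ := fun i => (1 - ε) * softWeight β z κ δ x i) hc hlam hmu hβ
      hε0.le (fun i => mul_nonneg (by linarith) (softWeight_nonneg _ _ _ _ _ _))
      (by rw [← Finset.mul_sum, sum_softWeight, mul_one]) ?_ good ?_
    · refine le_trans ?_ h1
      have h2 : ∑ i ∈ goodᶜ, (1 - ε) * softWeight β z κ δ x i * (mu i * (1 - Real.exp (-β i))) ≤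
          ∑ i, Real.exp (-g / δ) * mu i := by
        refine le_trans (Finset.sum_le_sum fun i hi => ?_)
          (Finset.sum_le_sum_of_subset_of_nonneg (Finset.subset_univ goodᶜ)
            fun i _ _ => mul_nonneg (Real.exp_pos _).le (hmu i).le)
        obtain ⟨k, hk, hki⟩ : ∃ k, β k < β i ∧
            (k < i ∨ (i < k ∧ ∀ j, i < j → j ≤ k → z j - ρ < x j)) := by
          simpa [hgood, Finset.mem_compl, not_forall, -not_or] using hi
        have h3 := softWeight_le hδ0 (shiftedLevel_gap hβ0 hBβ hκ0 hρ0 hΔ hρB hx hk hki)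
        have h4 := softWeight_nonneg β z κ δ x i
        have h5 : (1 - ε) * softWeight β z κ δ x i ≤ Real.exp (-g / δ) := by
          rw [hg]; nlinarith
        have h6 : mu i * (1 - Real.exp (-β i)) ≤ mu i := by
          nlinarith [hmu i, Real.exp_pos (-β i)]
        have h7 : 0 ≤ mu i * (1 - Real.exp (-β i)) := by
          have : Real.exp (-β i) < 1 := by rw [Real.exp_lt_one_iff]; linarith [hβ0 i]
          exact mul_nonneg (hmu i).le (by linarith)
        exact mul_le_mul h5 h6 h7 (Real.exp_pos _).le
      rw [← Finset.mul_sum] at h2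
      linarith
    · rw [hGk]
      have : 0 ≤ barrierSlope ρ (A 0) (C 0) (z 0) (x 0) := by
        have := le_barrierSlope hρ0 (hA0 0) (hC0 0) (hx 0).2
        simpa [hC] using this
      simpa [hw] using this
    · intro i hi k hk
      by_contra! hlt
      rw [hgood, Finset.mem_filter] at hi
      refine hi.2 k hlt (hk.imp_right fun h => ⟨h.1, fun j hij hjk => ?_⟩)
      by_contra! hle
      have h2 := h.2 j hij hjk
      rw [hGk] at h2
      have h3 := barrierSlope_nonneg (B := C j) hρ0 (hA0 j) hle
      linarith
  · intro x hx i hi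
    have h1 : G x i = tailSum (w x) i + A i := by rw [hGk, hi, barrierSlope_zero hρ0 (hρz i)]
    refine ⟨by linarith [hq_ge x i, hA1 i], ?_⟩
    rw [coord_val, h1]
    by_cases h : i.val + 1 < J
    · have h2 : coord (G x) (i + 1) = G x ⟨i + 1, h⟩ := by simp [coord, h]
      have h3 := barrierSlope_le (ρ := ρ) (w := z ⟨i + 1, h⟩) hρ0 (hA0 ⟨i + 1, h⟩) (hC0 ⟨i + 1, h⟩)
        (hx ⟨i + 1, h⟩).1
      have h4 : A ⟨i + 1, h⟩ = A i - K' := by rw [hA]; push_cast; ring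
      rw [h2, hGk]
      linarith [hq_ge x i, hq_le x (i.val + 1), le_max_right K 0]
    · have h2 : coord (G x) (i + 1) = 0 := by simp [coord, h]
      rw [h2]
      linarith [hq_ge x i, hA1 i, le_max_right K 0]
  · intro x hx i hi0 hi
    have h1 : G x i = tailSum (w x) i - C i := by
      rw [hGk, hi, barrierSlope_top hρ0 (hρz i), sub_eq_add_neg]
    have hival : i.val ≠ 0 := fun h => hi0 (Fin.ext h)
    have h2 : K' ≤ C i := by
      rw [hC]
      have : (1 : ℝ) ≤ i.val := by exact_mod_cast Nat.one_le_iff_ne_zero.2 hival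
      dsimp only
      nlinarith
    refine ⟨by linarith [hq_le x i], fun j hj => ?_⟩
    have h3 := le_barrierSlope hρ0 (hA0 j) (hC0 j) (hx j).2
    have h4 : C i = C j + K' := by
      rw [hC]; dsimp only; rw [← hj]; push_cast; ring
    rw [h1, hGk]
    linarith [hq_le x i, hq_ge x j, le_max_right K 0]

/-! ### The explicit function is a viscosity solution -/

theorem mem_subdiff_iff {J : ℕ} [NeZero J] {z x p : State J} {V : State J → ℝ} :
    p ∈ subdiff z V x ↔ ∀ η > 0, ∀ᶠ y in 𝓝[domainG z \ {x}] x,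
      -η * ‖y - x‖ ≤ V y - V x - inner ℝ p (y - x) := by
  have hmem : ∀ᶠ y in 𝓝[domainG z \ {x}] x, 0 < ‖y - x‖ := by
    filter_upwards [self_mem_nhdsWithin] with y hy
    exact norm_pos_iff.2 (sub_ne_zero.2 hy.2)
  unfold subdiff
  rw [Set.mem_ofPred_eq, le_liminf_iff]
  constructor
  · intro h η hη
    have h1 := h ((-η : ℝ) : EReal) (by exact_mod_cast neg_lt_zero.2 hη)
    filter_upwards [h1, hmem] with y hy hpos
    have h2 : -η < (V y - V x - inner ℝ p (y - x)) / ‖y - x‖ := by exact_mod_cast hy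
    rw [lt_div_iff₀ hpos] at h2
    exact h2.le
  · intro h b hb
    obtain ⟨η, hη, hbη⟩ : ∃ η : ℝ, 0 < η ∧ b < ((-η : ℝ) : EReal) := by
      obtain ⟨q, hbq, hq⟩ := EReal.lt_iff_exists_real_btwn.1 hb
      refine ⟨-q, neg_pos.2 (by exact_mod_cast hq), by simpa using hbq⟩
    filter_upwards [h η hη, hmem] with y hy hpos
    refine hbη.trans_le ?_
    rw [EReal.coe_le_coe_iff, le_div_iff₀ hpos]
    exact hy

theorem mem_superdiff_iff {J : ℕ} [NeZero J] {z x p : State J} {V : State J → ℝ} :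
    p ∈ superdiff z V x ↔ ∀ η > 0, ∀ᶠ y in 𝓝[domainG z \ {x}] x,
      V y - V x - inner ℝ p (y - x) ≤ η * ‖y - x‖ := by
  have hmem : ∀ᶠ y in 𝓝[domainG z \ {x}] x, 0 < ‖y - x‖ := by
    filter_upwards [self_mem_nhdsWithin] with y hy
    exact norm_pos_iff.2 (sub_ne_zero.2 hy.2)
  unfold superdiff
  rw [Set.mem_ofPred_eq, limsup_le_iff]
  constructor
  · intro h η hη
    have h1 := h (η : EReal) (by exact_mod_cast hη)
    filter_upwards [h1, hmem] with y hy hpos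
    have h2 : (V y - V x - inner ℝ p (y - x)) / ‖y - x‖ < η := by exact_mod_cast hy
    rw [div_lt_iff₀ hpos] at h2
    exact h2.le
  · intro h b hb
    obtain ⟨η, hη, hbη⟩ := EReal.lt_iff_exists_real_btwn.1 hb
    filter_upwards [h η (by exact_mod_cast hη), hmem] with y hy hpos
    refine lt_of_le_of_lt ?_ hbη
    rw [EReal.coe_le_coe_iff, div_le_iff₀ hpos]
    exact hy

theorem inner_le_of_mem_subdiff {J : ℕ} [NeZero J] {z x p v : State J} {V : State J → ℝ} {s : ℝ}
    (hp : p ∈ subdiff z V x) (hv : v ≠ 0) (hG : ∀ᶠ t : ℝ in 𝓝[>] 0, x + t • v ∈ domainG z)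
    (hV : ∀ t : ℝ, 0 < t → V (x + t • v) ≤ V x + t * s) : inner ℝ p v ≤ s := by
  rw [mem_subdiff_iff] at hp
  have hlim : Tendsto (fun t : ℝ => x + t • v) (𝓝[>] 0) (𝓝[domainG z \ {x}] x) := by
    refine tendsto_nhdsWithin_iff.2 ⟨?_, ?_⟩
    · have : Tendsto (fun t : ℝ => x + t • v) (𝓝 0) (𝓝 (x + (0 : ℝ) • v)) :=
        Continuous.tendsto (by fun_prop) 0
      rw [zero_smul, add_zero] at this
      exact this.mono_left nhdsWithin_le_nhds
    · filter_upwards [hG, self_mem_nhdsWithin] with t ht ht0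
      refine ⟨ht, fun h => ?_⟩
      have h2 : t • v = 0 := by simpa using h
      exact (smul_ne_zero (ne_of_gt ht0) hv) h2
  refine le_of_forall_pos_le_add fun η hη => ?_
  have hv' : 0 < ‖v‖ := norm_pos_iff.2 hv
  obtain ⟨t, ht, ht0⟩ :=
    ((hlim.eventually (hp (η / ‖v‖) (by positivity))).and self_mem_nhdsWithin).exists
  have ht0' : (0 : ℝ) < t := ht0
  rw [add_sub_cancel_left, norm_smul, real_inner_smul_right, Real.norm_of_nonneg ht0'.le] at ht
  have h1 := hV t ht0
  have h2 : -(η / ‖v‖) * (t * ‖v‖) = -(t * η) := by field_simp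
  rw [h2] at ht
  have h3 : t * inner ℝ p v ≤ t * (s + η) := by linarith
  exact le_of_mul_le_mul_left h3 ht0'

theorem add_smul_unitVec_mem {J : ℕ} {z x : State J} (hx : x ∈ closedBox z) {i : Fin J}
    (h : x i < z i) : ∀ᶠ t : ℝ in 𝓝[>] 0, x + t • unitVec i ∈ closedBox z := by
  filter_upwards [Ioo_mem_nhdsGT (sub_pos.2 h)] with t ht j
  have hj : (x + t • unitVec i) j = x j + t * if j = i then 1 else 0 := by
    simp [unitVec_apply]
  rw [hj]
  have := hx j
  split_ifs with hji
  · subst hji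
    constructor <;> linarith [ht.1, ht.2]
  · simpa using this

theorem sub_smul_unitVec_mem {J : ℕ} {z x : State J} (hx : x ∈ closedBox z) {i : Fin J}
    (h : 0 < x i) : ∀ᶠ t : ℝ in 𝓝[>] 0, x + t • -unitVec i ∈ closedBox z := by
  filter_upwards [Ioo_mem_nhdsGT h] with t ht j
  have hj : (x + t • -unitVec i) j = x j - t * if j = i then 1 else 0 := by
    simp [unitVec_apply, sub_eq_add_neg]
  rw [hj]
  have := hx j
  split_ifs with hji
  · subst hji
    constructor <;> linarith [ht.1, ht.2]
  · simpa using this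

theorem eventually_mem_domainG {J : ℕ} [NeZero J] {z x v : State J} (hx : x 0 < z 0)
    (h : ∀ᶠ t : ℝ in 𝓝[>] 0, x + t • v ∈ closedBox z) :
    ∀ᶠ t : ℝ in 𝓝[>] 0, x + t • v ∈ domainG z := by
  have h1 : Tendsto (fun t : ℝ => (x + t • v) 0) (𝓝[>] 0) (𝓝 ((x + (0 : ℝ) • v) 0)) :=
    (Continuous.tendsto (by fun_prop) 0).mono_left nhdsWithin_le_nhds
  rw [zero_smul, add_zero] at h1
  filter_upwards [h, h1.eventually_lt_const hx] with t ht ht0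
  exact mem_domainG_iff.2 ⟨ht, ht0⟩

theorem unitVec_ne_zero {J : ℕ} (i : Fin J) : (unitVec i : State J) ≠ 0 := by
  intro h
  have := congrArg (fun v : State J => v i) h
  simp [unitVec_apply] at this

theorem norm_unitVec {J : ℕ} (i : Fin J) : ‖(unitVec i : State J)‖ = 1 := by simp [unitVec]

theorem coord_zero {J : ℕ} [NeZero J] (p : State J) : coord p 0 = p 0 := by
  simpa using coord_val p 0

theorem coord_bVec {J : ℕ} (β : Fin J → ℝ) (i : Fin J) (k : ℕ) :
    coord (bVec β i) k = if k ≤ i.val then β i else 0 := by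
  unfold coord
  split_ifs with h1 h2 h2
  · rw [bVec_apply, if_pos (Fin.le_def.2 h2)]
  · rw [bVec_apply, if_neg (fun h => h2 (Fin.le_def.1 h))]
  · omega
  · rfl

theorem minFun_add_le {J : ℕ} [NeZero J] {β : Fin J → ℝ} {z x : State J} {i : Fin J}
    (hi : minFun β z x = β i * ∑ j ∈ Finset.Iic i, (z j - x j)) (v : State J) (t : ℝ) :
    minFun β z (x + t • v) ≤ minFun β z x + t * -inner ℝ (bVec β i) v := by
  have h1 := minFun_le β z (x + t • v) i
  have e1 : β i * ∑ j ∈ Finset.Iic i, (z j - (x + t • v) j) =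
      inner ℝ (bVec β i) (z - (x + t • v)) := by rw [inner_bVec]; rfl
  have e2 : β i * ∑ j ∈ Finset.Iic i, (z j - x j) = inner ℝ (bVec β i) (z - x) := by
    rw [inner_bVec]; rfl
  rw [e1, ← sub_sub, inner_sub_right, real_inner_smul_right] at h1
  rw [hi, e2]
  linarith

/-- At a subdifferential `p` and for an active index `i`, the difference `-b_i - p` is nonnegative
and supported on the empty queues. If moreover `p · γ_k > 0` for all empty queues `k`, no service
term of `H` at `p` exceeds that at `-b_i`, where `H` vanishes. -/
theorem minFun_sub_property {J : ℕ} [NeZero J] {c lam : ℝ} {mu β : Fin J → ℝ} {z : State J}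
    (hlam : 0 < lam) (hmu : ∀ i, 0 < mu i) (hβ : ∀ i, IsPositiveRoot c lam (mu i) (β i))
    {x p : State J} (hx : x ∈ domainG z \ boundaryC z) (hp : p ∈ subdiff z (minFun β z) x) :
    hamExp c lam mu p ≤ 0 ∨ ∃ i, x i = 0 ∧ inner ℝ p (gammaVec i) ≤ 0 := by
  obtain ⟨hxG, hxC⟩ := hx
  have hxbox := domainG_subset_closedBox z hxG
  have hlt : ∀ k, x k < z k := by
    intro k
    by_cases hk : k = 0
    · exact hk ▸ hxG.2.1
    · refine lt_of_le_of_ne (hxG.2.2 k hk) fun h => hxC ⟨hxbox, hxG.2.1, k, hk, h⟩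
  obtain ⟨i, hi⟩ := exists_minFun_eq β z x
  have hle : ∀ k, p k ≤ -bVec β i k := by
    intro k
    have h1 := inner_le_of_mem_subdiff hp (unitVec_ne_zero k)
      (eventually_mem_domainG hxG.2.1 (add_smul_unitVec_mem hxbox (hlt k)))
      fun t _ => minFun_add_le hi _ t
    rwa [inner_unitVec, inner_unitVec] at h1
  have hge : ∀ k, x k ≠ 0 → -bVec β i k ≤ p k := by
    intro k hk
    have hk' : 0 < x k := lt_of_le_of_ne (hxbox k).1 (Ne.symm hk)
    have h1 := inner_le_of_mem_subdiff hp (neg_ne_zero.2 (unitVec_ne_zero k))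
      (eventually_mem_domainG hxG.2.1 (sub_smul_unitVec_mem hxbox hk'))
      fun t _ => minFun_add_le hi _ t
    rw [inner_neg_right, inner_neg_right, inner_unitVec, inner_unitVec] at h1
    linarith
  by_contra! hcon
  obtain ⟨hH, hI⟩ := hcon
  refine absurd hH (not_lt.2 ?_)
  have hlecoord : ∀ k : ℕ, coord p k ≤ -coord (bVec β i) k := by
    intro k
    unfold coord
    split_ifs
    · exact hle _
    · simp
  have hterm : ∀ k : Fin J, mu k * max 0 (1 - Real.exp (coord p k - coord p (k + 1))) ≤
      if k = i then mu i * (1 - Real.exp (-β i)) else 0 := by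
    intro k
    have hpos : 0 ≤ mu i * (1 - Real.exp (-β i)) := by
      have : Real.exp (-β i) < 1 := by rw [Real.exp_lt_one_iff]; linarith [(hβ i).1]
      exact mul_nonneg (hmu i).le (by linarith)
    by_cases hk : x k = 0
    · have h1 := hI k hk
      rw [inner_gammaVec] at h1
      have h2 := Real.one_le_exp h1.le
      rw [max_eq_left (by linarith), mul_zero]
      split_ifs
      exacts [hpos, le_rfl]
    · have h1 := hge k hk
      have h2 := hlecoord (k + 1)
      rw [coord_bVec] at h2
      rw [bVec_apply] at h1
      rw [coord_val]
      split_ifs with hki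
      · subst hki
        rw [if_pos le_rfl] at h1
        rw [if_neg (by omega)] at h2
        refine mul_le_mul_of_nonneg_left (max_le ?_ ?_) (hmu k).le
        · have : Real.exp (-β k) < 1 := by rw [Real.exp_lt_one_iff]; linarith [(hβ k).1]
          linarith
        · have : Real.exp (-β k) ≤ Real.exp (p k - coord p (k + 1)) :=
            Real.exp_le_exp.2 (by linarith)
          linarith
      · have h3 : 0 ≤ p k - coord p (k + 1) := by
          have hne : k.val ≠ i.val := fun h => hki (Fin.ext h)
          rcases lt_or_gt_of_ne hne with h | h
          · rw [if_pos (Fin.le_def.2 h.le)] at h1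
            rw [if_pos (by omega)] at h2
            linarith
          · rw [if_neg (fun h' => by have := Fin.le_def.1 h'; omega)] at h1
            rw [if_neg (by omega)] at h2
            linarith
        have h4 := Real.one_le_exp h3
        rw [max_eq_left (by linarith), mul_zero]
  have hsum := Finset.sum_le_sum fun k (_ : k ∈ Finset.univ) => hterm k
  rw [Finset.sum_ite_eq' Finset.univ i, if_pos (Finset.mem_univ i)] at hsum
  have h0 := hle 0
  rw [bVec_apply, if_pos (Fin.zero_le _)] at h0
  have h1 : Real.exp (β i) ≤ Real.exp (-p 0) := Real.exp_le_exp.2 (by linarith)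
  have h2 := (hβ i).2
  unfold hamExp
  nlinarith

/-- A one-sided bound for increments gives a bound for the directional derivative. -/
theorem fderiv_le_of_eventually {E : Type*} [NormedAddCommGroup E] [NormedSpace ℝ E] {f : E → ℝ}
    {L : E →L[ℝ] ℝ} {x v : E} {s : ℝ} (hf : HasFDerivAt f L x)
    (h : ∀ᶠ t : ℝ in 𝓝[>] 0, f (x + t • v) - f x ≤ t * s) : L v ≤ s := by
  have h1 : HasDerivAt (fun t : ℝ => f (x + t • v)) (L v) 0 := hf.hasLineDerivAt v
  have h2 := h1.tendsto_slope_zero_right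
  refine le_of_tendsto h2 ?_
  filter_upwards [h, self_mem_nhdsWithin] with t ht ht0
  have ht0' : (0 : ℝ) < t := ht0
  simp only [zero_add, zero_smul, add_zero, smul_eq_mul]
  rw [inv_mul_le_iff₀ ht0']
  exact ht

/-- At a superdifferential of the explicit function the Hamiltonian is nonnegative, also at
the boundary: a smooth subsolution that is uniformly close is touched from above nearby by almost
the same gradient, and at an interior point because of its steepness at the faces. -/
theorem hamExp_nonneg_of_mem_superdiff {J : ℕ} [NeZero J] {c lam : ℝ} {mu β : Fin J → ℝ}
    {z : State J} (hc : 0 < c) (hlam : 0 < lam) (hmu : ∀ i, 0 < mu i) (hz : ∀ i, 0 < z i)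
    (hβ : ∀ i, IsPositiveRoot c lam (mu i) (β i)) {x p : State J} (hx : x ∈ domainG z)
    (hp : p ∈ superdiff z (minFun β z) x) : 0 ≤ hamExp c lam mu p := by
  by_contra! hneg
  rw [mem_superdiff_iff] at hp
  have hev : ∀ᶠ p' in 𝓝 p, hamExp c lam mu p' < 0 :=
    (continuous_hamExp c lam mu).continuousAt.eventually_lt_const hneg
  obtain ⟨ε, hε0, hε⟩ := Metric.eventually_nhds_iff.1 hev
  set η := ε / 8 with hη
  have hη0 : 0 < η := by positivity
  have h1 := hp η hη0
  rw [eventually_nhdsWithin_iff, Metric.eventually_nhds_iff] at h1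
  obtain ⟨r', hr'0, hr'⟩ := h1
  obtain ⟨r, hr0, hrr', hrz⟩ : ∃ r : ℝ, 0 < r ∧ r < r' ∧ r < z 0 - x 0 := by
    have : 0 < min r' (z 0 - x 0) := lt_min hr'0 (sub_pos.2 hx.2.1)
    exact ⟨min r' (z 0 - x 0) / 2, by positivity,
      (half_lt_self this).trans_le (min_le_left _ _),
      (half_lt_self this).trans_le (min_le_right _ _)⟩
  have hxbox := domainG_subset_closedBox z hx
  obtain ⟨φ⟩ := nonempty_smoothSubsolution hc hlam hmu hz hβ (show 0 < η * r / 2 by positivity)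
    (‖p‖ + 4 * η + 1)
  -- the quadratic term localizes the maximum of `φ - ψ` near `x`
  set ψ : State J → ℝ := fun y => inner ℝ p (y - x) + 2 * η / r * ‖y - x‖ ^ 2 with hψ
  have hψd : ∀ y, HasFDerivAt ψ (innerSL ℝ (p + (4 * η / r) • (y - x))) y := by
    intro y
    have h2 : HasFDerivAt (fun y : State J => y - x) (ContinuousLinearMap.id ℝ (State J)) y :=
      (hasFDerivAt_id y).sub_const x
    have h3 := ((innerSL ℝ p).hasFDerivAt (x := y - x)).comp y h2
    have h4 := h2.norm_sq.const_mul (2 * η / r)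
    refine (h3.add h4).congr_fderiv ?_
    ext v
    simp
    ring
  have hcont : Continuous fun y => φ.toFun y - ψ y :=
    continuous_iff_continuousAt.2 fun y =>
      ((φ.hasFDerivAt y).continuousAt).sub (hψd y).continuousAt
  obtain ⟨y, ⟨hybox, hyball⟩, hymax⟩ :=
    ((isCompact_closedBox z).inter_right (Metric.isClosed_closedBall (x := x) (ε := r))).exists_isMaxOn
      ⟨x, hxbox, Metric.mem_closedBall_self hr0.le⟩ hcont.continuousOn
  have hyr : ‖y - x‖ ≤ r := by rwa [Metric.mem_closedBall, dist_eq_norm] at hyball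
  have hy0 : y 0 < z 0 := by
    have h2 : |y 0 - x 0| ≤ ‖y - x‖ := PiLp.norm_apply_le (y - x) 0
    linarith [le_abs_self (y 0 - x 0)]
  have hyG : y ∈ domainG z := mem_domainG_iff.2 ⟨hybox, hy0⟩
  have hyV : minFun β z y - minFun β z x - inner ℝ p (y - x) ≤ η * ‖y - x‖ := by
    by_cases hyx : y = x
    · subst hyx; simp
    · exact hr' (by rw [dist_eq_norm]; linarith) ⟨hyG, hyx⟩
  -- the maximum lies in the open ball
  have hylt : ‖y - x‖ < r := by
    refine lt_of_le_of_ne hyr fun heq => ?_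
    have h2 : φ.toFun x - ψ x ≤ φ.toFun y - ψ y :=
      hymax ⟨hxbox, Metric.mem_closedBall_self hr0.le⟩
    have h3 := φ.ge x hxbox
    have h4 := φ.le y hybox
    have h5 : ψ x = 0 := by simp [hψ]
    have h6 : ψ y = inner ℝ p (y - x) + 2 * η * r := by
      rw [hψ]; dsimp only; rw [heq]; field_simp
    rw [heq] at hyV
    nlinarith [mul_pos hη0 hr0]
  set p' := p + (4 * η / r) • (y - x) with hp'
  have hp'p : ‖p' - p‖ ≤ 4 * η := by
    rw [hp', add_sub_cancel_left, norm_smul, Real.norm_of_nonneg (by positivity)]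
    calc 4 * η / r * ‖y - x‖ ≤ 4 * η / r * r := by gcongr
      _ = 4 * η := by field_simp
  have hp'n : ‖p'‖ ≤ ‖p‖ + 4 * η := by
    have := norm_add_le p (p' - p)
    rw [add_sub_cancel] at this
    linarith
  have hcoord : ∀ i, |p' i| ≤ ‖p‖ + 4 * η := fun i => (PiLp.norm_apply_le p' i).trans hp'n
  have hdir : ∀ v : State J, (∀ᶠ t : ℝ in 𝓝[>] 0, y + t • v ∈ closedBox z) →
      inner ℝ (φ.grad y) v ≤ inner ℝ p' v := by
    intro v hv
    have h2 := fderiv_le_of_eventually (v := v) (s := 0)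
      ((φ.hasFDerivAt y).sub (hψd y)) ?_
    · have h3 : (innerSL ℝ (φ.grad y) - innerSL ℝ p') v =
        inner ℝ (φ.grad y) v - inner ℝ p' v := by simp
      rw [h3] at h2
      linarith
    · have h3 : Tendsto (fun t : ℝ => ‖y + t • v - x‖) (𝓝[>] 0) (𝓝 ‖y + (0 : ℝ) • v - x‖) :=
        (Continuous.tendsto (by fun_prop) 0).mono_left nhdsWithin_le_nhds
      rw [zero_smul, add_zero] at h3
      filter_upwards [hv, h3.eventually_lt_const hylt] with t ht htr
      have h4 : φ.toFun (y + t • v) - ψ (y + t • v) ≤ φ.toFun y - ψ y :=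
        hymax ⟨ht, by rw [Metric.mem_closedBall, dist_eq_norm]; exact htr.le⟩
      simp only [Pi.sub_apply, mul_zero]
      linarith
  have hpos : ∀ i, 0 < y i := by
    intro i
    refine lt_of_le_of_ne (hybox i).1 fun h => ?_
    have h2 := hdir _ (add_smul_unitVec_mem hybox (h ▸ hz i : y i < z i))
    rw [inner_unitVec, inner_unitVec] at h2
    have h3 := (φ.lower_face y hybox i h.symm).1
    linarith [(abs_le.1 (hcoord i)).2]
  have hlt : ∀ i, y i < z i := by
    intro i
    by_cases hi : i = 0
    · exact hi ▸ hy0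
    refine lt_of_le_of_ne (hybox i).2 fun h => ?_
    have h2 := hdir _ (sub_smul_unitVec_mem hybox (hpos i))
    rw [inner_neg_right, inner_neg_right, inner_unitVec, inner_unitVec] at h2
    have h3 := (φ.upper_face y hybox i hi h).1
    linarith [(abs_le.1 (hcoord i)).1]
  have hgrad : φ.grad y = p' := by
    ext i
    have h2 := hdir _ (add_smul_unitVec_mem hybox (hlt i))
    have h3 := hdir _ (sub_smul_unitVec_mem hybox (hpos i))
    rw [inner_unitVec, inner_unitVec] at h2
    rw [inner_neg_right, inner_neg_right, inner_unitVec, inner_unitVec] at h3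
    linarith
  have h2 := φ.ham_ge y hybox
  rw [hgrad] at h2
  have h3 := hε (y := p') (by rw [dist_eq_norm]; linarith)
  linarith [φ.margin_pos]

theorem isViscositySolution_minFun {J : ℕ} [NeZero J] {c lam : ℝ} {mu β : Fin J → ℝ} {z : State J}
    (hc : 0 < c) (hlam : 0 < lam) (hmu : ∀ i, 0 < mu i) (hz : ∀ i, 0 < z i)
    (hβ : ∀ i, IsPositiveRoot c lam (mu i) (β i)) :
    IsViscositySolution c lam mu z (minFun β z) where
  super x hx p hp := Or.inl <| by
    rw [hamiltonian_eq_hamExp hlam hmu]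
    exact hamExp_nonneg_of_mem_superdiff hc hlam hmu hz hβ hx hp
  sub x hx p hp := by
    rw [hamiltonian_eq_hamExp hlam hmu]
    exact minFun_sub_property hlam hmu hβ hx hp
  boundary x hx := minFun_eq_zero (fun i => (hβ i).1) hx hz

/-! ### Uniqueness -/

theorem mem_boundaryO_of_mem_closedBox {J : ℕ} [NeZero J] {z x : State J} (hx : x ∈ closedBox z)
    (h : x 0 = z 0) : x ∈ boundaryO z := ⟨h, fun i _ => hx i⟩

theorem hamExp_neg_smul_bVec {J : ℕ} [NeZero J] (c lam : ℝ) (mu β : Fin J → ℝ) (a : ℝ) (i : Fin J) :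
    hamExp c lam mu (-(a • bVec β i)) =
      c + lam * (1 - Real.exp (a * β i)) + mu i * max 0 (1 - Real.exp (-(a * β i))) := by
  have hcoord : ∀ k : ℕ, coord (-(a • bVec β i)) k = -(a * coord (bVec β i) k) := by
    intro k
    unfold coord
    split_ifs <;> simp
  unfold hamExp
  rw [Finset.sum_eq_single i]
  · rw [hcoord, hcoord, coord_bVec, coord_bVec, if_pos le_rfl, if_neg (by omega)]
    have : (-(a • bVec β i)) 0 = -(a * β i) := by
      rw [← coord_zero, hcoord, coord_bVec, if_pos (Nat.zero_le _)]
    rw [this]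
    simp
  · intro k _ hk
    have hne : k.val ≠ i.val := fun h => hk (Fin.ext h)
    rw [hcoord, hcoord, coord_bVec, coord_bVec]
    rcases lt_or_gt_of_ne hne with h | h
    · rw [if_pos h.le, if_pos (by omega)]; simp
    · rw [if_neg (by omega), if_neg (by omega)]; simp
  · simp

/-- A viscosity solution is dominated by each of the affine functions `b_i · (z - x)`: enlarged
slightly and tilted so that `p · γ_k < 0` for all `k`, these are strict supersolutions. -/
theorem le_of_isViscositySolution {J : ℕ} [NeZero J] {c lam : ℝ} {mu β : Fin J → ℝ} {z : State J}
    (hc : 0 < c) (hlam : 0 < lam) (hmu : ∀ i, 0 < mu i) (hz : ∀ i, 0 < z i)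
    (hβ : ∀ i, IsPositiveRoot c lam (mu i) (β i)) {W : State J → ℝ} (hWlip : IsLipschitz z W)
    (hW : IsViscositySolution c lam mu z W) {y : State J} (hy : y ∈ closedBox z) :
    W y ≤ minFun β z y := by
  obtain ⟨K, hK⟩ := hWlip
  rw [closure_domainG hz] at hK
  -- a vector with `r · γ_k = 1` for all `k`
  set r : State J := WithLp.toLp 2 fun k : Fin J => (J : ℝ) - k.val with hr
  have hrc : ∀ k : Fin J, coord r k - coord r (k + 1) = 1 := by
    intro k
    rw [coord_val]
    unfold coord
    split_ifs with h
    · simp [hr]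
    · have : k.val + 1 = J := by omega
      have h2 : (k.val : ℝ) + 1 = J := by exact_mod_cast this
      simp [hr]; linarith
  have hr0 : ∀ k, 0 ≤ r k := by
    intro k
    have : (k.val : ℝ) ≤ J := by exact_mod_cast k.2.le
    simp [hr, this]
  -- `s` and `δ` measure the enlargement and the tilt of the affine function
  have key : ∀ i : Fin J, ∀ s > (0 : ℝ), ∀ᶠ δ : ℝ in 𝓝[>] 0,
      W y ≤ inner ℝ ((1 + s) • bVec β i + δ • r) (z - y) := by
    intro i s hs
    have hβi := (hβ i).1
    have hneg : hamExp c lam mu (-((1 + s) • bVec β i)) < 0 := by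
      rw [hamExp_neg_smul_bVec, max_eq_right]
      · exact (hβ i).neg_of_lt hc hlam (hmu i) (by nlinarith)
      · have : Real.exp (-((1 + s) * β i)) ≤ 1 := by
          rw [Real.exp_le_one_iff]
          have : 0 < (1 + s) * β i := by positivity
          linarith
        linarith
    have hlim : Tendsto (fun δ : ℝ => hamExp c lam mu (-((1 + s) • bVec β i + δ • r))) (𝓝[>] 0)
        (𝓝 (hamExp c lam mu (-((1 + s) • bVec β i + (0 : ℝ) • r)))) :=
      (Continuous.tendsto ((continuous_hamExp c lam mu).comp (by fun_prop)) 0).mono_left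
        nhdsWithin_le_nhds
    rw [zero_smul, add_zero] at hlim
    filter_upwards [hlim.eventually_lt_const hneg, self_mem_nhdsWithin] with δ hδ hδ0
    have hδ0' : (0 : ℝ) < δ := hδ0
    set P := (1 + s) • bVec β i + δ • r with hP
    have hP0 : ∀ k, 0 ≤ P k := by
      intro k
      have h1 : P k = (1 + s) * bVec β i k + δ * r k := by simp [hP]
      rw [h1, bVec_apply]
      have := hr0 k
      split_ifs <;> positivity
    have hcontW : ContinuousOn (fun x => W x - inner ℝ P (z - x)) (closedBox z) :=
      hK.continuousOn.sub (by fun_prop)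
    obtain ⟨x, hx, hmax⟩ := (isCompact_closedBox z).exists_isMaxOn ⟨y, hy⟩ hcontW
    have hmaxy : W y - inner ℝ P (z - y) ≤ W x - inner ℝ P (z - x) := hmax hy
    suffices h : W x - inner ℝ P (z - x) ≤ 0 by linarith
    by_cases hx0 : x 0 = z 0
    · rw [hW.boundary x (mem_boundaryO_of_mem_closedBox hx hx0), inner_eq_sum]
      have : 0 ≤ ∑ j, P j * (z - x) j :=
        Finset.sum_nonneg fun j _ => mul_nonneg (hP0 j) (sub_nonneg.2 (hx j).2)
      linarith
    · exfalso
      have hxG : x ∈ domainG z := mem_domainG_iff.2 ⟨hx, lt_of_le_of_ne (hx 0).2 hx0⟩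
      have hmem : -P ∈ superdiff z W x := by
        rw [mem_superdiff_iff]
        intro η hη
        filter_upwards [self_mem_nhdsWithin] with w hw
        have h1 : W w - inner ℝ P (z - w) ≤ W x - inner ℝ P (z - x) :=
          hmax (domainG_subset_closedBox z hw.1)
        rw [inner_sub_right, inner_sub_right] at h1
        rw [inner_neg_left, inner_sub_right]
        have h2 : 0 ≤ η * ‖w - x‖ := by positivity
        linarith
      rcases hW.super x hxG _ hmem with h | ⟨k, -, h⟩
      · rw [hamiltonian_eq_hamExp hlam hmu] at h
        linarith
      · rw [inner_neg_left, hP, inner_add_left, real_inner_smul_left, real_inner_smul_left,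
          inner_gammaVec, inner_gammaVec, hrc, coord_bVec, coord_bVec] at h
        have h1 : (0 : ℝ) ≤ (if k.val ≤ i.val then β i else 0) -
            (if k.val + 1 ≤ i.val then β i else 0) := by
          split_ifs <;> first | omega | linarith
        have h2 : 0 ≤ (1 + s) * ((if k.val ≤ i.val then β i else 0) -
            (if k.val + 1 ≤ i.val then β i else 0)) := by positivity
        linarith
  refine le_minFun fun i => ?_
  have e1 : β i * ∑ j ∈ Finset.Iic i, (z j - y j) = inner ℝ (bVec β i) (z - y) := by
    rw [inner_bVec]; rfl
  rw [e1]
  have key2 : ∀ s > (0 : ℝ), W y ≤ inner ℝ ((1 + s) • bVec β i) (z - y) := by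
    intro s hs
    have hlim : Tendsto (fun δ : ℝ => inner ℝ ((1 + s) • bVec β i + δ • r) (z - y)) (𝓝[>] 0)
        (𝓝 (inner ℝ ((1 + s) • bVec β i + (0 : ℝ) • r) (z - y))) :=
      (Continuous.tendsto (by fun_prop) 0).mono_left nhdsWithin_le_nhds
    rw [zero_smul, add_zero] at hlim
    exact ge_of_tendsto hlim (key i s hs)
  have hlim : Tendsto (fun s : ℝ => inner ℝ ((1 + s) • bVec β i) (z - y)) (𝓝[>] 0)
      (𝓝 (inner ℝ ((1 + (0 : ℝ)) • bVec β i) (z - y))) :=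
    (Continuous.tendsto (by fun_prop) 0).mono_left nhdsWithin_le_nhds
  rw [add_zero, one_smul] at hlim
  exact ge_of_tendsto hlim (by filter_upwards [self_mem_nhdsWithin] with s hs using key2 s hs)

/-- A viscosity solution dominates every smooth subsolution that is steeper at the faces than
the solution. -/
theorem ge_of_isViscositySolution {J : ℕ} [NeZero J] {c lam : ℝ} {mu β : Fin J → ℝ} {z : State J}
    (hc : 0 < c) (hlam : 0 < lam) (hmu : ∀ i, 0 < mu i) (hz : ∀ i, 0 < z i)
    (hβ : ∀ i, IsPositiveRoot c lam (mu i) (β i)) {W : State J → ℝ} (hWlip : IsLipschitz z W)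
    (hW : IsViscositySolution c lam mu z W) {y : State J} (hy : y ∈ closedBox z) :
    minFun β z y ≤ W y := by
  obtain ⟨K, hK⟩ := hWlip
  rw [closure_domainG hz] at hK
  refine le_of_forall_pos_le_add fun e he => ?_
  obtain ⟨φ⟩ := nonempty_smoothSubsolution hc hlam hmu hz hβ he (K + 1)
  have hφc : Continuous φ.toFun :=
    continuous_iff_continuousAt.2 fun x => (φ.hasFDerivAt x).continuousAt
  obtain ⟨x, hx, hmin⟩ := (isCompact_closedBox z).exists_isMinOn ⟨y, hy⟩
    (hK.continuousOn.sub hφc.continuousOn)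
  have hminy : W x - φ.toFun x ≤ W y - φ.toFun y := hmin hy
  suffices h : 0 ≤ W x - φ.toFun x by linarith [φ.ge y hy]
  by_cases hx0 : x 0 = z 0
  · rw [hW.boundary x (mem_boundaryO_of_mem_closedBox hx hx0)]
    linarith [φ.nonpos x hx0.ge]
  exfalso
  have hxlt : x 0 < z 0 := lt_of_le_of_ne (hx 0).2 hx0
  -- at the minimum of `W - φ` the slope of `φ` inwards is at most the Lipschitz constant of `W`
  have hdir : ∀ v : State J, ‖v‖ = 1 → (∀ᶠ t : ℝ in 𝓝[>] 0, x + t • v ∈ closedBox z) →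
      inner ℝ (φ.grad x) v ≤ K := by
    intro v hv1 hv
    have h2 := fderiv_le_of_eventually (v := v) (s := K) (φ.hasFDerivAt x) ?_
    · simpa using h2
    · filter_upwards [hv, self_mem_nhdsWithin] with t ht ht0
      have ht0' : (0 : ℝ) < t := ht0
      have h3 : W x - φ.toFun x ≤ W (x + t • v) - φ.toFun (x + t • v) := hmin ht
      have h4 := hK.dist_le_mul _ ht _ hx
      rw [Real.dist_eq, dist_eq_norm, add_sub_cancel_left, norm_smul, hv1, mul_one,
        Real.norm_of_nonneg ht0'.le] at h4
      linarith [le_abs_self (W (x + t • v) - W x)]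
  have hpos : ∀ i, 0 < x i := by
    intro i
    refine lt_of_le_of_ne (hx i).1 fun h => ?_
    have h2 := hdir _ (norm_unitVec i) (add_smul_unitVec_mem hx (h ▸ hz i : x i < z i))
    rw [inner_unitVec] at h2
    linarith [(φ.lower_face x hx i h.symm).1]
  have hlt : ∀ i, i ≠ 0 → x i ≠ z i := by
    intro i hi h
    have h2 := hdir _ (by rw [norm_neg, norm_unitVec]) (sub_smul_unitVec_mem hx (hpos i))
    rw [inner_neg_right, inner_unitVec] at h2
    linarith [(φ.upper_face x hx i hi h).1]
  have hxG : x ∈ domainG z \ boundaryC z :=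
    ⟨mem_domainG_iff.2 ⟨hx, hxlt⟩, fun ⟨_, _, i, hi, h⟩ => hlt i hi h⟩
  have hmem : φ.grad x ∈ subdiff z W x := by
    rw [mem_subdiff_iff]
    intro η hη
    have h1 := (hasFDerivAt_iff_isLittleO.1 (φ.hasFDerivAt x)).def hη
    filter_upwards [nhdsWithin_le_nhds h1, self_mem_nhdsWithin] with w hw hwG
    have h2 : W x - φ.toFun x ≤ W w - φ.toFun w := hmin (domainG_subset_closedBox z hwG.1)
    rw [innerSL_apply_apply, Real.norm_eq_abs] at hw
    linarith [(abs_le.1 hw).1]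
  rcases hW.sub x hxG _ hmem with h | ⟨i, hi, -⟩
  · rw [hamiltonian_eq_hamExp hlam hmu] at h
    linarith [φ.ham_ge x hx, φ.margin_pos]
  · exact (hpos i).ne' hi

/-! ### A lower bound for the cost of an arbitrary controlled process -/

/-- A process with right-continuous paths is jointly measurable. -/
theorem measurable_uncurry_of_rightCont {Ω E : Type*} [MeasurableSpace Ω] [TopologicalSpace E]
    [TopologicalSpace.PseudoMetrizableSpace E] [MeasurableSpace E] [BorelSpace E]
    {X : ℝ≥0 → Ω → E} (hX : ∀ t, Measurable (X t))
    (hr : ∀ ω t, ContinuousWithinAt (fun s => X s ω) (Set.Ici t) t) :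
    Measurable fun q : ℝ≥0 × Ω => X q.1 q.2 := by
  set τ : ℕ → ℝ≥0 → ℝ≥0 := fun m t => ((⌊t * (m + 1)⌋₊ : ℝ≥0) + 1) / (m + 1) with hτ
  have hm : ∀ m, Measurable fun q : ℝ≥0 × Ω => X (τ m q.1) q.2 := by
    intro m
    have h1 : Measurable fun q : ℕ × Ω => X (((q.1 : ℝ≥0) + 1) / (m + 1)) q.2 :=
      measurable_from_prod_countable_right fun k => hX (((k : ℝ≥0) + 1) / (m + 1))
    have h2 : Measurable fun q : ℝ≥0 × Ω => (⌊q.1 * (m + 1)⌋₊, q.2) :=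
      (Nat.measurable_floor.comp (measurable_fst.mul_const _)).prodMk measurable_snd
    have h3 := h1.comp h2
    simpa only [Function.comp_def] using h3
  refine measurable_of_tendsto_metrizable hm (tendsto_pi_nhds.2 fun q => ?_)
  have h1 : ∀ m : ℕ, q.1 ≤ τ m q.1 := by
    intro m
    rw [hτ]
    dsimp only
    rw [le_div_iff₀ (by positivity)]
    exact (Nat.lt_floor_add_one _).le
  have h2 : ∀ m : ℕ, τ m q.1 ≤ q.1 + 1 / (m + 1) := by
    intro m
    rw [hτ]
    dsimp only
    rw [div_le_iff₀ (by positivity), add_mul, one_div, inv_mul_cancel₀ (by positivity)]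
    gcongr
    exact Nat.floor_le (zero_le)
  have h3 : Tendsto (fun m => τ m q.1) atTop (𝓝[≥] q.1) := by
    refine tendsto_nhdsWithin_iff.2 ⟨?_, Eventually.of_forall h1⟩
    refine tendsto_of_tendsto_of_tendsto_of_le_of_le tendsto_const_nhds ?_ h1 h2
    have := (tendsto_one_div_add_atTop_nhds_zero_nat (𝕜 := ℝ≥0)).const_add q.1
    rwa [add_zero] at this
  exact (hr q.2 q.1).tendsto.comp h3

theorem abs_generator_le {J : ℕ} [NeZero J] {lam : ℝ} {mu u : Fin J → ℝ} (hlam : 0 ≤ lam)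
    (hmu : ∀ i, 0 ≤ mu i) (hu : u ∈ controlSet J) {g : (Fin J → ℕ) → ℝ} {D : ℝ}
    (hg : ∀ k l, |g k - g l| ≤ D) (k : Fin J → ℕ) :
    |generator lam mu u g k| ≤ (lam + ∑ i, mu i) * D := by
  have hD : 0 ≤ D := (abs_nonneg _).trans (hg k k)
  unfold generator
  refine (abs_add_le _ _).trans ?_
  rw [add_mul, Finset.sum_mul]
  refine add_le_add ?_ ((Finset.abs_sum_le_sum_abs _ _).trans (Finset.sum_le_sum fun i _ => ?_))
  · rw [abs_mul, abs_of_nonneg hlam]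
    exact mul_le_mul_of_nonneg_left (hg _ _) hlam
  · rw [abs_mul, abs_mul, abs_of_nonneg (hu i).1, abs_of_nonneg (hmu i)]
    have h1 : |if 1 ≤ k i then g (serve i k) - g k else 0| ≤ D := by
      split_ifs
      · exact hg _ _
      · simpa using hD
    calc u i * mu i * |if 1 ≤ k i then g (serve i k) - g k else 0|
        ≤ 1 * mu i * D := by
          gcongr
          · exact mul_nonneg zero_le_one (hmu i)
          · exact hmu i
          · exact (hu i).2
      _ = mu i * D := by ring

theorem measurable_generator {J : ℕ} [NeZero J] (lam : ℝ) (mu : Fin J → ℝ)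
    (g : (Fin J → ℕ) → ℝ) :
    Measurable fun q : (Fin J → ℝ) × (Fin J → ℕ) => generator lam mu q.1 g q.2 := by
  unfold generator
  have h : ∀ f : (Fin J → ℕ) → ℝ, Measurable fun q : (Fin J → ℝ) × (Fin J → ℕ) => f q.2 :=
    fun f => (Measurable.of_discrete (f := f)).comp measurable_snd
  refine ((h fun k => g (arrive k) - g k).const_mul lam).add
    (Finset.measurable_fun_sum _ fun i _ => ?_)
  exact (((measurable_pi_apply i).comp measurable_fst).mul_const _).mul
    (h fun k => if 1 ≤ k i then g (serve i k) - g k else 0)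

/-- Dynkin's formula on an event of the past, with the expectation under the time integral. -/
theorem setIntegral_eq_add_integral {J : ℕ} [NeZero J] {Ω : Type*} {mΩ : MeasurableSpace Ω}
    {P : Measure Ω} [IsProbabilityMeasure P] {ℱ : Filtration ℝ≥0 mΩ} {lam : ℝ} {mu : Fin J → ℝ}
    (hlam : 0 ≤ lam) (hmu : ∀ i, 0 ≤ mu i) {n : ℕ} {Q : ℝ≥0 → Ω → (Fin J → ℕ)}
    {u : ℝ≥0 → Ω → (Fin J → ℝ)}
    (hQ : Measurable fun q : ℝ≥0 × Ω => Q q.1 q.2) (hu : Measurable fun q : ℝ≥0 × Ω => u q.1 q.2)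
    (hU : ∀ t ω, u t ω ∈ controlSet J) {g : (Fin J → ℕ) → ℝ} {C : ℝ} (hg : ∀ k, |g k| ≤ C)
    (hM : Martingale (fun (t : ℝ≥0) ω => g (Q t ω) -
      ∫ s in (0 : ℝ)..t, (n : ℝ) * generator lam mu (u s.toNNReal ω) g (Q s.toNNReal ω)) ℱ P)
    {s t : ℝ≥0} (hst : s ≤ t) {B : Set Ω} (hB : MeasurableSet[ℱ s] B) :
    ∫ ω in B, g (Q t ω) ∂P = ∫ ω in B, g (Q s ω) ∂P +
      ∫ r in (s : ℝ)..t, ∫ ω in B,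
        (n : ℝ) * generator lam mu (u r.toNNReal ω) g (Q r.toNNReal ω) ∂P := by
  set h : ℝ → Ω → ℝ := fun r ω =>
    (n : ℝ) * generator lam mu (u r.toNNReal ω) g (Q r.toNNReal ω) with hh
  have hmeas : Measurable fun q : ℝ × Ω => h q.1 q.2 := by
    have h1 : Measurable fun q : ℝ × Ω => (q.1.toNNReal, q.2) :=
      (measurable_real_toNNReal.comp measurable_fst).prodMk measurable_snd
    exact ((measurable_generator lam mu g).comp ((hu.comp h1).prodMk (hQ.comp h1))).const_mul _
  have hbd : ∀ r ω, ‖h r ω‖ ≤ n * ((lam + ∑ i, mu i) * (2 * C)) := by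
    intro r ω
    rw [hh]
    dsimp only
    rw [norm_mul, Real.norm_natCast]
    gcongr
    refine abs_generator_le hlam hmu (hU _ _) (fun k l => ?_) _
    have h1 := abs_le.1 (hg k)
    have h2 := abs_le.1 (hg l)
    rw [abs_le]
    constructor <;> linarith
  have hint : ∀ (a b : ℝ) ω, IntervalIntegrable (fun r => h r ω) volume a b := by
    intro a b ω
    refine IntervalIntegrable.mono_fun (intervalIntegrable_const (c := n * ((lam + ∑ i, mu i) * (2 * C))))
      ?_ ?_
    · exact (hmeas.comp (measurable_id.prodMk measurable_const)).aestronglyMeasurable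
    · refine Eventually.of_forall fun r => (hbd r ω).trans (le_abs_self _)
  have hgi : ∀ r, Integrable (fun ω => g (Q r ω)) (P.restrict B) := by
    intro r
    refine Integrable.of_bound (C := C) ?_ (Eventually.of_forall fun ω => hg _)
    exact ((Measurable.of_discrete (f := g)).comp
      (hQ.comp (measurable_const.prodMk measurable_id))).aestronglyMeasurable
  have hMs := (hM.integrable s).restrict (s := B)
  have hMt := (hM.integrable t).restrict (s := B)
  have hIs : Integrable (fun ω => ∫ r in (0 : ℝ)..s, h r ω) (P.restrict B) := by
    have := (hgi s).sub hMs
    refine this.congr (Eventually.of_forall fun ω => ?_)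
    simp [hh]
  have hIt : Integrable (fun ω => ∫ r in (0 : ℝ)..t, h r ω) (P.restrict B) := by
    have := (hgi t).sub hMt
    refine this.congr (Eventually.of_forall fun ω => ?_)
    simp [hh]
  have e1 := hM.setIntegral_eq hst hB
  rw [integral_sub (hgi s) hIs, integral_sub (hgi t) hIt] at e1
  have e2 : ∫ ω in B, (∫ r in (0 : ℝ)..t, h r ω) ∂P - ∫ ω in B, (∫ r in (0 : ℝ)..s, h r ω) ∂P =
      ∫ r in (s : ℝ)..t, ∫ ω in B, h r ω ∂P := by
    rw [← integral_sub hIt hIs]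
    have hst' : (s : ℝ) ≤ t := by exact_mod_cast hst
    rw [intervalIntegral.integral_of_le hst', integral_integral_swap]
    · refine integral_congr_ae (Eventually.of_forall fun ω => ?_)
      dsimp only
      rw [intervalIntegral.integral_interval_sub_left (hint _ _ _) (hint _ _ _),
        intervalIntegral.integral_of_le hst']
    · refine Integrable.of_bound (C := n * ((lam + ∑ i, mu i) * (2 * C)))
        hmeas.aestronglyMeasurable (Eventually.of_forall fun q => hbd _ _)
  linarith

/-- Short-time growth of an expectation: if `g` grows in the current state `k` at the rate
`a` under every control, then `E g (Q_t)` does so up to an error of second order, as the process is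
unlikely to leave `k`. -/
theorem setIntegral_ge_of_generator_ge {J : ℕ} [NeZero J] {Ω : Type*} {mΩ : MeasurableSpace Ω}
    {P : Measure Ω} [IsProbabilityMeasure P] {ℱ : Filtration ℝ≥0 mΩ} {lam : ℝ} {mu : Fin J → ℝ}
    (hlam : 0 ≤ lam) (hmu : ∀ i, 0 ≤ mu i) {n : ℕ} {Q : ℝ≥0 → Ω → (Fin J → ℕ)}
    {u : ℝ≥0 → Ω → (Fin J → ℝ)}
    (hQ : Measurable fun q : ℝ≥0 × Ω => Q q.1 q.2) (hu : Measurable fun q : ℝ≥0 × Ω => u q.1 q.2)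
    (hU : ∀ t ω, u t ω ∈ controlSet J)
    (hM : ∀ g : (Fin J → ℕ) → ℝ, (∃ C, ∀ k, |g k| ≤ C) →
      Martingale (fun (t : ℝ≥0) ω => g (Q t ω) -
      ∫ s in (0 : ℝ)..t, (n : ℝ) * generator lam mu (u s.toNNReal ω) g (Q s.toNNReal ω)) ℱ P)
    {g : (Fin J → ℕ) → ℝ} {D a : ℝ} (hg0 : ∀ k, 0 ≤ g k) (hgD : ∀ k, g k ≤ D) {k : Fin J → ℕ}
    (haD : a ≤ D)
    (hgen : ∀ v ∈ controlSet J, a ≤ n * generator lam mu v g k)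
    {s : ℝ≥0} (h : ℝ≥0) {B : Set Ω} (hB : MeasurableSet[ℱ s] B) (hBk : ∀ ω ∈ B, Q s ω = k) :
    P.real B * (g k + h * (a - (1 + n * (lam + ∑ i, mu i)) * D * (n * (lam + ∑ i, mu i)) * h)) ≤
      ∫ ω in B, g (Q (s + h) ω) ∂P := by
  set R := n * (lam + ∑ i, mu i) with hR
  have hR0 : 0 ≤ R := mul_nonneg (Nat.cast_nonneg _)
    (add_nonneg hlam (Finset.sum_nonneg fun i _ => hmu i))
  have hD0 : 0 ≤ D := (hg0 k).trans (hgD k)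
  have hBm : MeasurableSet B := ℱ.le s B hB
  have hQr : ∀ r, Measurable (Q r) := fun r => hQ.comp (measurable_const.prodMk measurable_id)
  have hur : ∀ r, Measurable (u r) := fun r => hu.comp (measurable_const.prodMk measurable_id)
  have hbound : ∀ (f : (Fin J → ℕ) → ℝ) (E : ℝ), (∀ l, 0 ≤ f l) → (∀ l, f l ≤ E) →
      ∀ r ω, |n * generator lam mu (u r ω) f (Q r ω)| ≤ R * E := by
    intro f E hf0 hfE r ω
    rw [abs_mul, Nat.abs_cast, hR, mul_assoc]
    gcongr
    refine abs_generator_le hlam hmu (hU _ _) (fun k l => ?_) _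
    rw [abs_le]
    constructor <;> linarith [hf0 k, hf0 l, hfE k, hfE l]
  have hgint : ∀ (f : (Fin J → ℕ) → ℝ) (E : ℝ), (∀ l, 0 ≤ f l) → (∀ l, f l ≤ E) →
      ∀ r, Integrable (fun ω => n * generator lam mu (u r ω) f (Q r ω)) (P.restrict B) := by
    intro f E hf0 hfE r
    refine Integrable.of_bound (C := R * E) ?_ (Eventually.of_forall fun ω => hbound f E hf0 hfE r ω)
    exact (((measurable_generator lam mu f).comp ((hur r).prodMk (hQr r))).const_mul _).aestronglyMeasurable
  -- the inner integrals are interval integrable, being measurable and bounded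
  have hiint : ∀ (f : (Fin J → ℕ) → ℝ) (E : ℝ), (∀ l, 0 ≤ f l) → (∀ l, f l ≤ E) → ∀ x y : ℝ,
      IntervalIntegrable (fun r : ℝ => ∫ ω in B,
        (n : ℝ) * generator lam mu (u r.toNNReal ω) f (Q r.toNNReal ω) ∂P) volume x y := by
    intro f E hf0 hfE x y
    have hmeas : Measurable fun q : ℝ × Ω =>
        (n : ℝ) * generator lam mu (u q.1.toNNReal q.2) f (Q q.1.toNNReal q.2) := by
      have h1 : Measurable fun q : ℝ × Ω => (q.1.toNNReal, q.2) :=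
        (measurable_real_toNNReal.comp measurable_fst).prodMk measurable_snd
      exact ((measurable_generator lam mu f).comp ((hu.comp h1).prodMk (hQ.comp h1))).const_mul _
    refine IntervalIntegrable.mono_fun (intervalIntegrable_const (c := R * E * P.real B)) ?_ ?_
    · exact (hmeas.stronglyMeasurable.integral_prod_right').aestronglyMeasurable
    · refine Eventually.of_forall fun r => (le_trans ?_ (le_abs_self _))
      refine (norm_setIntegral_le_of_norm_le_const (measure_lt_top _ _) fun ω _ => hbound f E hf0 hfE _ ω)
  have dyn := fun (f : (Fin J → ℕ) → ℝ) (E : ℝ) (hf0 : ∀ l, 0 ≤ f l) (hfE : ∀ l, f l ≤ E)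
      (t : ℝ≥0) (hst : s ≤ t) =>
    setIntegral_eq_add_integral hlam hmu hQ hu hU
      (fun l => abs_le.2 ⟨by linarith [hf0 l, hfE l], hfE l⟩) (hM f ⟨E, fun l =>
        abs_le.2 ⟨by linarith [hf0 l, hfE l], hfE l⟩⟩) hst hB
  -- the probability of having left `k`
  have stay : ∀ t, s ≤ t → P.real (B ∩ {ω | Q t ω ≠ k}) ≤ R * (t - s) * P.real B := by
    intro t hst
    set f : (Fin J → ℕ) → ℝ := fun l => if l = k then 1 else 0 with hf
    have hf0 : ∀ l, 0 ≤ f l := fun l => by rw [hf]; dsimp only; split_ifs <;> norm_num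
    have hf1 : ∀ l, f l ≤ 1 := fun l => by rw [hf]; dsimp only; split_ifs <;> norm_num
    have h1 := dyn f 1 hf0 hf1 t hst
    have h2 : ∫ ω in B, f (Q s ω) ∂P = P.real B := by
      rw [setIntegral_congr_fun (g := fun _ => (1 : ℝ)) hBm]
      · simp
      · intro ω hω
        simp [hf, hBk ω hω]
    have h3 : ∫ ω in B, f (Q t ω) ∂P = P.real B - P.real (B ∩ {ω | Q t ω ≠ k}) := by
      have hS : MeasurableSet {ω | Q t ω = k} := hQr t (measurableSet_singleton k)
      have h4 : (fun ω => f (Q t ω)) = Set.indicator {ω | Q t ω = k} fun _ => (1 : ℝ) := by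
        ext ω
        simp [hf, Set.indicator_apply]
      rw [h4, integral_indicator hS, Measure.restrict_restrict hS]
      simp only [integral_const, smul_eq_mul, mul_one, measureReal_restrict_apply_univ]
      have h5 := measureReal_inter_add_sdiff (μ := P) (s := B) hS
      have h6 : B \ {ω | Q t ω = k} = B ∩ {ω | Q t ω ≠ k} := by ext; simp
      rw [h6] at h5
      rw [Set.inter_comm]
      linarith
    have hst' : (s : ℝ) ≤ t := by exact_mod_cast hst
    have h7 : -(R * P.real B) * (t - s) ≤ ∫ r in (s : ℝ)..t, ∫ ω in B,
        (n : ℝ) * generator lam mu (u r.toNNReal ω) f (Q r.toNNReal ω) ∂P := by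
      have : ∫ r in (s : ℝ)..t, -(R * P.real B) = -(R * P.real B) * (t - s) := by
        rw [intervalIntegral.integral_const, smul_eq_mul, mul_comm]
      rw [← this]
      refine intervalIntegral.integral_mono_on hst' intervalIntegrable_const
        (hiint f 1 hf0 hf1 _ _) fun r _ => ?_
      have h8 := norm_setIntegral_le_of_norm_le_const (μ := P) (s := B)
        (f := fun ω => (n : ℝ) * generator lam mu (u r.toNNReal ω) f (Q r.toNNReal ω))
        (measure_lt_top _ _) fun ω _ => hbound f 1 hf0 hf1 r.toNNReal ω
      rw [mul_one] at h8
      exact (abs_le.1 h8).1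
    rw [h1, h2] at h3
    linarith
  have hst : s ≤ s + h := le_self_add
  rw [dyn g D hg0 hgD _ hst]
  have e1 : ∫ ω in B, g (Q s ω) ∂P = P.real B * g k := by
    rw [setIntegral_congr_fun (g := fun _ => g k) hBm fun ω hω => by simp [hBk ω hω]]
    simp
  rw [e1, mul_add]
  refine add_le_add le_rfl ?_
  have e2 : P.real B * (h * (a - (1 + R) * D * R * h)) =
      ∫ r in (s : ℝ)..(s + h : ℝ≥0), P.real B * (a - (1 + R) * D * R * h) := by
    rw [intervalIntegral.integral_const, smul_eq_mul]
    push_cast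
    ring
  rw [e2]
  refine intervalIntegral.integral_mono_on (by exact_mod_cast hst) intervalIntegrable_const
    (hiint g D hg0 hgD _ _) fun r hr => ?_
  set t := r.toNNReal with ht
  have hr0 : 0 ≤ r := s.2.trans hr.1
  have hrt : (t : ℝ) = r := Real.coe_toNNReal r hr0
  have hst2 : s ≤ t := by rw [← NNReal.coe_le_coe, hrt]; exact hr.1
  have hS : MeasurableSet {ω | Q t ω ≠ k} := hQr t (measurableSet_singleton k).compl
  have h1 : ∫ ω in B, (a - (1 + R) * D * Set.indicator {ω | Q t ω ≠ k} (fun _ => (1 : ℝ)) ω) ∂P ≤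
      ∫ ω in B, (n : ℝ) * generator lam mu (u t ω) g (Q t ω) ∂P := by
    refine integral_mono_ae ?_ (hgint g D hg0 hgD t) (Eventually.of_forall fun ω => ?_)
    · exact (integrable_const _).sub (((integrable_const _).indicator hS).const_mul _)
    · dsimp only
      by_cases hq : Q t ω = k
      · rw [Set.indicator_of_notMem (by simpa using hq), mul_zero, sub_zero, hq]
        exact hgen _ (hU _ _)
      · rw [Set.indicator_of_mem (by simpa using hq), mul_one]
        have := (abs_le.1 (hbound g D hg0 hgD t ω)).1
        linarith
  refine le_trans ?_ h1
  rw [integral_sub (integrable_const _) (((integrable_const _).indicator hS).const_mul _),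
    integral_const_mul, integral_indicator hS, Measure.restrict_restrict hS]
  simp only [integral_const, smul_eq_mul, mul_one, measureReal_restrict_apply_univ]
  have h2 := stay t hst2
  rw [Set.inter_comm] at h2
  have h3 : (t : ℝ) - s ≤ h := by
    have := hr.2
    push_cast at this
    linarith
  have h4 : P.real ({ω | Q t ω ≠ k} ∩ B) ≤ R * h * P.real B := by
    refine h2.trans ?_
    gcongr
  have h5 : (1 + R) * D * P.real ({ω | Q t ω ≠ k} ∩ B) ≤ (1 + R) * D * (R * h * P.real B) := by
    gcongr
  linarith

/-- The number of customers in the queues up to the `i`-th. -/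
def levelSum {J : ℕ} (i : Fin J) (k : Fin J → ℕ) : ℝ := ∑ j ∈ Finset.Iic i, (k j : ℝ)

theorem levelSum_nonneg {J : ℕ} (i : Fin J) (k : Fin J → ℕ) : 0 ≤ levelSum i k :=
  Finset.sum_nonneg fun _ _ => Nat.cast_nonneg _

theorem levelSum_arrive {J : ℕ} [NeZero J] (i : Fin J) (k : Fin J → ℕ) :
    levelSum i (arrive k) = levelSum i k + 1 := by
  have h : ∀ j, ((arrive k j : ℕ) : ℝ) = k j + if j = 0 then 1 else 0 := by
    intro j
    unfold arrive
    split_ifs <;> simp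
  unfold levelSum
  simp_rw [h]
  rw [Finset.sum_add_distrib, Finset.sum_ite_eq' (Finset.Iic i) (0 : Fin J),
    if_pos (Finset.mem_Iic.2 (Fin.zero_le _))]

theorem levelSum_serve {J : ℕ} (i j : Fin J) {k : Fin J → ℕ} (hk : 1 ≤ k j) :
    levelSum i (serve j k) = levelSum i k - if j = i then 1 else 0 := by
  have h : ∀ l, ((serve j k l : ℕ) : ℝ) =
      k l - (if l = j then 1 else 0) + if l.val = j.val + 1 then 1 else 0 := by
    intro l
    unfold serve
    by_cases h1 : l = j
    · subst h1
      simp [Nat.cast_sub hk]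
    · rw [if_neg h1, if_neg h1]
      split_ifs <;> simp
  have h2 : ∑ l ∈ Finset.Iic i, (if l.val = j.val + 1 then (1 : ℝ) else 0) =
      if j.val + 1 ≤ i.val then 1 else 0 := by
    split_ifs with hj
    · have hlt : j.val + 1 < J := by omega
      rw [Finset.sum_eq_single ⟨j.val + 1, hlt⟩]
      · simp
      · intro b _ hb
        rw [if_neg fun h => hb (Fin.ext h)]
      · intro hb
        exact absurd (Finset.mem_Iic.2 (Fin.le_def.2 hj)) hb
    · refine Finset.sum_eq_zero fun l hl => if_neg ?_
      have := Fin.le_def.1 (Finset.mem_Iic.1 hl)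
      omega
  unfold levelSum
  simp_rw [h]
  rw [Finset.sum_add_distrib, Finset.sum_sub_distrib, Finset.sum_ite_eq' (Finset.Iic i) j, h2]
  simp only [Finset.mem_Iic, Fin.le_def]
  have h3 : j = i ↔ j.val = i.val := Fin.ext_iff
  split_ifs <;> first | omega | ring

/-- The exponential test function `exp (-n a (∑_{j ≤ i} (z_j - x_j)))` in terms of queue lengths,
truncated outside the rectangle. -/
def expTest {J : ℕ} (a Z : ℝ) (i : Fin J) (k : Fin J → ℕ) : ℝ :=
  min (Real.exp (a * (levelSum i k - Z))) (Real.exp a)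

theorem expTest_eq {J : ℕ} {a Z : ℝ} (ha : 0 ≤ a) {i : Fin J} {k : Fin J → ℕ}
    (hk : levelSum i k ≤ Z + 1) : expTest a Z i k = Real.exp (a * (levelSum i k - Z)) := by
  refine min_eq_left (Real.exp_le_exp.2 ?_)
  nlinarith

theorem generator_expTest_ge {J : ℕ} [NeZero J] {lam a Z : ℝ} {mu v : Fin J → ℝ}
    (hmu : ∀ i, 0 ≤ mu i) (ha : 0 ≤ a) (hv : v ∈ controlSet J) {i : Fin J}
    {k : Fin J → ℕ} (hk : levelSum i k ≤ Z) :
    (lam * (Real.exp a - 1) - mu i * (1 - Real.exp (-a))) * expTest a Z i k ≤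
      generator lam mu v (expTest a Z i) k := by
  set F := expTest a Z i with hF
  have hFk : F k = Real.exp (a * (levelSum i k - Z)) := expTest_eq ha (by linarith)
  have hFpos : 0 < F k := by rw [hFk]; exact Real.exp_pos _
  have harr : F (arrive k) = F k * Real.exp a := by
    rw [hFk, hF, expTest_eq ha (by rw [levelSum_arrive]; linarith), levelSum_arrive, ← Real.exp_add]
    ring_nf
  have hserve : ∀ j, 1 ≤ k j → F (serve j k) = if j = i then F k * Real.exp (-a) else F k := by
    intro j hj
    have h1 : levelSum i (serve j k) ≤ Z + 1 := by
      rw [levelSum_serve i j hj]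
      split_ifs <;> linarith
    rw [hFk, hF, expTest_eq ha h1, levelSum_serve i j hj]
    split_ifs
    · rw [← Real.exp_add]; ring_nf
    · rw [sub_zero]
  have hexp : Real.exp (-a) ≤ 1 := by rw [Real.exp_le_one_iff]; linarith
  have hsum : ∑ j, -(if j = i then mu i * (1 - Real.exp (-a)) * F k else 0) ≤
      ∑ j, v j * mu j * (if 1 ≤ k j then F (serve j k) - F k else 0) := by
    refine Finset.sum_le_sum fun j _ => ?_
    by_cases hj : j = i
    · subst hj
      rw [if_pos rfl]
      have h0 : 0 ≤ mu j * (1 - Real.exp (-a)) * F k :=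
        mul_nonneg (mul_nonneg (hmu j) (by linarith)) hFpos.le
      split_ifs with h1
      · rw [hserve j h1, if_pos rfl]
        nlinarith [mul_nonneg h0 (sub_nonneg.2 (hv j).2)]
      · simpa using h0
    · rw [if_neg hj]
      split_ifs with h1
      · rw [hserve j h1, if_neg hj]; simp
      · simp
  rw [Finset.sum_neg_distrib, Finset.sum_ite_eq' Finset.univ i, if_pos (Finset.mem_univ _)] at hsum
  unfold generator
  rw [harr]
  linarith

theorem scaled_apply {J : ℕ} (n : ℕ) (k : Fin J → ℕ) (i : Fin J) :
    scaled n k i = (k i : ℝ) / n := rfl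

theorem scaled_injective {J : ℕ} {n : ℕ} (hn : 1 ≤ n) :
    Function.Injective (scaled n : (Fin J → ℕ) → State J) := by
  intro k l h
  ext i
  have h1 : (k i : ℝ) / n = l i / n := congrArg (fun x : State J => x i) h
  have hn' : (n : ℝ) ≠ 0 := by positivity
  field_simp at h1
  exact_mod_cast h1

theorem finite_setOf_scaled_mem {J : ℕ} [NeZero J] (z : State J) {n : ℕ} (hn : 1 ≤ n) :
    {k : Fin J → ℕ | scaled n k ∈ domainG z}.Finite := by
  refine (Set.finite_Iic fun j => ⌊n * z j⌋₊).subset fun k hk j => ?_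
  have h1 := (domainG_subset_closedBox z hk j).2
  have hn' : (0 : ℝ) < n := by exact_mod_cast hn
  rw [scaled_apply, div_le_iff₀ hn'] at h1
  exact Nat.le_floor (by linarith)

theorem exitTime_le {J : ℕ} [NeZero J] {lam : ℝ} {mu : Fin J → ℝ} {n : ℕ} {x z : State J}
    (A : ControlledProcess J lam mu n x) {ω : A.Ω} {t : ℝ≥0}
    (h : scaled n (A.Q t ω) ∉ domainG z) : exitTime z A ω ≤ t :=
  iInf₂_le t h

set_option maxHeartbeats 1000000 in
/-- Under any control the expected discounted exit time is at least exponentially small with the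
rate `a ∑_{j ≤ i} (z_j - x_j)`, for every `a > β_i`: observed along a fine time grid until the
first exit, the discounted test function is a submartingale. -/
theorem le_cost {J : ℕ} [NeZero J] {c lam : ℝ} {mu : Fin J → ℝ} {z : State J}
    (hc : 0 < c) (hlam : 0 < lam) (hmu : ∀ i, 0 < mu i) {i : Fin J} {b a : ℝ}
    (hb : IsPositiveRoot c lam (mu i) b) (hba : b < a) {n : ℕ} (hn : 1 ≤ n) {k₀ : Fin J → ℕ}
    (hk₀ : scaled n k₀ ∈ domainG z) (A : ControlledProcess J lam mu n (scaled n k₀)) :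
    ENNReal.ofReal (Real.exp (a * (levelSum i k₀ - n * ∑ j ∈ Finset.Iic i, z j) - a)) ≤
      cost c z A := by
  obtain ⟨Ω, mΩ, P, isProb, ℱ, complete, Q, u, rightCont, leftLim, adapted_Q, measurable_u,
    adapted_u, u_mem, start, martingale⟩ := A
  set A : ControlledProcess J lam mu n (scaled n k₀) := ⟨Ω, mΩ, P, isProb, ℱ, complete, Q, u,
    rightCont, leftLim, adapted_Q, measurable_u, adapted_u, u_mem, start, martingale⟩ with hA
  have ha : 0 < a := hb.1.trans hba
  have hn' : (0 : ℝ) < n := by exact_mod_cast hn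
  set Z : ℝ := n * ∑ j ∈ Finset.Iic i, z j with hZ
  set F := expTest a Z i with hF
  set S : Set (Fin J → ℕ) := {k | scaled n k ∈ domainG z} with hS
  have hSfin : S.Finite := finite_setOf_scaled_mem z hn
  have hSZ : ∀ k ∈ S, levelSum i k ≤ Z := by
    intro k hk
    rw [hZ, levelSum, Finset.mul_sum]
    refine Finset.sum_le_sum fun j _ => ?_
    have h1 := (domainG_subset_closedBox z hk j).2
    rw [scaled_apply, div_le_iff₀ hn'] at h1
    linarith
  have hFpos : ∀ k, 0 < F k := fun k => lt_min (Real.exp_pos _) (Real.exp_pos _)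
  have hFa : ∀ k, F k ≤ Real.exp a := fun k => min_le_right _ _
  have hZ0 : 0 ≤ Z := (levelSum_nonneg i k₀).trans (hSZ k₀ hk₀)
  have hFmin : ∀ k, Real.exp (-(a * Z)) ≤ F k := by
    intro k
    refine le_min (Real.exp_le_exp.2 ?_) (Real.exp_le_exp.2 ?_)
    · nlinarith [mul_nonneg ha.le (levelSum_nonneg i k)]
    · nlinarith [mul_nonneg ha.le hZ0]
  -- the surplus of the growth rate of the test function over the discount rate
  set κ := lam * (Real.exp a - 1) - mu i * (1 - Real.exp (-a)) - c with hκ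
  have hκ0 : 0 < κ := by
    have := hb.neg_of_lt hc hlam (hmu i) hba
    rw [hκ]; linarith
  set R := n * (lam + ∑ j, mu j) with hR
  have hR0 : 0 < R := by
    have := Finset.sum_nonneg fun j (_ : j ∈ Finset.univ) => (hmu j).le
    positivity
  set D := Real.exp a + n * (c + κ) * Real.exp a with hD
  have hD0 : 0 < D := by positivity
  set C₂ := (1 + R) * D * R with hC₂
  have hC₂0 : 0 < C₂ := by positivity
  have hQm : Measurable fun q : ℝ≥0 × Ω => Q q.1 q.2 :=
    measurable_uncurry_of_rightCont (fun t => (adapted_Q t).mono (ℱ.le t) le_rfl) rightCont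
  -- a grid so fine that the surplus outweighs the errors of second order in the step `h`
  obtain ⟨h, hh0, hh1, hh2⟩ : ∃ h : ℝ≥0, 0 < h ∧ (n : ℝ) * c * h ≤ 1 ∧
      h * (Real.exp a * (n * c) ^ 2 + C₂) ≤ n * κ * Real.exp (-(a * Z)) := by
    set E := Real.exp a * (n * c) ^ 2 + C₂ with hE
    have hE0 : 0 < E := by positivity
    have hpos : 0 < min (1 / (n * c)) (n * κ * Real.exp (-(a * Z)) / E) := by positivity
    obtain ⟨h, hh⟩ : ∃ h : ℝ≥0, (h : ℝ) = min (1 / (n * c)) (n * κ * Real.exp (-(a * Z)) / E) :=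
      ⟨Real.toNNReal _, Real.coe_toNNReal _ hpos.le⟩
    refine ⟨h, by rw [← NNReal.coe_pos, hh]; exact hpos, ?_, ?_⟩
    · have := min_le_left (1 / (n * c)) (n * κ * Real.exp (-(a * Z)) / E)
      rw [← hh, le_div_iff₀ (by positivity)] at this
      linarith
    · have := min_le_right (1 / (n * c)) (n * κ * Real.exp (-(a * Z)) / E)
      rwa [← hh, le_div_iff₀ hE0] at this
  -- one step of the grid
  have step : ∀ (s : ℝ≥0) (B : Set Ω), MeasurableSet[ℱ s] B → (∀ ω ∈ B, Q s ω ∈ S) →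
      Real.exp (n * c * h) * ∫ ω in B, F (Q s ω) ∂P ≤ ∫ ω in B, F (Q (s + h) ω) ∂P := by
    intro s B hB hBS
    have hdecomp : B = ⋃ k ∈ hSfin.toFinset, B ∩ {ω | Q s ω = k} := by
      ext ω
      simp only [Set.Finite.mem_toFinset, Set.mem_iUnion, Set.mem_inter_iff, exists_prop]
      constructor
      · exact fun hω => ⟨Q s ω, hBS ω hω, hω, rfl⟩
      · rintro ⟨k, -, hω, -⟩
        exact hω
    have hmk : ∀ k, MeasurableSet[ℱ s] (B ∩ {ω | Q s ω = k}) := fun k =>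
      MeasurableSet.inter hB (adapted_Q s (measurableSet_singleton k))
    have hdisj : Set.PairwiseDisjoint (↑hSfin.toFinset) fun k => B ∩ {ω | Q s ω = k} := by
      intro k _ l _ hkl
      rw [Function.onFun, Set.disjoint_left]
      rintro ω ⟨-, h1⟩ ⟨-, h2⟩
      exact hkl (h1.symm.trans h2)
    have hint : ∀ t (B' : Set Ω), IntegrableOn (fun ω => F (Q t ω)) B' P := by
      intro t B'
      refine Integrable.of_bound (C := Real.exp a) ?_ (Eventually.of_forall fun ω => ?_)
      · exact ((Measurable.of_discrete (f := F)).comp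
          (hQm.comp (measurable_const.prodMk measurable_id))).aestronglyMeasurable
      · rw [Real.norm_of_nonneg (hFpos _).le]
        exact hFa _
    have hsplit : ∀ t, ∫ ω in B, F (Q t ω) ∂P =
        ∑ k ∈ hSfin.toFinset, ∫ ω in B ∩ {ω | Q s ω = k}, F (Q t ω) ∂P := by
      intro t
      conv_lhs => rw [hdecomp]
      exact integral_biUnion_finset _ (fun k _ => ℱ.le s _ (hmk k)) hdisj fun k _ => hint _ _
    rw [hsplit, hsplit, Finset.mul_sum]
    refine Finset.sum_le_sum fun k hk => ?_
    have hkS : k ∈ S := by simpa using hk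
    have h1 := setIntegral_ge_of_generator_ge (P := P) (ℱ := ℱ) (g := F) (D := D)
      (a := n * (c + κ) * F k) (k := k) hlam.le (fun j => (hmu j).le) hQm measurable_u u_mem
      martingale (fun l => (hFpos l).le) (fun l => (hFa l).trans (by rw [hD]; simp; positivity))
      (by
        have h2 : n * (c + κ) * F k ≤ n * (c + κ) * Real.exp a := by
          gcongr
          exact hFa k
        have := Real.exp_pos a
        rw [hD]; linarith)
      (fun v hv => by
        have h2 := generator_expTest_ge (lam := lam) (a := a) (fun j => (hmu j).le) ha.le hv (hSZ k hkS)
        have h3 : lam * (Real.exp a - 1) - mu i * (1 - Real.exp (-a)) = c + κ := by rw [hκ]; ring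
        rw [h3] at h2
        rw [mul_assoc]
        exact mul_le_mul_of_nonneg_left h2 hn'.le)
      h (hmk k) (fun ω hω => hω.2)
    refine le_trans ?_ h1
    have h2 : ∫ ω in B ∩ {ω | Q s ω = k}, F (Q s ω) ∂P =
        P.real (B ∩ {ω | Q s ω = k}) * F k := by
      rw [setIntegral_congr_fun (g := fun _ => F k) (ℱ.le s _ (hmk k)) fun ω hω => by
        have : Q s ω = k := hω.2
        simp [this]]
      simp
    rw [h2, ← mul_assoc, mul_comm (Real.exp _), mul_assoc]
    refine mul_le_mul_of_nonneg_left ?_ measureReal_nonneg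
    have h3 : Real.exp (n * c * h) ≤ 1 + n * c * h + (n * c * h) ^ 2 := by
      have h4 : 0 ≤ (n : ℝ) * c * h := by positivity
      have := (abs_le.1 (Real.abs_exp_sub_one_sub_id_le (x := n * c * h)
        (by rw [abs_of_nonneg h4]; exact hh1))).2
      linarith
    have h5 := hFmin k
    have h6 := hFa k
    have hh0' : (0 : ℝ) < h := by exact_mod_cast hh0
    have h7 : h * (F k * (n * c) ^ 2 + C₂) ≤ n * κ * F k := by
      calc h * (F k * (n * c) ^ 2 + C₂) ≤ h * (Real.exp a * (n * c) ^ 2 + C₂) := by gcongr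
        _ ≤ n * κ * Real.exp (-(a * Z)) := hh2
        _ ≤ n * κ * F k := by gcongr
    have h8 := mul_le_mul_of_nonneg_left h7 hh0'.le
    have h9 := mul_le_mul_of_nonneg_right h3 (hFpos k).le
    rw [← hR, ← hC₂]
    nlinarith
  -- no exit before the `j`-th grid point
  set E : ℕ → Set Ω := fun j => {ω | ∀ m < j, Q (m * h) ω ∈ S} with hE
  have hEsucc : ∀ j, E (j + 1) = E j ∩ {ω | Q (j * h) ω ∈ S} := by
    intro j
    ext ω
    simp only [hE, Set.mem_ofPred_eq, Set.mem_inter_iff, Nat.lt_succ_iff_lt_or_eq, or_imp,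
      forall_and, forall_eq]
  have hEm : ∀ j : ℕ, MeasurableSet[ℱ (j * h)] (E (j + 1)) := by
    intro j
    have : E (j + 1) = ⋂ m : ℕ, ⋂ _ : m < j + 1, {ω | Q (m * h) ω ∈ S} := by
      ext ω; simp [hE]
    rw [this]
    refine MeasurableSet.iInter fun m => MeasurableSet.iInter fun hm => ?_
    have hmj : (m : ℝ≥0) * h ≤ j * h := by
      gcongr
      exact Nat.lt_succ_iff.1 hm
    exact ℱ.mono hmj _ (adapted_Q _ (MeasurableSet.of_discrete (s := S)))
  have hEm' : ∀ j, MeasurableSet (E j) := by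
    intro j
    cases j with
    | zero => simp [hE]
    | succ j => exact ℱ.le _ _ (hEm j)
  have hEsub : ∀ j, E (j + 1) ⊆ E j := fun j => by rw [hEsucc]; exact Set.inter_subset_left
  have hEanti : Antitone E := antitone_nat_of_succ_le hEsub
  have hint : ∀ t (B' : Set Ω), IntegrableOn (fun ω => F (Q t ω)) B' P := by
    intro t B'
    refine Integrable.of_bound (C := Real.exp a) ?_ (Eventually.of_forall fun ω => ?_)
    · exact ((Measurable.of_discrete (f := F)).comp
        (hQm.comp (measurable_const.prodMk measurable_id))).aestronglyMeasurable
    · rw [Real.norm_of_nonneg (hFpos _).le]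
      exact hFa _
  have hup : ∀ t (B' : Set Ω), ∫ ω in B', F (Q t ω) ∂P ≤ Real.exp a * P.real B' := by
    intro t B'
    have := norm_setIntegral_le_of_norm_le_const (μ := P) (s := B') (f := fun ω => F (Q t ω))
      (C := Real.exp a) (measure_lt_top _ _)
      fun ω _ => by rw [Real.norm_of_nonneg (hFpos _).le]; exact hFa _
    exact (le_abs_self _).trans this
  have tele : ∀ N : ℕ, F k₀ ≤
      Real.exp a * ∑ j ∈ Finset.range N, Real.exp (-(n * c * (j * h))) * P.real (E j \ E (j + 1)) +
        Real.exp (-(n * c * (N * h))) * ∫ ω in E N, F (Q (N * h) ω) ∂P := by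
    intro N
    induction N with
    | zero =>
      have h1 : ∫ ω in E 0, F (Q ((0 : ℕ) * h) ω) ∂P = F k₀ := by
        have h2 : E 0 = Set.univ := by ext; simp [hE]
        rw [h2, setIntegral_univ]
        have h3 : (fun ω => F (Q ((0 : ℕ) * h) ω)) =ᵐ[P] fun _ => F k₀ := by
          filter_upwards [start] with ω hω
          rw [Nat.cast_zero, zero_mul, scaled_injective hn hω]
        rw [integral_congr_ae h3]
        simp
      rw [h1]
      simp
    | succ N ih =>
      refine ih.trans ?_
      rw [Finset.sum_range_succ, mul_add, add_assoc]
      refine add_le_add le_rfl ?_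
      have h1 : ∫ ω in E N, F (Q (N * h) ω) ∂P = ∫ ω in E (N + 1), F (Q (N * h) ω) ∂P +
          ∫ ω in E N \ E (N + 1), F (Q (N * h) ω) ∂P := by
        have h2 := integral_inter_add_sdiff (μ := P) (s := E N) (hEm' (N + 1)) (hint (N * h) (E N))
        rw [Set.inter_eq_right.2 (hEsub N)] at h2
        exact h2.symm
      have h3 := step (N * h) (E (N + 1)) (hEm N) (fun ω hω => hω N (Nat.lt_succ_self N))
      have h4 := hup (N * h) (E N \ E (N + 1))
      have h5 : (N : ℝ≥0) * h + h = ((N + 1 : ℕ) : ℝ≥0) * h := by push_cast; ring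
      rw [h5] at h3
      have h6 : Real.exp (-(n * c * ((N + 1 : ℕ) * h))) * Real.exp (n * c * h) =
          Real.exp (-(n * c * (N * h))) := by
        rw [← Real.exp_add]; push_cast; ring_nf
      have h7 := mul_le_mul_of_nonneg_left h3 (Real.exp_pos (-(n * c * ((N + 1 : ℕ) * h)))).le
      rw [← mul_assoc, h6] at h7
      have h8 := mul_le_mul_of_nonneg_left h4 (Real.exp_pos (-(n * c * (N * h)))).le
      rw [h1, mul_add]
      linarith
  set f : Ω → ℝ≥0∞ := fun ω => ENNReal.ofReal (Real.exp (-((n : ℝ) * c * (exitTime z A ω).toReal)))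
    with hf
  have hcost : ∀ N : ℕ, ENNReal.ofReal (∑ j ∈ Finset.range N,
      Real.exp (-(n * c * (j * h))) * P.real (E j \ E (j + 1))) ≤ cost c z A := by
    intro N
    have hd : Set.PairwiseDisjoint (↑(Finset.range N)) fun j => E j \ E (j + 1) := by
      have key : ∀ j l : ℕ, j < l → Disjoint (E j \ E (j + 1)) (E l \ E (l + 1)) := by
        intro j l hjl
        rw [Set.disjoint_left]
        rintro ω ⟨-, h1⟩ ⟨h2, -⟩
        exact h1 (hEanti hjl h2)
      intro j _ l _ hjl
      rcases lt_or_gt_of_ne hjl with h1 | h1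
      · exact key j l h1
      · exact (key l j h1).symm
    rw [ENNReal.ofReal_sum_of_nonneg fun j _ => by positivity]
    unfold cost
    refine le_trans ?_ (setLIntegral_le_lintegral (⋃ j ∈ Finset.range N, E j \ E (j + 1)) _)
    rw [lintegral_biUnion_finset hd fun j _ => (hEm' j).diff (hEm' (j + 1))]
    refine Finset.sum_le_sum fun j _ => ?_
    rw [ENNReal.ofReal_mul (Real.exp_pos _).le, ofReal_measureReal, ← setLIntegral_const]
    refine setLIntegral_mono' ((hEm' j).diff (hEm' (j + 1))) fun ω hω => ?_
    have hout : Q (j * h) ω ∉ S := fun hin => hω.2 (by rw [hEsucc]; exact ⟨hω.1, hin⟩)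
    have hexit : exitTime z A ω ≤ ((j * h : ℝ≥0) : ℝ≥0∞) := exitTime_le A hout
    rw [if_neg (ne_top_of_le_ne_top ENNReal.coe_ne_top hexit)]
    refine ENNReal.ofReal_le_ofReal (Real.exp_le_exp.2 (neg_le_neg ?_))
    have h1 := ENNReal.toReal_mono ENNReal.coe_ne_top hexit
    rw [ENNReal.coe_toReal] at h1
    push_cast at h1
    gcongr
  have hcost1 : cost c z A ≠ ⊤ := by
    refine ne_top_of_le_ne_top ENNReal.one_ne_top ?_
    unfold cost
    calc _ ≤ ∫⁻ _ω, 1 ∂P := by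
          refine lintegral_mono fun ω => ?_
          split_ifs
          · exact zero_le
          · rw [ENNReal.ofReal_le_one, Real.exp_le_one_iff, neg_nonpos]
            positivity
      _ = 1 := by simp
  have hN : ∀ N : ℕ, F k₀ ≤ Real.exp a * (cost c z A).toReal +
      Real.exp (-(n * c * (N * h))) * Real.exp a := by
    intro N
    refine (tele N).trans (add_le_add ?_ ?_)
    · gcongr
      have := ENNReal.toReal_mono hcost1 (hcost N)
      rwa [ENNReal.toReal_ofReal (Finset.sum_nonneg fun j _ => by positivity)] at this
    · gcongr
      refine (hup _ _).trans ?_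
      have : P.real (E N) ≤ 1 := measureReal_le_one
      nlinarith [Real.exp_pos a]
  have hlim : Tendsto (fun N : ℕ => Real.exp a * (cost c z A).toReal +
      Real.exp (-(n * c * (N * h))) * Real.exp a) atTop
      (𝓝 (Real.exp a * (cost c z A).toReal + 0 * Real.exp a)) := by
    refine tendsto_const_nhds.add (Tendsto.mul_const _ (Real.tendsto_exp_neg_atTop_nhds_zero.comp ?_))
    have hh0' : (0 : ℝ) < h := by exact_mod_cast hh0
    have h1 : Tendsto (fun N : ℕ => (n : ℝ) * c * h * (N : ℝ)) atTop atTop :=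
      tendsto_natCast_atTop_atTop.const_mul_atTop (by positivity)
    refine h1.congr fun N => by ring
  have hfin := ge_of_tendsto' hlim hN
  rw [zero_mul, add_zero, hF, expTest_eq ha.le (by linarith [hSZ k₀ hk₀])] at hfin
  rw [ENNReal.ofReal_le_iff_le_toReal hcost1, Real.exp_sub, div_le_iff₀ (Real.exp_pos _)]
  linarith

theorem valueFun_le {J : ℕ} [NeZero J] {c lam : ℝ} {mu : Fin J → ℝ} {z : State J}
    (hc : 0 < c) (hlam : 0 < lam) (hmu : ∀ i, 0 < mu i) {i : Fin J} {b a : ℝ}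
    (hb : IsPositiveRoot c lam (mu i) b) (hba : b < a) {n : ℕ} (hn : 1 ≤ n) {x : State J}
    (hx : x ∈ latticeG z n) :
    valueFun c lam mu z n x ≤
      ((a * ∑ j ∈ Finset.Iic i, (z j - x j) + a / n : ℝ) : EReal) := by
  obtain ⟨hxG, k, rfl⟩ := hx
  unfold valueFun
  rw [EReal.neg_le, ← EReal.coe_neg]
  refine le_iInf fun A => ?_
  have hn' : (0 : ℝ) < n := by exact_mod_cast hn
  have h1 := ENNReal.log_monotone (le_cost hc hlam hmu hb hba hn hxG A)
  rw [ENNReal.log_ofReal_of_pos (Real.exp_pos _), Real.log_exp] at h1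
  have h2 := mul_le_mul_of_nonneg_left h1
    (show (0 : EReal) ≤ (((n : ℝ)⁻¹ : ℝ) : EReal) by exact_mod_cast (inv_pos.2 hn').le)
  refine le_trans (le_of_eq ?_) h2
  rw [← EReal.coe_mul]
  congr 1
  have h3 : ∑ j ∈ Finset.Iic i, (z j - scaled n k j) =
      ∑ j ∈ Finset.Iic i, z j - levelSum i k / n := by
    rw [Finset.sum_sub_distrib, levelSum, Finset.sum_div]
    rfl
  rw [h3]
  field_simp
  ring

/-! ### Independent noise -/

/-- Resampling one coordinate of an i.i.d. sequence does not change its law. -/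
theorem measurePreserving_update {N : Type*} [MeasurableSpace N] (ν : Measure N)
    [IsProbabilityMeasure ν] (j : ℕ) :
    MeasurePreserving (fun q : (ℕ → N) × N => Function.update q.1 j q.2)
      ((Measure.infinitePi fun _ : ℕ => ν).prod ν) (Measure.infinitePi fun _ : ℕ => ν) := by
  have hm : Measurable fun q : (ℕ → N) × N => Function.update q.1 j q.2 := by
    refine measurable_pi_lambda _ fun i => ?_
    by_cases h : i = j
    · subst h
      simpa using measurable_snd
    · simp only [Function.update_of_ne h]
      exact (measurable_pi_apply i).comp measurable_fst
  refine ⟨hm, Measure.eq_infinitePi _ fun s t ht => ?_⟩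
  rw [Measure.map_apply hm (MeasurableSet.pi s.countable_toSet fun i _ => ht i)]
  by_cases hj : j ∈ s
  · have h1 : (fun q : (ℕ → N) × N => Function.update q.1 j q.2) ⁻¹' (Set.pi ↑s t) =
        (Set.pi ↑(s.erase j) t) ×ˢ t j := by
      ext ⟨ω, x⟩
      simp only [Set.mem_preimage, Set.mem_pi, Finset.mem_coe, Set.mem_prod, Finset.mem_erase]
      constructor
      · intro h
        refine ⟨fun i hi => ?_, ?_⟩
        · simpa [Function.update_of_ne hi.1] using h i hi.2
        · simpa using h j hj
      · rintro ⟨h1, h2⟩ i hi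
        by_cases hij : i = j
        · subst hij; simpa using h2
        · simpa [Function.update_of_ne hij] using h1 i ⟨hij, hi⟩
    rw [h1, Measure.prod_prod, Measure.infinitePi_pi _ fun i _ => ht i,
      Finset.prod_erase_mul s _ hj]
  · have h1 : (fun q : (ℕ → N) × N => Function.update q.1 j q.2) ⁻¹' (Set.pi ↑s t) =
        (Set.pi ↑s t) ×ˢ Set.univ := by
      ext ⟨ω, x⟩
      simp only [Set.mem_preimage, Set.mem_pi, Finset.mem_coe, Set.mem_prod, Set.mem_univ, and_true]
      refine forall₂_congr fun i hi => ?_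
      have hij : i ≠ j := fun h => hj (h ▸ hi)
      simp [Function.update_of_ne hij]
    rw [h1, Measure.prod_prod, Measure.infinitePi_pi _ fun i _ => ht i, measure_univ, mul_one]

/-- The exponential law of rate `r`, on the nonnegative reals. -/
def gapMeasure (r : ℝ) : Measure ℝ≥0 := (expMeasure r).map Real.toNNReal

theorem isProbabilityMeasure_gapMeasure {r : ℝ} (hr : 0 < r) :
    IsProbabilityMeasure (gapMeasure r) := by
  have := isProbabilityMeasure_expMeasure hr
  exact Measure.isProbabilityMeasure_map measurable_real_toNNReal.aemeasurable

theorem gapMeasure_real_Iic {r : ℝ} (hr : 0 < r) (b : ℝ≥0) :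
    (gapMeasure r).real {x | x ≤ b} = 1 - Real.exp (-(r * b)) := by
  have := isProbabilityMeasure_expMeasure hr
  have h1 := cdf_expMeasure_eq hr (b : ℝ)
  rw [if_pos b.coe_nonneg, cdf_eq_real] at h1
  have h2 : MeasurableSet {x : ℝ≥0 | x ≤ b} := measurableSet_Iic
  rw [← h1, gapMeasure, map_measureReal_apply measurable_real_toNNReal h2]
  congr 1
  ext x
  simp [Real.toNNReal_le_iff_le_coe]

/-- The Laplace transform of the exponential law. -/
theorem lintegral_exp_gapMeasure {r θ : ℝ} (hr : 0 < r) (hθ : 0 ≤ θ) :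
    ∫⁻ x, ENNReal.ofReal (Real.exp (-(θ * (x : ℝ)))) ∂gapMeasure r = ENNReal.ofReal (r / (r + θ)) := by
  have hmeas : Measurable fun x : ℝ≥0 => ENNReal.ofReal (Real.exp (-(θ * (x : ℝ)))) := by fun_prop
  rw [gapMeasure, lintegral_map hmeas measurable_real_toNNReal]
  have h1 : expMeasure r = volume.withDensity (exponentialPDF r) := rfl
  have hpdf : ∀ s, Measurable (exponentialPDF s) := fun s =>
    (measurable_exponentialPDFReal s).ennreal_ofReal
  have hm2 : Measurable fun a : ℝ =>
      ENNReal.ofReal (Real.exp (-(θ * ((a.toNNReal : ℝ≥0) : ℝ)))) :=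
    hmeas.comp measurable_real_toNNReal
  rw [h1, lintegral_withDensity_eq_lintegral_mul _ (hpdf r) hm2]
  have h2 : ∀ x, (exponentialPDF r * fun a : ℝ =>
      ENNReal.ofReal (Real.exp (-(θ * ((a.toNNReal : ℝ≥0) : ℝ))))) x =
      ENNReal.ofReal (r / (r + θ)) * exponentialPDF (r + θ) x := by
    intro x
    rw [Pi.mul_apply]
    rcases lt_or_ge x 0 with hx | hx
    · rw [exponentialPDF_of_neg hx, exponentialPDF_of_neg hx]; simp
    · rw [exponentialPDF_of_nonneg hx, exponentialPDF_of_nonneg hx,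
        ← ENNReal.ofReal_mul (by positivity), ← ENNReal.ofReal_mul (by positivity),
        Real.coe_toNNReal x hx]
      congr 1
      rw [mul_assoc, ← Real.exp_add]
      have : r / (r + θ) * ((r + θ) * Real.exp (-((r + θ) * x))) = r * Real.exp (-((r + θ) * x)) := by
        field_simp
      rw [this]
      ring_nf
  simp_rw [h2]
  rw [lintegral_const_mul _ (hpdf _), lintegral_exponentialPDF_eq_one (by positivity), mul_one]

/-- The compensator of the jump of an exponential clock: `P(T ≤ b) = r E[min T b]`. -/
theorem gapMeasure_real_Iic_eq {r : ℝ} (hr : 0 < r) (b : ℝ≥0) :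
    (gapMeasure r).real {x | x ≤ b} = r * ∫ x, min (x : ℝ) b ∂gapMeasure r := by
  have := isProbabilityMeasure_gapMeasure hr
  have hint : Integrable (fun x : ℝ≥0 => min (x : ℝ) b) (gapMeasure r) := by
    refine Integrable.of_bound (C := b) (by fun_prop) (Eventually.of_forall fun x => ?_)
    rw [Real.norm_of_nonneg (le_min x.coe_nonneg b.coe_nonneg)]
    exact min_le_right _ _
  rw [hint.integral_eq_integral_meas_lt (Eventually.of_forall fun x => le_min x.coe_nonneg b.coe_nonneg)]
  have h1 : ∀ t ∈ Set.Ioi (0 : ℝ), (gapMeasure r).real {x : ℝ≥0 | t < min (x : ℝ) b} =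
      (Set.Ioo 0 (b : ℝ)).indicator (fun t => Real.exp (-(r * t))) t := by
    intro t ht
    have ht0 : (0 : ℝ) < t := ht
    by_cases htb : t < b
    · rw [Set.indicator_of_mem (show t ∈ Set.Ioo 0 (b : ℝ) from ⟨ht0, htb⟩)]
      have h2 := gapMeasure_real_Iic hr t.toNNReal
      have h3 : {x : ℝ≥0 | t < min (x : ℝ) b} = {x : ℝ≥0 | x ≤ t.toNNReal}ᶜ := by
        ext x
        simp only [lt_min_iff, Set.mem_ofPred_eq, Set.mem_compl_iff, not_le, htb, and_true]
        rw [Real.toNNReal_lt_iff_lt_coe ht0.le]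
      have h6 : MeasurableSet {x : ℝ≥0 | x ≤ t.toNNReal} := measurableSet_Iic
      rw [h3, probReal_compl_eq_one_sub h6, h2, Real.coe_toNNReal t ht0.le]
      simp only [sub_sub_cancel]
    · rw [Set.indicator_of_notMem fun h => htb h.2]
      have h3 : {x : ℝ≥0 | t < min (x : ℝ) b} = ∅ := by
        ext x
        simp only [lt_min_iff, Set.mem_ofPred_eq, Set.mem_empty_iff_false, iff_false, not_and]
        exact fun _ => htb
      rw [h3]; simp
  rw [setIntegral_congr_fun measurableSet_Ioi h1, setIntegral_indicator measurableSet_Ioo,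
    Set.inter_eq_right.2 Set.Ioo_subset_Ioi_self, ← integral_Ioc_eq_integral_Ioo,
    ← intervalIntegral.integral_of_le b.coe_nonneg, gapMeasure_real_Iic hr]
  have h4 : ∀ x ∈ Set.uIcc (0 : ℝ) b, HasDerivAt (fun x => -(Real.exp (-(r * x)) / r))
      (Real.exp (-(r * x))) x := by
    intro x _
    have h5 : HasDerivAt (fun x => -(r * x)) (-(r * 1)) x := ((hasDerivAt_id x).const_mul r).neg
    refine ((h5.exp.div_const r).neg).congr_deriv ?_
    field_simp
  rw [intervalIntegral.integral_eq_sub_of_hasDerivAt h4 (Continuous.intervalIntegrable (by fun_prop) _ _)]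
  simp
  field_simp
  ring

/-! ### The embedded chain and its jump times -/

section JumpProcess

variable {S Mk : Type*}

/-- The time of the `m`-th jump: the sum of the first `m` gaps. -/
def jumpTime (ω : ℕ → ℝ≥0 × Mk) : ℕ → ℝ≥0
  | 0 => 0
  | m + 1 => jumpTime ω m + (ω m).1

/-- The state after `m` jumps. -/
def jumpChain (step : S → Mk → S) (k₀ : S) (ω : ℕ → ℝ≥0 × Mk) : ℕ → S
  | 0 => k₀
  | m + 1 => step (jumpChain step k₀ ω m) (ω m).2

theorem jumpTime_congr {ω ω' : ℕ → ℝ≥0 × Mk} {m : ℕ} (h : ∀ i < m, ω i = ω' i) :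
    jumpTime ω m = jumpTime ω' m := by
  induction m with
  | zero => rfl
  | succ m ih =>
    simp only [jumpTime]
    rw [ih fun i hi => h i (hi.trans (Nat.lt_succ_self m)), h m (Nat.lt_succ_self m)]

theorem jumpChain_congr (step : S → Mk → S) (k₀ : S) {ω ω' : ℕ → ℝ≥0 × Mk} {m : ℕ}
    (h : ∀ i < m, ω i = ω' i) : jumpChain step k₀ ω m = jumpChain step k₀ ω' m := by
  induction m with
  | zero => rfl
  | succ m ih =>
    simp only [jumpChain]
    rw [ih fun i hi => h i (hi.trans (Nat.lt_succ_self m)), h m (Nat.lt_succ_self m)]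

theorem monotone_jumpTime (ω : ℕ → ℝ≥0 × Mk) : Monotone (jumpTime ω) :=
  monotone_nat_of_le_succ fun _ => le_self_add

theorem update_eq_of_lt (ω : ℕ → ℝ≥0 × Mk) {i j : ℕ} (x : ℝ≥0 × Mk) (h : i < j) :
    Function.update ω j x i = ω i := Function.update_of_ne h.ne _ _

theorem jumpTime_update (ω : ℕ → ℝ≥0 × Mk) (j : ℕ) (x : ℝ≥0 × Mk) :
    jumpTime (Function.update ω j x) j = jumpTime ω j :=
  jumpTime_congr fun _ hi => update_eq_of_lt ω x hi

theorem jumpChain_update (step : S → Mk → S) (k₀ : S) (ω : ℕ → ℝ≥0 × Mk) (j : ℕ) (x : ℝ≥0 × Mk) :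
    jumpChain step k₀ (Function.update ω j x) j = jumpChain step k₀ ω j :=
  jumpChain_congr step k₀ fun _ hi => update_eq_of_lt ω x hi

theorem jumpTime_update_succ (ω : ℕ → ℝ≥0 × Mk) (j : ℕ) (x : ℝ≥0 × Mk) :
    jumpTime (Function.update ω j x) (j + 1) = jumpTime ω j + x.1 := by
  rw [jumpTime, jumpTime_update, Function.update_self]

theorem jumpChain_update_succ (step : S → Mk → S) (k₀ : S) (ω : ℕ → ℝ≥0 × Mk) (j : ℕ)
    (x : ℝ≥0 × Mk) :
    jumpChain step k₀ (Function.update ω j x) (j + 1) = step (jumpChain step k₀ ω j) x.2 := by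
  rw [jumpChain, jumpChain_update, Function.update_self]

/-- The jump times do not accumulate. -/
def NonExplosive (ω : ℕ → ℝ≥0 × Mk) : Prop := ∀ t, ∃ m, t < jumpTime ω (m + 1)

variable [MeasurableSpace Mk]

theorem measurable_jumpTime (m : ℕ) : Measurable fun ω : ℕ → ℝ≥0 × Mk => jumpTime ω m := by
  induction m with
  | zero => exact measurable_const
  | succ m ih => exact ih.add (measurable_fst.comp (measurable_pi_apply m))

theorem measurable_jumpChain [MeasurableSpace S] [Countable S] [DiscreteMeasurableSpace S]
    [Countable Mk] [DiscreteMeasurableSpace Mk]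
    (step : S → Mk → S) (k₀ : S) (m : ℕ) :
    Measurable fun ω : ℕ → ℝ≥0 × Mk => jumpChain step k₀ ω m := by
  induction m with
  | zero => exact measurable_const
  | succ m ih =>
    have h : Measurable fun p : S × Mk => step p.1 p.2 := Measurable.of_discrete
    exact h.comp (ih.prodMk (measurable_snd.comp (measurable_pi_apply m)))

/-- The law of the noise driving the jump process: i.i.d. pairs of an exponential gap and
an independent mark. -/
def noise (r : ℝ) (ν : Measure Mk) : Measure (ℕ → ℝ≥0 × Mk) :=
  Measure.infinitePi fun _ => (gapMeasure r).prod ν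

variable {r : ℝ} {ν : Measure Mk} [IsProbabilityMeasure ν]

theorem isProbabilityMeasure_noise (hr : 0 < r) : IsProbabilityMeasure (noise r ν) := by
  have := isProbabilityMeasure_gapMeasure hr
  unfold noise
  infer_instance

theorem measurePreserving_update_noise (hr : 0 < r) (j : ℕ) :
    MeasurePreserving (fun q : (ℕ → ℝ≥0 × Mk) × (ℝ≥0 × Mk) => Function.update q.1 j q.2)
      ((noise r ν).prod ((gapMeasure r).prod ν)) (noise r ν) := by
  have := isProbabilityMeasure_gapMeasure hr
  exact measurePreserving_update _ j

theorem lintegral_noise_eq (hr : 0 < r) (j : ℕ) {f : (ℕ → ℝ≥0 × Mk) → ℝ≥0∞} (hf : Measurable f) :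
    ∫⁻ ω, f ω ∂noise r ν =
      ∫⁻ ω, ∫⁻ x, f (Function.update ω j x) ∂((gapMeasure r).prod ν) ∂noise r ν := by
  have := isProbabilityMeasure_gapMeasure hr
  have h := measurePreserving_update_noise (ν := ν) hr j
  rw [← h.lintegral_comp hf, lintegral_prod]
  exact (hf.comp h.measurable).aemeasurable

theorem integral_noise_eq (hr : 0 < r) (j : ℕ) {f : (ℕ → ℝ≥0 × Mk) → ℝ} {C : ℝ} (hf : Measurable f)
    (hC : ∀ ω, |f ω| ≤ C) :
    ∫ ω, f ω ∂noise r ν =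
      ∫ ω, ∫ x, f (Function.update ω j x) ∂((gapMeasure r).prod ν) ∂noise r ν := by
  have := isProbabilityMeasure_gapMeasure hr
  have := isProbabilityMeasure_noise (ν := ν) hr
  have h := measurePreserving_update_noise (ν := ν) hr j
  rw [← h.map_eq, integral_map h.measurable.aemeasurable hf.aestronglyMeasurable, h.map_eq,
    integral_prod]
  exact Integrable.of_bound (C := C) (hf.comp h.measurable).aestronglyMeasurable
    (Eventually.of_forall fun q => hC _)

/-- `E e^{-S_m}` decreases geometrically. -/
theorem lintegral_exp_jumpTime (hr : 0 < r) (m : ℕ) :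
    ∫⁻ ω, ENNReal.ofReal (Real.exp (-(jumpTime ω m : ℝ))) ∂noise r ν =
      ENNReal.ofReal (r / (r + 1)) ^ m := by
  have := isProbabilityMeasure_gapMeasure hr
  have := isProbabilityMeasure_noise (ν := ν) hr
  have hmeas : ∀ m, Measurable fun ω : ℕ → ℝ≥0 × Mk =>
      ENNReal.ofReal (Real.exp (-(jumpTime ω m : ℝ))) := by
    intro m
    have := measurable_jumpTime (Mk := Mk) m
    fun_prop
  induction m with
  | zero => simp [jumpTime]
  | succ m ih =>
    rw [lintegral_noise_eq hr m (hmeas _)]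
    simp_rw [jumpTime_update_succ, NNReal.coe_add, neg_add, Real.exp_add,
      ENNReal.ofReal_mul (Real.exp_pos _).le]
    have h1 : ∀ ω : ℕ → ℝ≥0 × Mk, ∫⁻ x : ℝ≥0 × Mk, ENNReal.ofReal (Real.exp (-(jumpTime ω m : ℝ))) *
        ENNReal.ofReal (Real.exp (-(x.1 : ℝ))) ∂((gapMeasure r).prod ν) =
        ENNReal.ofReal (Real.exp (-(jumpTime ω m : ℝ))) * ENNReal.ofReal (r / (r + 1)) := by
      intro ω
      rw [lintegral_const_mul _ (by fun_prop), lintegral_prod _ (by fun_prop)]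
      simp only [lintegral_const, measure_univ, mul_one]
      have h2 := lintegral_exp_gapMeasure hr zero_le_one
      simp only [one_mul] at h2
      rw [h2]
    simp_rw [h1]
    rw [lintegral_mul_const _ (hmeas m), ih, pow_succ]

theorem ae_nonExplosive (hr : 0 < r) : ∀ᵐ ω ∂noise r ν, NonExplosive ω := by
  have h : ∀ T : ℕ, ∀ᵐ ω ∂noise r ν, ∃ m, (T : ℝ≥0) < jumpTime ω (m + 1) := by
    intro T
    rw [ae_iff]
    push Not
    have hlim : Tendsto (fun m : ℕ => ENNReal.ofReal (r / (r + 1)) ^ (m + 1) /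
        ENNReal.ofReal (Real.exp (-(T : ℝ)))) atTop (𝓝 (0 / ENNReal.ofReal (Real.exp (-(T : ℝ))))) := by
      refine ENNReal.Tendsto.div_const ?_ (Or.inr ?_)
      · refine (tendsto_add_atTop_iff_nat 1).2 (ENNReal.tendsto_pow_atTop_nhds_zero_of_lt_one ?_)
        rw [ENNReal.ofReal_lt_one, div_lt_one (by positivity)]
        linarith
      · simp [Real.exp_pos]
    rw [ENNReal.zero_div] at hlim
    refine le_antisymm (ge_of_tendsto' hlim fun m => ?_) zero_le
    have hmeas : Measurable fun ω : ℕ → ℝ≥0 × Mk =>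
        ENNReal.ofReal (Real.exp (-(jumpTime ω (m + 1) : ℝ))) := by
      have := measurable_jumpTime (Mk := Mk) (m + 1)
      fun_prop
    rw [← lintegral_exp_jumpTime (ν := ν) hr (m + 1)]
    refine le_trans (measure_mono fun ω hω => ?_)
      (meas_ge_le_lintegral_div hmeas.aemeasurable (by simp [Real.exp_pos]) ENNReal.ofReal_ne_top)
    refine ENNReal.ofReal_le_ofReal (Real.exp_le_exp.2 (neg_le_neg ?_))
    exact_mod_cast hω m
  filter_upwards [ae_all_iff.2 h] with ω hω t
  obtain ⟨T, hT⟩ := exists_nat_ge t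
  obtain ⟨m, hm⟩ := hω T
  exact ⟨m, hT.trans_lt hm⟩

end JumpProcess

/-! ### The paths of the jump process -/

section Paths

variable {S Mk : Type*} (step : S → Mk → S) (k₀ : S)

open scoped Classical in
/-- The state at time `t` when only the first `m` jumps are carried out. -/
def truncPath (ω : ℕ → ℝ≥0 × Mk) (t : ℝ≥0) : ℕ → S
  | 0 => k₀
  | m + 1 => if jumpTime ω (m + 1) ≤ t then jumpChain step k₀ ω (m + 1) else truncPath ω t m

open scoped Classical in
/-- The state at time `t`; on the null set where the jump times accumulate it is frozen at `k₀`, so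
that all paths are regular. -/
def path (ω : ℕ → ℝ≥0 × Mk) (t : ℝ≥0) : S :=
  if h : NonExplosive ω then truncPath step k₀ ω t (h t).choose else k₀

variable {step k₀} {ω : ℕ → ℝ≥0 × Mk} {t : ℝ≥0}

theorem truncPath_eq_jumpChain {m : ℕ} (h : jumpTime ω m ≤ t) :
    truncPath step k₀ ω t m = jumpChain step k₀ ω m := by
  cases m with
  | zero => rfl
  | succ m => rw [truncPath, if_pos h]

theorem truncPath_eq_of_le {m l : ℕ} (h : t < jumpTime ω (m + 1)) (hml : m ≤ l) :
    truncPath step k₀ ω t l = truncPath step k₀ ω t m := by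
  induction l, hml using Nat.le_induction with
  | base => rfl
  | succ l hl ih =>
    rw [truncPath, if_neg (not_le.2 (h.trans_le (monotone_jumpTime ω (Nat.succ_le_succ hl)))), ih]

theorem truncPath_congr {ω' : ℕ → ℝ≥0 × Mk} {m : ℕ} (h : ∀ i < m, ω i = ω' i) :
    truncPath step k₀ ω t m = truncPath step k₀ ω' t m := by
  induction m with
  | zero => rfl
  | succ m ih =>
    rw [truncPath, truncPath, jumpTime_congr h, jumpChain_congr step k₀ h,
      ih fun i hi => h i (hi.trans (Nat.lt_succ_self m))]

theorem path_eq_truncPath (hω : NonExplosive ω) {m : ℕ} (h : t < jumpTime ω (m + 1)) :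
    path step k₀ ω t = truncPath step k₀ ω t m := by
  rw [path, dif_pos hω]
  rcases le_total m (hω t).choose with h' | h'
  · exact truncPath_eq_of_le h h'
  · exact (truncPath_eq_of_le (hω t).choose_spec h').symm

theorem path_eq_jumpChain (hω : NonExplosive ω) {m : ℕ} (h : jumpTime ω m ≤ t)
    (h' : t < jumpTime ω (m + 1)) : path step k₀ ω t = jumpChain step k₀ ω m :=
  (path_eq_truncPath hω h').trans (truncPath_eq_jumpChain h)

theorem path_zero (hω : NonExplosive ω) (h : 0 < jumpTime ω 1) : path step k₀ ω 0 = k₀ :=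
  path_eq_truncPath (m := 0) hω h

theorem eventually_truncPath_eq (ω : ℕ → ℝ≥0 × Mk) (t : ℝ≥0) (m : ℕ) :
    ∀ᶠ s in 𝓝[≥] t, truncPath step k₀ ω s m = truncPath step k₀ ω t m := by
  induction m with
  | zero => exact Eventually.of_forall fun _ => rfl
  | succ m ih =>
    by_cases h : jumpTime ω (m + 1) ≤ t
    · filter_upwards [self_mem_nhdsWithin] with s hs
      rw [truncPath, truncPath, if_pos h, if_pos (h.trans hs)]
    · filter_upwards [ih, mem_nhdsWithin_of_mem_nhds (Iio_mem_nhds (not_le.1 h))] with s hs hs'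
      rw [truncPath, truncPath, if_neg h, if_neg (not_le.2 hs'), hs]

theorem exists_eventually_truncPath_eq (ω : ℕ → ℝ≥0 × Mk) (t : ℝ≥0) (m : ℕ) :
    ∃ q, ∀ᶠ s in 𝓝[<] t, truncPath step k₀ ω s m = q := by
  induction m with
  | zero => exact ⟨k₀, Eventually.of_forall fun _ => rfl⟩
  | succ m ih =>
    by_cases h : jumpTime ω (m + 1) < t
    · refine ⟨jumpChain step k₀ ω (m + 1), ?_⟩
      filter_upwards [mem_nhdsWithin_of_mem_nhds (Ioi_mem_nhds h)] with s hs
      rw [truncPath, if_pos (Set.mem_Ioi.1 hs).le]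
    · obtain ⟨q, hq⟩ := ih
      refine ⟨q, ?_⟩
      filter_upwards [hq, self_mem_nhdsWithin] with s hs hs'
      rw [truncPath, if_neg (not_le.2 ((Set.mem_Iio.1 hs').trans_le (not_lt.1 h))), hs]

theorem eventually_path_eq (ω : ℕ → ℝ≥0 × Mk) (t : ℝ≥0) :
    ∀ᶠ s in 𝓝[≥] t, path step k₀ ω s = path step k₀ ω t := by
  by_cases hω : NonExplosive ω
  · obtain ⟨m, hm⟩ := hω t
    filter_upwards [eventually_truncPath_eq ω t m, mem_nhdsWithin_of_mem_nhds (Iio_mem_nhds hm)]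
      with s hs hs'
    rw [path_eq_truncPath hω hm, path_eq_truncPath hω hs', hs]
  · simp [path, hω]

theorem exists_eventually_path_eq (ω : ℕ → ℝ≥0 × Mk) (t : ℝ≥0) :
    ∃ q, ∀ᶠ s in 𝓝[<] t, path step k₀ ω s = q := by
  by_cases hω : NonExplosive ω
  · obtain ⟨m, hm⟩ := hω t
    obtain ⟨q, hq⟩ := exists_eventually_truncPath_eq (step := step) (k₀ := k₀) ω t m
    refine ⟨q, ?_⟩
    filter_upwards [hq, mem_nhdsWithin_of_mem_nhds (Iio_mem_nhds hm)] with s hs hs'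
    rw [path_eq_truncPath hω hs', hs]
  · exact ⟨k₀, by simp [path, hω]⟩

open scoped Classical in
theorem apply_truncPath (h : S → ℝ) (ω : ℕ → ℝ≥0 × Mk) (t : ℝ≥0) (m : ℕ) :
    h (truncPath step k₀ ω t m) = h k₀ + ∑ j ∈ Finset.range m,
      (h (jumpChain step k₀ ω (j + 1)) - h (jumpChain step k₀ ω j)) *
        (if jumpTime ω (j + 1) ≤ t then 1 else 0) := by
  induction m with
  | zero => simp [truncPath]
  | succ m ih =>
    rw [Finset.sum_range_succ, ← add_assoc, ← ih, truncPath]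
    split_ifs with h1
    · rw [truncPath_eq_jumpChain ((monotone_jumpTime ω (Nat.le_succ m)).trans h1)]; ring
    · ring

open scoped Classical in
theorem measurable_ite_le_toNNReal (a : ℝ≥0) :
    Measurable fun s : ℝ => if a ≤ s.toNNReal then (1 : ℝ) else 0 :=
  Measurable.ite (measurable_real_toNNReal (measurableSet_Ici : MeasurableSet (Set.Ici a)))
    measurable_const measurable_const

open scoped Classical in
theorem intervalIntegrable_ite_le_toNNReal (a : ℝ≥0) (b d : ℝ) :
    IntervalIntegrable (fun s : ℝ => if a ≤ s.toNNReal then (1 : ℝ) else 0) volume b d := by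
  refine (intervalIntegrable_const (c := (1 : ℝ))).mono_fun
    (measurable_ite_le_toNNReal a).aestronglyMeasurable (Eventually.of_forall fun s => ?_)
  dsimp only
  split_ifs <;> simp

open scoped Classical in
theorem integral_ite_le_toNNReal (a t : ℝ≥0) :
    ∫ s in (0 : ℝ)..t, (if a ≤ s.toNNReal then (1 : ℝ) else 0) = ((t - a : ℝ≥0) : ℝ) := by
  have hm : MeasurableSet {s : ℝ | a ≤ s.toNNReal} :=
    measurable_real_toNNReal (measurableSet_Ici : MeasurableSet (Set.Ici a))
  have h1 : (fun s : ℝ => if a ≤ s.toNNReal then (1 : ℝ) else 0) =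
      {s : ℝ | a ≤ s.toNNReal}.indicator fun _ => 1 := by
    ext s
    simp [Set.indicator_apply]
  rw [intervalIntegral.integral_of_le t.coe_nonneg, h1, setIntegral_indicator hm,
    setIntegral_const, smul_eq_mul, mul_one]
  have h2 : (volume (Set.Ioc (0 : ℝ) t ∩ {s : ℝ | a ≤ s.toNNReal})) = ENNReal.ofReal (t - a) := by
    refine le_antisymm ?_ ?_
    · rw [← Real.volume_Icc]
      refine measure_mono fun s hs => ⟨?_, hs.1.2⟩
      have h3 : a ≤ s.toNNReal := hs.2
      rwa [Real.le_toNNReal_iff_coe_le hs.1.1.le] at h3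
    · rw [← Real.volume_Ioc]
      refine measure_mono fun s hs => ?_
      have h3 : 0 < s := a.coe_nonneg.trans_lt hs.1
      exact ⟨⟨h3, hs.2⟩, (Real.le_toNNReal_iff_coe_le h3.le).2 hs.1.le⟩
  rw [measureReal_def, h2, NNReal.coe_sub_def]
  rfl

theorem integral_truncPath (h : S → ℝ) (ω : ℕ → ℝ≥0 × Mk) (t : ℝ≥0) (m : ℕ) :
    ∫ s in (0 : ℝ)..t, h (truncPath step k₀ ω s.toNNReal m) = h k₀ * t + ∑ j ∈ Finset.range m,
      (h (jumpChain step k₀ ω (j + 1)) - h (jumpChain step k₀ ω j)) *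
        ((t - jumpTime ω (j + 1) : ℝ≥0) : ℝ) := by
  classical
  simp_rw [apply_truncPath h ω _ m]
  have hi : ∀ j, IntervalIntegrable (fun s : ℝ =>
      (h (jumpChain step k₀ ω (j + 1)) - h (jumpChain step k₀ ω j)) *
        (if jumpTime ω (j + 1) ≤ s.toNNReal then 1 else 0)) volume 0 t :=
    fun j => (intervalIntegrable_ite_le_toNNReal _ _ _).const_mul _
  have hs := IntervalIntegrable.sum (Finset.range m) fun j _ => hi j
  simp only [Finset.sum_fn] at hs
  rw [intervalIntegral.integral_add intervalIntegrable_const hs, intervalIntegral.integral_const,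
    intervalIntegral.integral_finsetSum fun j _ => hi j]
  congr 1
  · simp [mul_comm]
  · refine Finset.sum_congr rfl fun j _ => ?_
    rw [intervalIntegral.integral_const_mul, integral_ite_le_toNNReal]

theorem sum_sub_mul_eq (a : ℕ → ℝ) (b : ℕ → ℝ) (m : ℕ) :
    a 0 * b 0 + ∑ j ∈ Finset.range m, (a (j + 1) - a j) * b (j + 1) =
      ∑ j ∈ Finset.range m, a j * (b j - b (j + 1)) + a m * b m := by
  induction m with
  | zero => simp
  | succ m ih => rw [Finset.sum_range_succ, Finset.sum_range_succ, ← add_assoc, ih]; ring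

/-- The compensated jump number `j` stopped at time `t`: the increment of `g` at the jump, minus
the integral of `h` along the holding time that precedes it. -/
def jumpIncrement (step : S → Mk → S) (k₀ : S) (g h : S → ℝ) (t : ℝ≥0) (j : ℕ)
    (ω : ℕ → ℝ≥0 × Mk) : ℝ :=
  (Set.Iic t).indicator (fun _ => g (jumpChain step k₀ ω (j + 1)) - g (jumpChain step k₀ ω j))
      (jumpTime ω (j + 1)) -
    h (jumpChain step k₀ ω j) * (((t - jumpTime ω j : ℝ≥0) : ℝ) -
      ((t - jumpTime ω (j + 1) : ℝ≥0) : ℝ))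

theorem sum_jumpIncrement (g h : S → ℝ) (ω : ℕ → ℝ≥0 × Mk) (t : ℝ≥0) (m : ℕ) :
    ∑ j ∈ Finset.range m, jumpIncrement step k₀ g h t j ω =
      g (truncPath step k₀ ω t m) - g k₀ - ∑ j ∈ Finset.range m,
        h (jumpChain step k₀ ω j) * (((t - jumpTime ω j : ℝ≥0) : ℝ) -
          ((t - jumpTime ω (j + 1) : ℝ≥0) : ℝ)) := by
  classical
  rw [apply_truncPath g ω t m, add_sub_cancel_left, ← Finset.sum_sub_distrib]
  refine Finset.sum_congr rfl fun j _ => ?_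
  rw [jumpIncrement, Set.indicator_apply]
  simp only [Set.mem_Iic, mul_ite, mul_one, mul_zero]

theorem abs_sum_jumpIncrement_le {g h : S → ℝ} {C D : ℝ} (hg : ∀ k, |g k| ≤ C)
    (hh : ∀ k, |h k| ≤ D) (ω : ℕ → ℝ≥0 × Mk) (t : ℝ≥0) (m : ℕ) :
    |∑ j ∈ Finset.range m, jumpIncrement step k₀ g h t j ω| ≤ 2 * C + D * t := by
  have hD : 0 ≤ D := (abs_nonneg _).trans (hh k₀)
  rw [sum_jumpIncrement]
  refine (abs_sub _ _).trans (add_le_add ((abs_sub _ _).trans ?_) ?_)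
  · linarith [hg (truncPath step k₀ ω t m), hg k₀]
  refine (Finset.abs_sum_le_sum_abs _ _).trans ?_
  have h1 : ∀ j, 0 ≤ ((t - jumpTime ω j : ℝ≥0) : ℝ) - ((t - jumpTime ω (j + 1) : ℝ≥0) : ℝ) := by
    intro j
    rw [sub_nonneg, NNReal.coe_le_coe]
    exact tsub_le_tsub_left (monotone_jumpTime ω (Nat.le_succ j)) t
  calc _ ≤ ∑ j ∈ Finset.range m, D * (((t - jumpTime ω j : ℝ≥0) : ℝ) -
          ((t - jumpTime ω (j + 1) : ℝ≥0) : ℝ)) := by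
        refine Finset.sum_le_sum fun j _ => ?_
        rw [abs_mul, abs_of_nonneg (h1 j)]
        exact mul_le_mul_of_nonneg_right (hh _) (h1 j)
    _ = D * (t - ((t - jumpTime ω m : ℝ≥0) : ℝ)) := by
        rw [← Finset.mul_sum, Finset.sum_range_sub' fun j => ((t - jumpTime ω j : ℝ≥0) : ℝ)]
        simp [jumpTime]
    _ ≤ D * t := mul_le_mul_of_nonneg_left (by linarith [(t - jumpTime ω m).coe_nonneg]) hD

theorem abs_jumpIncrement_le (step : S → Mk → S) (k₀ : S) {g h : S → ℝ} {C D : ℝ}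
    (hg : ∀ k, |g k| ≤ C) (hh : ∀ k, |h k| ≤ D) (t : ℝ≥0) (j : ℕ) (ω : ℕ → ℝ≥0 × Mk) :
    |jumpIncrement step k₀ g h t j ω| ≤ 2 * (2 * C + D * t) := by
  have h1 := abs_sum_jumpIncrement_le (step := step) (k₀ := k₀) hg hh ω t (j + 1)
  have h2 := abs_sum_jumpIncrement_le (step := step) (k₀ := k₀) hg hh ω t j
  rw [Finset.sum_range_succ] at h1
  rw [abs_le] at *
  constructor <;> linarith [h1.1, h1.2, h2.1, h2.2]

/-- Once the jump has occurred, its compensated increment no longer changes. -/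
theorem jumpIncrement_eq_of_le (g h : S → ℝ) {s t : ℝ≥0} (hst : s ≤ t) {j : ℕ}
    (hj : jumpTime ω (j + 1) ≤ s) :
    jumpIncrement step k₀ g h t j ω = jumpIncrement step k₀ g h s j ω := by
  have h0 := monotone_jumpTime ω (Nat.le_succ j)
  unfold jumpIncrement
  rw [Set.indicator_of_mem (show jumpTime ω (j + 1) ∈ Set.Iic t from hj.trans hst),
    Set.indicator_of_mem (show jumpTime ω (j + 1) ∈ Set.Iic s from hj),
    NNReal.coe_sub ((h0.trans hj).trans hst), NNReal.coe_sub (h0.trans hj),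
    NNReal.coe_sub (hj.trans hst), NNReal.coe_sub hj]
  ring

theorem apply_truncPath_sub_integral (g h : S → ℝ) {m : ℕ} (hm : t < jumpTime ω (m + 1)) :
    g (truncPath step k₀ ω t m) - ∫ s in (0 : ℝ)..t, h (truncPath step k₀ ω s.toNNReal m) =
      g k₀ + ∑ j ∈ Finset.range (m + 1), jumpIncrement step k₀ g h t j ω := by
  have h2 := sum_sub_mul_eq (fun j => h (jumpChain step k₀ ω j))
    (fun j => ((t - jumpTime ω j : ℝ≥0) : ℝ)) m
  have h3 : ((t - jumpTime ω 0 : ℝ≥0) : ℝ) = t := by simp [jumpTime]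
  have h4 : t - jumpTime ω (m + 1) = 0 := tsub_eq_zero_of_le hm.le
  rw [sum_jumpIncrement, truncPath_eq_of_le hm (Nat.le_succ m), integral_truncPath,
    Finset.sum_range_succ, h4]
  simp only [h3] at h2
  have h5 : jumpChain step k₀ ω 0 = k₀ := rfl
  rw [h5] at h2
  rw [h2]
  simp only [NNReal.coe_zero, sub_zero]
  ring

theorem integral_path_eq (hω : NonExplosive ω) (h : S → ℝ) {m : ℕ} (hm : t < jumpTime ω (m + 1)) :
    ∫ s in (0 : ℝ)..t, h (path step k₀ ω s.toNNReal) =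
      ∫ s in (0 : ℝ)..t, h (truncPath step k₀ ω s.toNNReal m) := by
  refine intervalIntegral.integral_congr fun s hs => ?_
  rw [Set.uIcc_of_le t.coe_nonneg] at hs
  have h1 : s.toNNReal ≤ t := Real.toNNReal_le_iff_le_coe.2 hs.2
  rw [path_eq_truncPath hω (h1.trans_lt hm)]

/-- The martingale of the jump process is the sum of its compensated increments. -/
theorem apply_path_sub_integral (hω : NonExplosive ω) (g h : S → ℝ) {m : ℕ}
    (hm : t < jumpTime ω (m + 1)) {L : ℕ} (hL : m + 1 ≤ L) :
    g (path step k₀ ω t) - ∫ s in (0 : ℝ)..t, h (path step k₀ ω s.toNNReal) =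
      g k₀ + ∑ j ∈ Finset.range L, jumpIncrement step k₀ g h t j ω := by
  obtain ⟨l, rfl⟩ : ∃ l, L = l + 1 := ⟨L - 1, by omega⟩
  have hl : t < jumpTime ω (l + 1) := hm.trans_le (monotone_jumpTime ω hL)
  rw [path_eq_truncPath hω hl, integral_path_eq hω h hl, apply_truncPath_sub_integral g h hl]

end Paths

/-! ### The martingale problem for the jump process -/

section Martingale

set_option linter.unusedSectionVars false

variable {S Mk : Type*} [MeasurableSpace S] [Countable S] [DiscreteMeasurableSpace S]
  [MeasurableSpace Mk] [Countable Mk] [DiscreteMeasurableSpace Mk]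

/-- A function of the noise that only depends on its first `m` entries. -/
def DependsOnFirst {E : Type*} (m : ℕ) (f : (ℕ → ℝ≥0 × Mk) → E) : Prop :=
  ∀ ω ω', (∀ i < m, ω i = ω' i) → f ω = f ω'

theorem measurable_truncPath (step : S → Mk → S) (k₀ : S) (t : ℝ≥0) (m : ℕ) :
    Measurable fun ω : ℕ → ℝ≥0 × Mk => truncPath step k₀ ω t m := by
  classical
  induction m with
  | zero => exact measurable_const
  | succ m ih =>
    exact Measurable.ite (measurableSet_le (measurable_jumpTime (m + 1)) measurable_const)
      (measurable_jumpChain step k₀ (m + 1)) ih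

theorem measurable_jumpIncrement (step : S → Mk → S) (k₀ : S) (g h : S → ℝ) (t : ℝ≥0) (j : ℕ) :
    Measurable (jumpIncrement (Mk := Mk) step k₀ g h t j) := by
  have hc : ∀ (f : S → ℝ) i, Measurable fun ω : ℕ → ℝ≥0 × Mk => f (jumpChain step k₀ ω i) :=
    fun f i => (Measurable.of_discrete (f := f)).comp (measurable_jumpChain step k₀ i)
  have ht : ∀ i, Measurable fun ω : ℕ → ℝ≥0 × Mk => ((t - jumpTime ω i : ℝ≥0) : ℝ) :=
    fun i => ((measurable_const (a := t)).sub (measurable_jumpTime i)).coe_nnreal_real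
  have hi : Measurable fun ω : ℕ → ℝ≥0 × Mk => (Set.Iic t).indicator
      (fun _ => g (jumpChain step k₀ ω (j + 1)) - g (jumpChain step k₀ ω j))
        (jumpTime ω (j + 1)) := by
    classical
    simp only [Set.indicator_apply]
    exact Measurable.ite ((measurable_jumpTime (j + 1)) measurableSet_Iic)
      ((hc g _).sub (hc g _)) measurable_const
  exact hi.sub ((hc h j).mul ((ht j).sub (ht (j + 1))))

variable {r : ℝ} {ν : Measure Mk} [IsProbabilityMeasure ν]

/-- The generator of the jump process, with jump rate `r` and mark law `ν`. -/
def jumpGenerator (r : ℝ) (ν : Measure Mk) (step : S → Mk → S) (g : S → ℝ) (k : S) : ℝ :=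
  r * (∫ a, g (step k a) ∂ν - g k)

theorem abs_jumpGenerator_le (hr : 0 < r) (step : S → Mk → S) {g : S → ℝ} {C : ℝ}
    (hg : ∀ k, |g k| ≤ C) (k : S) : |jumpGenerator r ν step g k| ≤ r * (2 * C) := by
  have h1 : |∫ a, g (step k a) ∂ν| ≤ C := by
    have := norm_integral_le_of_norm_le_const (μ := ν) (f := fun a => g (step k a))
      (Eventually.of_forall fun a => hg _)
    simpa using this
  rw [jumpGenerator, abs_mul, abs_of_pos hr]
  refine mul_le_mul_of_nonneg_left ((abs_sub _ _).trans ?_) hr.le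
  linarith [hg k]

/-- Given the first `j` entries of the noise, the `j`-th compensated increment has mean zero. -/
theorem setIntegral_jumpIncrement_eq_zero (hr : 0 < r) (step : S → Mk → S) (k₀ : S) {g : S → ℝ}
    {C : ℝ} (hg : ∀ k, |g k| ≤ C) (t : ℝ≥0) (j : ℕ) {B : Set (ℕ → ℝ≥0 × Mk)}
    (hB : MeasurableSet B) (hBj : DependsOnFirst j (· ∈ B)) :
    ∫ ω in B, jumpIncrement step k₀ g (jumpGenerator r ν step g) t j ω ∂noise r ν = 0 := by
  classical
  have := isProbabilityMeasure_gapMeasure hr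
  set h := jumpGenerator r ν step g with hh
  have hhD : ∀ k, |h k| ≤ r * (2 * C) := fun k => abs_jumpGenerator_le hr step hg k
  have hbd := abs_jumpIncrement_le (Mk := Mk) step k₀ hg hhD t j
  rw [← integral_indicator hB, integral_noise_eq hr j
    ((measurable_jumpIncrement step k₀ g h t j).indicator hB)
    (C := 2 * (2 * C + r * (2 * C) * t)) fun ω => ?_]
  · refine integral_eq_zero_of_ae (Eventually.of_forall fun ω => ?_)
    dsimp only [Pi.zero_apply]
    have hmem : ∀ x, Function.update ω j x ∈ B ↔ ω ∈ B := fun x =>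
      iff_of_eq (hBj _ _ fun i hi => update_eq_of_lt ω x hi)
    by_cases hω : ω ∈ B
    swap
    · simp [hmem, hω]
    simp only [Set.indicator_apply, hmem, hω, if_true]
    set k := jumpChain step k₀ ω j with hk
    set b : ℝ≥0 := t - jumpTime ω j with hb
    have hval : ∀ x : ℝ≥0 × Mk, jumpIncrement step k₀ g h t j (Function.update ω j x) =
        (Set.Iic t).indicator (fun _ => (1 : ℝ)) (jumpTime ω j + x.1) * (g (step k x.2) - g k) -
          h k * min (x.1 : ℝ) b := by
      intro x
      rw [jumpIncrement, jumpTime_update_succ, jumpTime_update, jumpChain_update_succ,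
        jumpChain_update, ← tsub_tsub, ← hb, ← hk]
      congr 1
      · by_cases hx : jumpTime ω j + x.1 ∈ Set.Iic t
        · rw [Set.indicator_of_mem hx, Set.indicator_of_mem hx, one_mul]
        · rw [Set.indicator_of_notMem hx, Set.indicator_of_notMem hx, zero_mul]
      · congr 1
        rcases le_total x.1 b with hx | hx
        · rw [NNReal.coe_sub hx, min_eq_left (NNReal.coe_le_coe.2 hx)]; ring
        · rw [tsub_eq_zero_of_le hx, min_eq_right (NNReal.coe_le_coe.2 hx)]; simp
    simp_rw [hval]
    have hind : Measurable fun x : ℝ≥0 => (Set.Iic t).indicator (fun _ => (1 : ℝ))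
        (jumpTime ω j + x) :=
      (measurable_const.indicator measurableSet_Iic).comp (measurable_const_add _)
    have hgm : Measurable fun a : Mk => g (step k a) - g k := Measurable.of_discrete
    have hi1 : Integrable (fun x : ℝ≥0 => (Set.Iic t).indicator (fun _ => (1 : ℝ))
        (jumpTime ω j + x)) (gapMeasure r) := by
      refine Integrable.of_bound (C := 1) hind.aestronglyMeasurable (Eventually.of_forall fun x => ?_)
      by_cases hx : jumpTime ω j + x ∈ Set.Iic t
      · rw [Set.indicator_of_mem hx]; simp
      · rw [Set.indicator_of_notMem hx]; simp
    have hig : Integrable (fun a => g (step k a)) ν :=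
      Integrable.of_bound (C := C) (Measurable.of_discrete (f := fun a => g (step k a))).aestronglyMeasurable
        (Eventually.of_forall fun a => hg _)
    have hi2 : Integrable (fun a => g (step k a) - g k) ν := hig.sub (integrable_const _)
    have hi3 : Integrable (fun x : ℝ≥0 => min (x : ℝ) b) (gapMeasure r) := by
      refine Integrable.of_bound (C := b) (by fun_prop) (Eventually.of_forall fun x => ?_)
      rw [Real.norm_of_nonneg (le_min x.coe_nonneg b.coe_nonneg)]
      exact min_le_right _ _
    rw [integral_sub (hi1.mul_prod hi2) ((hi3.comp_fst ν).const_mul _),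
      integral_prod_mul (fun x : ℝ≥0 => (Set.Iic t).indicator (fun _ => (1 : ℝ))
        (jumpTime ω j + x)) (fun a => g (step k a) - g k), integral_const_mul,
      integral_sub hig (integrable_const _), integral_fun_fst (fun x : ℝ≥0 => min (x : ℝ) b)]
    have hprob : ∫ x : ℝ≥0, (Set.Iic t).indicator (fun _ => (1 : ℝ)) (jumpTime ω j + x)
        ∂gapMeasure r = (gapMeasure r).real {x | x ≤ b} := by
      have hms : MeasurableSet {x : ℝ≥0 | jumpTime ω j + x ≤ t} :=
        measurableSet_le (measurable_const_add _) measurable_const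
      have h1 : (fun x : ℝ≥0 => (Set.Iic t).indicator (fun _ => (1 : ℝ)) (jumpTime ω j + x)) =
          {x : ℝ≥0 | jumpTime ω j + x ≤ t}.indicator fun _ => 1 := by
        ext x
        simp [Set.indicator_apply]
      rw [h1, integral_indicator hms, setIntegral_const, smul_eq_mul, mul_one]
      rcases le_total (jumpTime ω j) t with hjt | hjt
      · congr 1
        ext x
        simp only [Set.mem_ofPred_eq, hb]
        rw [le_tsub_iff_left hjt]
      · -- when the holding time starts after `t`, both sides vanish
        have hb0 : b = 0 := tsub_eq_zero_of_le hjt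
        have h2 := gapMeasure_real_Iic hr b
        rw [hb0] at h2 ⊢
        simp only [NNReal.coe_zero, mul_zero, neg_zero, Real.exp_zero, sub_self] at h2
        refine le_antisymm ?_ (h2.le.trans measureReal_nonneg)
        refine measureReal_mono fun x hx => ?_
        have hx' : jumpTime ω j + x ≤ t := hx
        have h3 : jumpTime ω j + x ≤ jumpTime ω j + 0 := by simpa using hx'.trans hjt
        exact (add_le_add_iff_left _).1 h3
    rw [hprob, gapMeasure_real_Iic_eq hr b, hh, jumpGenerator]
    simp only [integral_const, probReal_univ, smul_eq_mul, one_mul]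
    ring
  · rw [Set.indicator_apply]
    split_ifs
    · exact hbd ω
    · simpa using (abs_nonneg _).trans (hbd ω)

variable {Ω : Type*} {mΩ : MeasurableSpace Ω} {P : Measure Ω} {W : Ω → ℕ → ℝ≥0 × Mk}

/-- `B` is determined at time `t`: up to null sets and before the jump number `m + 1`, it only
depends on the first `m` entries of the noise `W`. -/
def IsDeterminedAt (P : Measure Ω) (W : Ω → ℕ → ℝ≥0 × Mk) (t : ℝ≥0) (B : Set Ω) : Prop :=
  ∀ m, ∃ B' : Set (ℕ → ℝ≥0 × Mk), MeasurableSet B' ∧ DependsOnFirst m (· ∈ B') ∧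
    ∀ᵐ ω ∂P, t < jumpTime (W ω) (m + 1) → (ω ∈ B ↔ W ω ∈ B')

/-- The filtration generated by the jump process, completed. -/
def jumpFiltration (P : Measure Ω) (W : Ω → ℕ → ℝ≥0 × Mk) : Filtration ℝ≥0 mΩ where
  seq t :=
    { MeasurableSet' := fun B => MeasurableSet B ∧ IsDeterminedAt P W t B
      measurableSet_empty := ⟨MeasurableSet.empty, fun m =>
        ⟨∅, MeasurableSet.empty, fun _ _ _ => rfl, by simp⟩⟩
      measurableSet_compl := fun B hB => ⟨hB.1.compl, fun m => by
        obtain ⟨B', h1, h2, h3⟩ := hB.2 m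
        refine ⟨B'ᶜ, h1.compl, fun ω ω' h => ?_, ?_⟩
        · have := h2 ω ω' h
          simp only [Set.mem_compl_iff, this]
        · filter_upwards [h3] with ω hω ht
          rw [Set.mem_compl_iff, Set.mem_compl_iff, hω ht]⟩
      measurableSet_iUnion := fun B hB => ⟨MeasurableSet.iUnion fun i => (hB i).1, fun m => by
        choose B' h1 h2 h3 using fun i => (hB i).2 m
        refine ⟨⋃ i, B' i, MeasurableSet.iUnion h1, fun ω ω' h => ?_, ?_⟩
        · have := fun i => h2 i ω ω' h
          simp only [Set.mem_iUnion, this]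
        · filter_upwards [ae_all_iff.2 h3] with ω hω ht
          simp only [Set.mem_iUnion, hω _ ht]⟩ }
  mono' s t hst B hB := ⟨hB.1, fun m => by
    obtain ⟨B', h1, h2, h3⟩ := hB.2 m
    refine ⟨B', h1, h2, ?_⟩
    filter_upwards [h3] with ω hω ht using hω (hst.trans_lt ht)⟩
  le' _ _ hB := hB.1

theorem measurableSet_jumpFiltration_of_null [P.IsComplete] {t : ℝ≥0} {B : Set Ω} (hB : P B = 0) :
    MeasurableSet[jumpFiltration P W t] B := by
  refine ⟨Measure.IsComplete.out' B hB, fun m => ⟨∅, MeasurableSet.empty, fun _ _ _ => rfl, ?_⟩⟩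
  filter_upwards [measure_eq_zero_iff_ae_notMem.1 hB] with ω hω _
  simp [hω]

/-- A random variable that coincides with a functional of the first `m` entries of the noise
before the jump number `m + 1`, for every `m`, is measurable at time `t`. -/
theorem measurable_jumpFiltration [P.IsComplete] {E : Type*} [MeasurableSpace E] {t : ℝ≥0}
    (hW : Measurable W) (hne : ∀ᵐ ω ∂P, NonExplosive (W ω)) {X : Ω → E}
    (Y : ℕ → (ℕ → ℝ≥0 × Mk) → E) (hY : ∀ m, Measurable (Y m)) (hYm : ∀ m, DependsOnFirst m (Y m))
    (hXY : ∀ m, ∀ᵐ ω ∂P, t < jumpTime (W ω) (m + 1) → X ω = Y m (W ω)) :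
    Measurable[jumpFiltration P W t] X := by
  intro A hA
  refine ⟨?_, fun m => ⟨Y m ⁻¹' A, hY m hA, fun ω ω' h => ?_, ?_⟩⟩
  · have h1 : X ⁻¹' A =ᵐ[P] ⋃ m, {ω | t < jumpTime (W ω) (m + 1)} ∩ {ω | Y m (W ω) ∈ A} := by
      filter_upwards [ae_all_iff.2 hXY, hne] with ω hω hn
      refine propext ⟨fun h => ?_, fun h => ?_⟩
      · obtain ⟨m, hm⟩ := hn t
        refine Set.mem_iUnion.2 ⟨m, hm, ?_⟩
        have : X ω ∈ A := h
        rw [hω m hm] at this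
        exact this
      · obtain ⟨m, hm, hm'⟩ := Set.mem_iUnion.1 h
        have h3 : Y m (W ω) ∈ A := hm'
        rw [← hω m hm] at h3
        exact h3
    refine NullMeasurableSet.measurable_of_complete (μ := P)
      (NullMeasurableSet.congr (MeasurableSet.nullMeasurableSet ?_) h1.symm)
    refine MeasurableSet.iUnion fun m => MeasurableSet.inter ?_ (((hY m).comp hW) hA)
    exact measurableSet_lt measurable_const ((measurable_jumpTime (m + 1)).comp hW)
  · simp only [Set.mem_preimage, hYm m ω ω' h]
  · filter_upwards [hXY m] with ω hω ht
    rw [Set.mem_preimage, Set.mem_preimage, hω ht]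

/-- The process `g (X_t) - ∫_0^t A g (X_s) ds`, `A` the generator of the jump process `X`. -/
def jumpMartingale (r : ℝ) (ν : Measure Mk) (step : S → Mk → S) (k₀ : S) (g : S → ℝ)
    (W : Ω → ℕ → ℝ≥0 × Mk) (t : ℝ≥0) (ω : Ω) : ℝ :=
  g (path step k₀ (W ω) t) -
    ∫ s in (0 : ℝ)..t, jumpGenerator r ν step g (path step k₀ (W ω) s.toNNReal)

theorem dependsOnFirst_integral_truncPath (step : S → Mk → S) (k₀ : S) (g h : S → ℝ) (t : ℝ≥0)
    (m : ℕ) : DependsOnFirst (Mk := Mk) m fun ω => g (truncPath step k₀ ω t m) -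
      ∫ s in (0 : ℝ)..t, h (truncPath step k₀ ω s.toNNReal m) := by
  intro ω ω' hω
  simp only [truncPath_congr hω]

theorem measurable_integral_truncPath (step : S → Mk → S) (k₀ : S) (g h : S → ℝ) (t : ℝ≥0)
    (m : ℕ) : Measurable fun ω : ℕ → ℝ≥0 × Mk => g (truncPath step k₀ ω t m) -
      ∫ s in (0 : ℝ)..t, h (truncPath step k₀ ω s.toNNReal m) := by
  have hc : ∀ (f : S → ℝ) i, Measurable fun ω : ℕ → ℝ≥0 × Mk => f (jumpChain step k₀ ω i) :=
    fun f i => (Measurable.of_discrete (f := f)).comp (measurable_jumpChain step k₀ i)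
  have ht : ∀ i, Measurable fun ω : ℕ → ℝ≥0 × Mk => ((t - jumpTime ω i : ℝ≥0) : ℝ) :=
    fun i => ((measurable_const (a := t)).sub (measurable_jumpTime i)).coe_nnreal_real
  simp only [integral_truncPath]
  exact ((Measurable.of_discrete (f := g)).comp (measurable_truncPath step k₀ t m)).sub
    (measurable_const.add (Finset.measurable_fun_sum _ fun j _ =>
      ((hc h _).sub (hc h _)).mul (ht _)))

theorem measurable_jumpMartingale [P.IsComplete] (hW : Measurable W)
    (hne : ∀ᵐ ω ∂P, NonExplosive (W ω)) (step : S → Mk → S) (k₀ : S) (g : S → ℝ) (t : ℝ≥0) :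
    Measurable[jumpFiltration P W t] (jumpMartingale r ν step k₀ g W t) := by
  refine measurable_jumpFiltration hW hne _
    (measurable_integral_truncPath step k₀ g (jumpGenerator r ν step g) t)
    (dependsOnFirst_integral_truncPath step k₀ g (jumpGenerator r ν step g) t) fun m => ?_
  filter_upwards [hne] with ω hω hm
  rw [jumpMartingale, path_eq_truncPath hω hm, integral_path_eq hω _ hm]

theorem measurable_path [P.IsComplete] (hW : Measurable W) (hne : ∀ᵐ ω ∂P, NonExplosive (W ω))
    (step : S → Mk → S) (k₀ : S) (t : ℝ≥0) :
    Measurable[jumpFiltration P W t] fun ω => path step k₀ (W ω) t := by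
  refine measurable_jumpFiltration hW hne (fun m ω => truncPath step k₀ ω t m)
    (measurable_truncPath step k₀ t) (fun m ω ω' h => truncPath_congr h) fun m => ?_
  filter_upwards [hne] with ω hω hm using path_eq_truncPath hω hm

theorem abs_jumpMartingale_le (hr : 0 < r) (step : S → Mk → S) (k₀ : S) {g : S → ℝ} {C : ℝ}
    (hg : ∀ k, |g k| ≤ C) (t : ℝ≥0) (ω : Ω) :
    |jumpMartingale r ν step k₀ g W t ω| ≤ C + r * (2 * C) * t := by
  refine (abs_sub _ _).trans (add_le_add (hg _) ?_)
  have := intervalIntegral.norm_integral_le_of_norm_le_const (a := (0 : ℝ)) (b := t)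
    (f := fun s => jumpGenerator r ν step g (path step k₀ (W ω) s.toNNReal)) (C := r * (2 * C))
    fun s _ => abs_jumpGenerator_le hr step hg _
  simpa using this

/-- An increment whose jump has occurred before `s` does not change after `s`, and on the complement
an event of the past of `s` only depends on the entries of the noise before that jump, given which
the increments have mean zero. -/
theorem setIntegral_jumpMartingale_eq [IsProbabilityMeasure P] [P.IsComplete] (hr : 0 < r)
    (hW : MeasurePreserving W P (noise r ν)) (step : S → Mk → S) (k₀ : S) {g : S → ℝ} {C : ℝ}
    (hg : ∀ k, |g k| ≤ C) {s t : ℝ≥0} (hst : s ≤ t) {B : Set Ω}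
    (hB : MeasurableSet[jumpFiltration P W s] B) :
    ∫ ω in B, jumpMartingale r ν step k₀ g W t ω ∂P =
      ∫ ω in B, jumpMartingale r ν step k₀ g W s ω ∂P := by
  classical
  set h := jumpGenerator r ν step g with hh
  have hhD : ∀ k, |h k| ≤ r * (2 * C) := fun k => abs_jumpGenerator_le hr step hg k
  have hne : ∀ᵐ ω ∂P, NonExplosive (W ω) :=
    hW.quasiMeasurePreserving.ae (ae_nonExplosive hr)
  set inc : ℝ≥0 → ℕ → Ω → ℝ := fun t j ω => jumpIncrement step k₀ g h t j (W ω) with hinc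
  have hincm : ∀ t j, Measurable (inc t j) := fun t j =>
    (measurable_jumpIncrement step k₀ g h t j).comp hW.measurable
  have hinci : ∀ t j, Integrable (inc t j) P := fun t j =>
    Integrable.of_bound (C := 2 * (2 * C + r * (2 * C) * t)) (hincm t j).aestronglyMeasurable
      (Eventually.of_forall fun ω => abs_jumpIncrement_le step k₀ hg hhD t j (W ω))
  -- the integrals over `B` of the martingale are the limits of those of its partial sums
  have hlim : ∀ t, Tendsto (fun L => ∫ ω in B, (g k₀ + ∑ j ∈ Finset.range L, inc t j ω) ∂P) atTop
      (𝓝 (∫ ω in B, jumpMartingale r ν step k₀ g W t ω ∂P)) := by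
    intro t
    refine tendsto_integral_of_dominated_convergence (fun _ => C + (2 * C + r * (2 * C) * t))
      (fun L => ?_) (integrable_const _) (fun L => ?_) ?_
    · exact (measurable_const.add (Finset.measurable_fun_sum _ fun j _ =>
        hincm t j)).aestronglyMeasurable
    · refine Eventually.of_forall fun ω => ?_
      exact (abs_add_le _ _).trans (add_le_add (hg _) (abs_sum_jumpIncrement_le hg hhD _ _ _))
    · filter_upwards [ae_restrict_of_ae hne] with ω hω
      obtain ⟨m, hm⟩ := hω t
      refine tendsto_const_nhds.congr' ?_
      filter_upwards [eventually_ge_atTop (m + 1)] with L hL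
      exact apply_path_sub_integral hω g h hm hL
  have heq : ∀ j, ∫ ω in B, inc t j ω ∂P = ∫ ω in B, inc s j ω ∂P := by
    intro j
    obtain ⟨B', h1, h2, h3⟩ := hB.2 j
    have hB'0 : ∀ t, ∫ ω in W ⁻¹' B', inc t j ω ∂P = 0 := by
      intro t
      have h4 := setIntegral_jumpIncrement_eq_zero (ν := ν) hr step k₀ hg t j h1 h2
      rw [← hW.map_eq, setIntegral_map h1
        (measurable_jumpIncrement step k₀ g h t j).aestronglyMeasurable
        hW.measurable.aemeasurable] at h4
      exact h4
    rw [← sub_eq_zero, ← integral_sub (hinci t j).integrableOn (hinci s j).integrableOn,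
      ← integral_indicator hB.1]
    have h5 : ∫ ω, (W ⁻¹' B').indicator (fun ω => inc t j ω - inc s j ω) ω ∂P = 0 := by
      rw [integral_indicator (hW.measurable h1),
        integral_sub (hinci t j).integrableOn (hinci s j).integrableOn, hB'0, hB'0, sub_zero]
    rw [← h5]
    refine integral_congr_ae ?_
    filter_upwards [h3] with ω hω
    by_cases hj : s < jumpTime (W ω) (j + 1)
    · simp only [Set.indicator_apply, Set.mem_preimage, hω hj]
    · have h6 : inc t j ω = inc s j ω := jumpIncrement_eq_of_le g h hst (not_lt.1 hj)
      simp only [Set.indicator_apply, h6, sub_self, ite_self]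
  refine tendsto_nhds_unique (hlim t) ((hlim s).congr fun L => ?_)
  have h7 : ∀ t, ∫ ω in B, (g k₀ + ∑ j ∈ Finset.range L, inc t j ω) ∂P =
      ∫ _ in B, g k₀ ∂P + ∑ j ∈ Finset.range L, ∫ ω in B, inc t j ω ∂P := by
    intro t
    rw [integral_add (integrable_const _).integrableOn
      (integrable_finsetSum _ fun j _ => (hinci t j).integrableOn),
      integral_finsetSum _ fun j _ => (hinci t j).integrableOn]
  rw [h7, h7]
  congr 1
  exact Finset.sum_congr rfl fun j _ => (heq j).symm

theorem martingale_jumpMartingale [IsProbabilityMeasure P] [P.IsComplete] (hr : 0 < r)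
    (hW : MeasurePreserving W P (noise r ν)) (step : S → Mk → S) (k₀ : S) {g : S → ℝ} {C : ℝ}
    (hg : ∀ k, |g k| ≤ C) :
    Martingale (jumpMartingale r ν step k₀ g W) (jumpFiltration P W) P := by
  have hne : ∀ᵐ ω ∂P, NonExplosive (W ω) :=
    hW.quasiMeasurePreserving.ae (ae_nonExplosive hr)
  have hm := fun t => measurable_jumpMartingale (r := r) (ν := ν) hW.measurable hne step k₀ g t
  have hint : ∀ t, Integrable (jumpMartingale r ν step k₀ g W t) P := fun t =>
    Integrable.of_bound (C := C + r * (2 * C) * t)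
      ((hm t).mono ((jumpFiltration P W).le t) le_rfl).aestronglyMeasurable
      (Eventually.of_forall fun ω => abs_jumpMartingale_le hr step k₀ hg t ω)
  refine ⟨fun t => (hm t).stronglyMeasurable, fun s t hst => ?_⟩
  refine (ae_eq_condExp_of_forall_setIntegral_eq ((jumpFiltration P W).le s) (hint t)
    (fun _ _ _ => (hint s).integrableOn) (fun B hB _ => ?_)
    (hm s).stronglyMeasurable.aestronglyMeasurable).symm
  exact (setIntegral_jumpMartingale_eq hr hW step k₀ hg hst hB).symm

end Martingale

/-! ### The discounted exit time of the jump process -/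

section Exit

set_option linter.unusedSectionVars false

variable {S Mk : Type*}

/-- The embedded chain leaves `G` for the first time at its jump number `m`. -/
def firstExit (step : S → Mk → S) (k₀ : S) (G : Set S) (m : ℕ) : Set (ℕ → ℝ≥0 × Mk) :=
  {ω | (∀ j < m, jumpChain step k₀ ω j ∈ G) ∧ jumpChain step k₀ ω m ∉ G}

/-- If the path is outside `G` at time `t`, then the chain has left `G` before. -/
theorem exists_mem_firstExit {step : S → Mk → S} {k₀ : S} {G : Set S} {ω : ℕ → ℝ≥0 × Mk}
    (hω : NonExplosive ω) {t : ℝ≥0} (ht : path step k₀ ω t ∉ G) :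
    ∃ m, ω ∈ firstExit step k₀ G m ∧ jumpTime ω m ≤ t := by
  classical
  have hN := Nat.find_spec (hω t)
  set N := Nat.find (hω t) with hNdef
  have hNt : jumpTime ω N ≤ t := by
    rcases Nat.eq_zero_or_pos N with h0 | h0
    · rw [h0]; exact zero_le
    · obtain ⟨l, hl⟩ : ∃ l, N = l + 1 := ⟨N - 1, by omega⟩
      have := Nat.find_min (hω t) (m := l) (by omega)
      rw [hl]
      exact not_lt.1 this
  rw [path_eq_jumpChain hω hNt hN] at ht
  have hex : ∃ m, jumpChain step k₀ ω m ∉ G := ⟨N, ht⟩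
  refine ⟨Nat.find hex, ⟨fun j hj => not_not.1 (Nat.find_min hex hj), Nat.find_spec hex⟩, ?_⟩
  exact (monotone_jumpTime ω (Nat.find_min' hex ht)).trans hNt

theorem eq_of_mem_firstExit {step : S → Mk → S} {k₀ : S} {G : Set S} {ω : ℕ → ℝ≥0 × Mk} {m l : ℕ}
    (hm : ω ∈ firstExit step k₀ G m) (hl : ω ∈ firstExit step k₀ G l) : m = l := by
  rcases lt_trichotomy m l with h | h | h
  · exact absurd (hl.1 m h) hm.2
  · exact h
  · exact absurd (hm.1 l h) hl.2

variable [MeasurableSpace S] [Countable S] [DiscreteMeasurableSpace S]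
  [MeasurableSpace Mk] [Countable Mk] [DiscreteMeasurableSpace Mk]

theorem measurableSet_stays (step : S → Mk → S) (k₀ : S) (G : Set S) (m : ℕ) :
    MeasurableSet {ω : ℕ → ℝ≥0 × Mk | ∀ j < m, jumpChain step k₀ ω j ∈ G} := by
  have : {ω : ℕ → ℝ≥0 × Mk | ∀ j < m, jumpChain step k₀ ω j ∈ G} =
      ⋂ j, ⋂ (_ : j < m), (fun ω => jumpChain step k₀ ω j) ⁻¹' G := by
    ext ω; simp
  rw [this]
  exact MeasurableSet.iInter fun j => MeasurableSet.iInter fun _ =>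
    measurable_jumpChain step k₀ j (MeasurableSet.of_discrete (s := G))

theorem measurableSet_firstExit (step : S → Mk → S) (k₀ : S) (G : Set S) (m : ℕ) :
    MeasurableSet (firstExit (Mk := Mk) step k₀ G m) :=
  (measurableSet_stays step k₀ G m).inter
    (measurable_jumpChain step k₀ m (MeasurableSet.of_discrete (s := Gᶜ)))

theorem measurable_exp_jumpTime (θ : ℝ) (m : ℕ) : Measurable fun ω : ℕ → ℝ≥0 × Mk =>
    ENNReal.ofReal (Real.exp (-(θ * (jumpTime ω m : ℝ)))) := by
  have := measurable_jumpTime (Mk := Mk) m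
  fun_prop

variable {r : ℝ} {ν : Measure Mk} [IsProbabilityMeasure ν]

/-- If `f ≥ 1` outside `G` and `E[e^{-θ T} f(X_T)] ≤ f` on `G`, with `T` the first jump time, then
the Laplace transform of the exit time from `G` is at most `f`. -/
theorem tsum_lintegral_firstExit_le (hr : 0 < r) {θ : ℝ} (hθ : 0 ≤ θ) (step : S → Mk → S) {k₀ : S}
    {G : Set S} (hk₀ : k₀ ∈ G) {f : S → ℝ≥0∞}
    (hf : ∀ k ∈ G, ENNReal.ofReal (r / (r + θ)) * ∫⁻ a, f (step k a) ∂ν ≤ f k)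
    (hf1 : ∀ k ∈ G, ∀ a, step k a ∉ G → 1 ≤ f (step k a)) :
    ∑' m, ∫⁻ ω in firstExit step k₀ G m, ENNReal.ofReal (Real.exp (-(θ * (jumpTime ω m : ℝ))))
      ∂noise r ν ≤ f k₀ := by
  classical
  have := isProbabilityMeasure_gapMeasure hr
  have := isProbabilityMeasure_noise (ν := ν) hr
  set E : ℕ → Set (ℕ → ℝ≥0 × Mk) := fun m => {ω | ∀ j < m, jumpChain step k₀ ω j ∈ G} with hE
  have hEm : ∀ m, MeasurableSet (E m) := measurableSet_stays step k₀ G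
  have hfm : ∀ m, Measurable fun ω : ℕ → ℝ≥0 × Mk =>
      ENNReal.ofReal (Real.exp (-(θ * (jumpTime ω m : ℝ)))) * f (jumpChain step k₀ ω m) := fun m =>
    (measurable_exp_jumpTime θ m).mul
      ((Measurable.of_discrete (f := f)).comp (measurable_jumpChain step k₀ m))
  set a : ℕ → ℝ≥0∞ := fun m => ∫⁻ ω in E m,
    ENNReal.ofReal (Real.exp (-(θ * (jumpTime ω m : ℝ)))) * f (jumpChain step k₀ ω m)
      ∂noise r ν with ha
  set e : ℕ → ℝ≥0∞ := fun m => ∫⁻ ω in firstExit step k₀ G m,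
    ENNReal.ofReal (Real.exp (-(θ * (jumpTime ω m : ℝ)))) ∂noise r ν with he
  have hsub : ∀ m, a (m + 1) ≤ ∫⁻ ω in E (m + 1),
      ENNReal.ofReal (Real.exp (-(θ * (jumpTime ω m : ℝ)))) * f (jumpChain step k₀ ω m)
        ∂noise r ν := by
    intro m
    simp only [ha]
    rw [← lintegral_indicator (hEm _), ← lintegral_indicator (hEm _),
      lintegral_noise_eq hr m ((hfm (m + 1)).indicator (hEm _))]
    refine lintegral_mono fun ω => ?_
    have hmem : ∀ x, Function.update ω m x ∈ E (m + 1) ↔ ω ∈ E (m + 1) := by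
      intro x
      simp only [hE, Set.mem_ofPred_eq]
      refine forall₂_congr fun j hj => ?_
      rw [jumpChain_congr step k₀ fun i hi =>
        update_eq_of_lt ω x (hi.trans_le (Nat.lt_succ_iff.1 hj))]
    by_cases hω : ω ∈ E (m + 1)
    swap
    · simp [hmem, hω]
    simp only [Set.indicator_apply, hmem, hω, if_true, jumpTime_update_succ, jumpChain_update_succ,
      NNReal.coe_add, mul_add, neg_add, Real.exp_add, ENNReal.ofReal_mul (Real.exp_pos _).le]
    have hk : jumpChain step k₀ ω m ∈ G := hω m (Nat.lt_succ_self m)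
    simp_rw [mul_assoc]
    rw [lintegral_const_mul _ (by
      exact (show Measurable fun x : ℝ≥0 × Mk => ENNReal.ofReal (Real.exp (-(θ * (x.1 : ℝ)))) by
        fun_prop).mul ((Measurable.of_discrete (f := fun a => f (step _ a))).comp measurable_snd)),
      lintegral_prod_mul (f := fun x : ℝ≥0 => ENNReal.ofReal (Real.exp (-(θ * (x : ℝ)))))
        (g := fun a => f (step (jumpChain step k₀ ω m) a)) (by fun_prop)
        (Measurable.of_discrete.aemeasurable), lintegral_exp_gapMeasure hr hθ]
    gcongr
    exact hf _ hk
  have hstep : ∀ m, a (m + 1) + e m ≤ a m := by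
    intro m
    have h1 : E m = E (m + 1) ∪ firstExit step k₀ G m := by
      ext ω
      simp only [hE, firstExit, Set.mem_union, Set.mem_ofPred_eq]
      constructor
      · intro h
        by_cases hm : jumpChain step k₀ ω m ∈ G
        · left
          intro j hj
          rcases Nat.lt_succ_iff_lt_or_eq.1 hj with h2 | h2
          · exact h j h2
          · rwa [h2]
        · exact Or.inr ⟨h, hm⟩
      · rintro (h | h)
        · exact fun j hj => h j (hj.trans (Nat.lt_succ_self m))
        · exact h.1
    have h2 : Disjoint (E (m + 1)) (firstExit step k₀ G m) :=
      Set.disjoint_left.2 fun ω h h' => h'.2 (h m (Nat.lt_succ_self m))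
    have h3 : a m = (∫⁻ ω in E (m + 1), ENNReal.ofReal (Real.exp (-(θ * (jumpTime ω m : ℝ)))) *
          f (jumpChain step k₀ ω m) ∂noise r ν) +
        ∫⁻ ω in firstExit step k₀ G m, ENNReal.ofReal (Real.exp (-(θ * (jumpTime ω m : ℝ)))) *
          f (jumpChain step k₀ ω m) ∂noise r ν := by
      simp only [ha]
      rw [h1, lintegral_union (measurableSet_firstExit step k₀ G m) h2]
    rw [h3]
    refine add_le_add (hsub m) (setLIntegral_mono (hfm m) fun ω hω => ?_)
    refine le_mul_of_one_le_right zero_le ?_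
    cases m with
    | zero => exact absurd hk₀ hω.2
    | succ m => exact hf1 _ (hω.1 m (Nat.lt_succ_self m)) _ hω.2
  have hsum : ∀ m, ∑ j ∈ Finset.range m, e j + a m ≤ f k₀ := by
    intro m
    induction m with
    | zero =>
      have : a 0 ≤ f k₀ := by
        simp only [ha]
        refine (setLIntegral_le_lintegral _ _).trans ?_
        simp [jumpTime, jumpChain]
      simpa using this
    | succ m ih =>
      rw [Finset.sum_range_succ, add_assoc, add_comm (e m)]
      exact (add_le_add_right (hstep m) _).trans ih
  exact ENNReal.tsum_le_of_sum_range_le fun m => le_self_add.trans (hsum m)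

end Exit

/-! ### The network under a feedback control -/

section Feedback

variable {J : ℕ} {lam : ℝ} {mu : Fin J → ℝ}

/-- The total rate of the arrival and service clocks. -/
def totalRate (lam : ℝ) (mu : Fin J → ℝ) : ℝ := lam + ∑ i, mu i

/-- The rates of the clocks: clock `0` is that of the arrivals, clock `i + 1` that of the server of
queue `i`. -/
def clockRate (lam : ℝ) (mu : Fin J → ℝ) : Fin (J + 1) → ℝ := Fin.cons lam mu

/-- The law of the clock that rings next. -/
def clockLaw (lam : ℝ) (mu : Fin J → ℝ) : Measure (Fin (J + 1)) :=
  ∑ a, ENNReal.ofReal (clockRate lam mu a / totalRate lam mu) • Measure.dirac a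

open scoped Classical in
/-- The new queue lengths after the clock `a` rings, when exactly the servers in `act k` work in
the state `k`. -/
def networkStep [NeZero J] (act : (Fin J → ℕ) → Set (Fin J)) (k : Fin J → ℕ) : Fin (J + 1) → Fin J → ℕ :=
  Fin.cons (arrive k) fun i => if i ∈ act k ∧ 1 ≤ k i then serve i k else k

open scoped Classical in
/-- The control that switches on exactly the servers in `act k` in the state `k`. -/
def feedbackControl (act : (Fin J → ℕ) → Set (Fin J)) (k : Fin J → ℕ) : Fin J → ℝ :=
  fun i => if i ∈ act k then 1 else 0

theorem totalRate_pos (hlam : 0 < lam) (hmu : ∀ i, 0 < mu i) : 0 < totalRate lam mu :=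
  add_pos_of_pos_of_nonneg hlam (Finset.sum_nonneg fun i _ => (hmu i).le)

theorem clockRate_pos (hlam : 0 < lam) (hmu : ∀ i, 0 < mu i) (a : Fin (J + 1)) :
    0 < clockRate lam mu a := by
  refine Fin.cases ?_ (fun i => ?_) a
  · simpa [clockRate] using hlam
  · simpa [clockRate] using hmu i

theorem sum_clockRate : ∑ a, clockRate lam mu a = totalRate lam mu := by
  rw [Fin.sum_univ_succ]
  simp [clockRate, totalRate]

theorem lintegral_clockLaw (f : Fin (J + 1) → ℝ≥0∞) :
    ∫⁻ a, f a ∂clockLaw lam mu =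
      ∑ a, ENNReal.ofReal (clockRate lam mu a / totalRate lam mu) * f a := by
  rw [clockLaw, lintegral_finsetSum_measure]
  simp [lintegral_smul_measure]

theorem isProbabilityMeasure_clockLaw (hlam : 0 < lam) (hmu : ∀ i, 0 < mu i) :
    IsProbabilityMeasure (clockLaw lam mu) := by
  have hR := totalRate_pos hlam hmu
  refine ⟨?_⟩
  rw [← lintegral_one, lintegral_clockLaw]
  simp only [mul_one]
  rw [← ENNReal.ofReal_sum_of_nonneg fun a _ => (div_pos (clockRate_pos hlam hmu a) hR).le,
    ← Finset.sum_div, sum_clockRate, div_self hR.ne', ENNReal.ofReal_one]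

theorem integral_clockLaw (hlam : 0 < lam) (hmu : ∀ i, 0 < mu i) (f : Fin (J + 1) → ℝ) :
    ∫ a, f a ∂clockLaw lam mu = ∑ a, clockRate lam mu a / totalRate lam mu * f a := by
  have hR := totalRate_pos hlam hmu
  rw [clockLaw, integral_finsetSum_measure fun a _ =>
    (integrable_dirac (by simp)).smul_measure ENNReal.ofReal_ne_top]
  refine Finset.sum_congr rfl fun a _ => ?_
  rw [integral_smul_measure, integral_dirac,
    ENNReal.toReal_ofReal (div_pos (clockRate_pos hlam hmu a) hR).le, smul_eq_mul]

theorem sum_clockRate_mul [NeZero J] (act : (Fin J → ℕ) → Set (Fin J)) (g : (Fin J → ℕ) → ℝ) (k : Fin J → ℕ) :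
    ∑ a, clockRate lam mu a * (g (networkStep act k a) - g k) =
      generator lam mu (feedbackControl act k) g k := by
  classical
  rw [Fin.sum_univ_succ, generator]
  congr 1
  refine Finset.sum_congr rfl fun i _ => ?_
  simp only [clockRate, networkStep, feedbackControl, Fin.cons_succ]
  by_cases h1 : i ∈ act k <;> by_cases h2 : 1 ≤ k i <;> simp [h1, h2]

theorem jumpGenerator_clockLaw [NeZero J] (hlam : 0 < lam) (hmu : ∀ i, 0 < mu i) (n : ℕ)
    (act : (Fin J → ℕ) → Set (Fin J)) (g : (Fin J → ℕ) → ℝ) (k : Fin J → ℕ) :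
    jumpGenerator (n * totalRate lam mu) (clockLaw lam mu) (networkStep act) g k =
      n * generator lam mu (feedbackControl act k) g k := by
  have hR := totalRate_pos hlam hmu
  rw [jumpGenerator, integral_clockLaw hlam hmu, ← sum_clockRate_mul]
  simp only [mul_sub, Finset.sum_sub_distrib]
  rw [← Finset.sum_mul, sum_clockRate, Finset.mul_sum, Finset.mul_sum]
  congr 1
  · refine Finset.sum_congr rfl fun a _ => ?_
    field_simp
  · ring

theorem feedbackControl_mem (act : (Fin J → ℕ) → Set (Fin J)) (k : Fin J → ℕ) :
    feedbackControl act k ∈ controlSet J := by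
  classical
  intro i
  rw [feedbackControl]
  split_ifs <;> norm_num

theorem ae_jumpTime_one_pos {Mk : Type*} [MeasurableSpace Mk] {r : ℝ} (hr : 0 < r) (ν : Measure Mk)
    [IsProbabilityMeasure ν] : ∀ᵐ ω ∂noise r ν, 0 < jumpTime ω 1 := by
  have := isProbabilityMeasure_gapMeasure hr
  have h0 : ∀ᵐ x ∂gapMeasure r, 0 < x := by
    have h1 := gapMeasure_real_Iic hr 0
    simp only [NNReal.coe_zero, mul_zero, neg_zero, Real.exp_zero, sub_self] at h1
    rw [measureReal_eq_zero_iff] at h1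
    filter_upwards [measure_eq_zero_iff_ae_notMem.1 h1] with x hx
    exact not_le.1 hx
  have h2 : MeasurePreserving (fun ω : ℕ → ℝ≥0 × Mk => (ω 0).1) (noise r ν) (gapMeasure r) :=
    measurePreserving_fst.comp (measurePreserving_eval_infinitePi _ 0)
  filter_upwards [h2.quasiMeasurePreserving.ae h0] with ω hω
  simpa [jumpTime] using hω

theorem measurePreserving_id_completion {α : Type*} [MeasurableSpace α] (μ : Measure α) :
    @MeasurePreserving (NullMeasurableSpace α μ) α _ _ id μ.completion μ := by
  have hm : @Measurable (NullMeasurableSpace α μ) α _ _ id := fun s hs => hs.nullMeasurableSet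
  refine ⟨hm, Measure.ext fun s hs => ?_⟩
  exact (Measure.map_apply hm hs).trans (Measure.completion_apply μ s)

/-- The network under a feedback control, as a controlled process on the completed space of the
noise. -/
def feedbackProcess [NeZero J] (hlam : 0 < lam) (hmu : ∀ i, 0 < mu i) {n : ℕ} (hn : 1 ≤ n)
    (act : (Fin J → ℕ) → Set (Fin J)) (k₀ : Fin J → ℕ) :
    ControlledProcess J lam mu n (scaled n k₀) :=
  let r : ℝ := n * totalRate lam mu
  let ν := clockLaw lam mu
  let W : NullMeasurableSpace (ℕ → ℝ≥0 × Fin (J + 1)) (noise r ν) → ℕ → ℝ≥0 × Fin (J + 1) := id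
  have hr : 0 < r := mul_pos (by exact_mod_cast hn) (totalRate_pos hlam hmu)
  haveI : IsProbabilityMeasure ν := isProbabilityMeasure_clockLaw hlam hmu
  haveI : IsProbabilityMeasure (noise r ν) := isProbabilityMeasure_noise hr
  have hW : MeasurePreserving W (noise r ν).completion (noise r ν) :=
    measurePreserving_id_completion _
  haveI hP : IsProbabilityMeasure (noise r ν).completion :=
    ⟨(Measure.completion_apply _ _).trans (measure_univ (μ := noise r ν))⟩
  have hne : ∀ᵐ ω ∂(noise r ν).completion, NonExplosive (W ω) :=
    hW.quasiMeasurePreserving.ae (ae_nonExplosive hr)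
  have hQ := measurable_path hW.measurable hne (networkStep act) k₀
  have hcont : ∀ ω t, ContinuousWithinAt (fun s => path (networkStep act) k₀ (W ω) s)
      (Set.Ici t) t := fun ω t =>
    tendsto_const_nhds.congr' ((eventually_path_eq (W ω) t).mono fun _ h => h.symm)
  { Ω := NullMeasurableSpace (ℕ → ℝ≥0 × Fin (J + 1)) (noise r ν)
    mΩ := inferInstance
    P := (noise r ν).completion
    isProb := hP
    ℱ := jumpFiltration (noise r ν).completion W
    complete := fun _ hs => measurableSet_jumpFiltration_of_null hs
    Q := fun t ω => path (networkStep act) k₀ (W ω) t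
    u := fun t ω => feedbackControl act (path (networkStep act) k₀ (W ω) t)
    rightCont := hcont
    leftLim := fun ω t => by
      obtain ⟨q, hq⟩ := exists_eventually_path_eq (step := networkStep act) (k₀ := k₀) (W ω) t
      exact ⟨q, tendsto_const_nhds.congr' (hq.mono fun _ h => h.symm)⟩
    adapted_Q := hQ
    measurable_u := (Measurable.of_discrete (f := feedbackControl act)).comp
      (measurable_uncurry_of_rightCont
        (fun t => (hQ t).mono ((jumpFiltration (noise r ν).completion W).le t) le_rfl) hcont)
    adapted_u := fun t => (Measurable.of_discrete (f := feedbackControl act)).comp (hQ t)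
    u_mem := fun t ω => feedbackControl_mem act _
    start := by
      filter_upwards [hne, hW.quasiMeasurePreserving.ae (ae_jumpTime_one_pos hr ν)] with ω h1 h2
      rw [path_zero h1 h2]
    martingale := by
      rintro g ⟨C, hC⟩
      have h := martingale_jumpMartingale hr hW (networkStep act) k₀ hC
      have h1 : jumpMartingale r ν (networkStep act) k₀ g W = fun (t : ℝ≥0) ω =>
          g (path (networkStep act) k₀ (W ω) t) - ∫ s in (0 : ℝ)..t, (n : ℝ) *
            generator lam mu (feedbackControl act (path (networkStep act) k₀ (W ω) s.toNNReal)) g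
              (path (networkStep act) k₀ (W ω) s.toNNReal) := by
        funext t ω
        simp only [jumpMartingale]
        congr 1
        refine intervalIntegral.integral_congr fun s _ => ?_
        exact jumpGenerator_clockLaw hlam hmu n act g _
      rw [h1] at h
      exact h }

end Feedback

/-! ### The cost of a feedback control -/

/-- A supersolution `g` of the discounted equation in the state space, with `g ≥ 1` at the exits,
dominates the cost of the feedback control. -/
theorem cost_feedbackProcess_le {J : ℕ} [NeZero J] {c lam : ℝ} {mu : Fin J → ℝ} {z : State J}
    (hc : 0 < c) (hlam : 0 < lam) (hmu : ∀ i, 0 < mu i) {n : ℕ} (hn : 1 ≤ n)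
    (act : (Fin J → ℕ) → Set (Fin J)) {k₀ : Fin J → ℕ} (hk₀ : scaled n k₀ ∈ domainG z)
    {g : (Fin J → ℕ) → ℝ} (hg : ∀ k, 0 ≤ g k)
    (hgen : ∀ k, scaled n k ∈ domainG z → generator lam mu (feedbackControl act k) g k ≤ c * g k)
    (hexit : ∀ k, scaled n k ∈ domainG z → ∀ a, scaled n (networkStep act k a) ∉ domainG z →
      1 ≤ g (networkStep act k a)) :
    cost c z (feedbackProcess hlam hmu hn act k₀) ≤ ENNReal.ofReal (g k₀) := by
  have hn' : (0 : ℝ) < n := by exact_mod_cast hn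
  have hR := totalRate_pos hlam hmu
  have hr : 0 < n * totalRate lam mu := mul_pos hn' hR
  have := isProbabilityMeasure_clockLaw hlam hmu
  have hθ : 0 ≤ n * c := by positivity
  set G : Set (Fin J → ℕ) := {k | scaled n k ∈ domainG z} with hG
  have hf : ∀ k ∈ G, ENNReal.ofReal (n * totalRate lam mu / (n * totalRate lam mu + n * c)) *
      ∫⁻ a, ENNReal.ofReal (g (networkStep act k a)) ∂clockLaw lam mu ≤ ENNReal.ofReal (g k) := by
    intro k hk
    have hw := fun a => clockRate_pos hlam hmu a
    rw [lintegral_clockLaw]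
    simp_rw [← ENNReal.ofReal_mul (div_pos (hw _) hR).le]
    rw [← ENNReal.ofReal_sum_of_nonneg fun a _ => mul_nonneg (div_pos (hw a) hR).le (hg _),
      ← ENNReal.ofReal_mul (by positivity)]
    refine ENNReal.ofReal_le_ofReal ?_
    have h1 := hgen k hk
    rw [← sum_clockRate_mul] at h1
    simp only [mul_sub, Finset.sum_sub_distrib] at h1
    rw [← Finset.sum_mul, sum_clockRate] at h1
    have h2 : n * totalRate lam mu / (n * totalRate lam mu + n * c) *
        ∑ a, clockRate lam mu a / totalRate lam mu * g (networkStep act k a) =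
        (∑ a, clockRate lam mu a * g (networkStep act k a)) / (totalRate lam mu + c) := by
      simp_rw [div_mul_eq_mul_div]
      rw [← Finset.sum_div]
      field_simp
    rw [h2, div_le_iff₀ (by positivity)]
    linarith
  have hf1 : ∀ k ∈ G, ∀ a, networkStep act k a ∉ G →
      1 ≤ ENNReal.ofReal (g (networkStep act k a)) := fun k hk a ha =>
    ENNReal.one_le_ofReal.2 (hexit k hk a ha)
  refine le_trans ?_ (tsum_lintegral_firstExit_le hr hθ (networkStep act) hk₀ hf hf1)
  set F : ℕ → (ℕ → ℝ≥0 × Fin (J + 1)) → ℝ≥0∞ := fun m =>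
    (firstExit (networkStep act) k₀ G m).indicator fun ω =>
      ENNReal.ofReal (Real.exp (-(n * c * (jumpTime ω m : ℝ)))) with hF
  have hFm : ∀ m, Measurable (F m) := fun m =>
    (measurable_exp_jumpTime _ m).indicator (measurableSet_firstExit _ _ _ m)
  have hid := measurePreserving_id_completion (noise (n * totalRate lam mu) (clockLaw lam mu))
  have h1 : ∑' m, ∫⁻ ω in firstExit (networkStep act) k₀ G m,
      ENNReal.ofReal (Real.exp (-(n * c * (jumpTime ω m : ℝ))))
        ∂noise (n * totalRate lam mu) (clockLaw lam mu) =
      ∫⁻ ω, ∑' m, F m ω ∂noise (n * totalRate lam mu) (clockLaw lam mu) := by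
    rw [lintegral_tsum fun m => (hFm m).aemeasurable]
    refine tsum_congr fun m => ?_
    rw [hF, lintegral_indicator (measurableSet_firstExit _ _ _ m)]
  rw [h1, ← hid.lintegral_comp (Measurable.tsum hFm)]
  unfold cost
  refine lintegral_mono_ae ?_
  filter_upwards [hid.quasiMeasurePreserving.ae (ae_nonExplosive hr)] with ω hω
  split_ifs with htop
  · exact zero_le
  · have hex : ∃ t : ℝ≥0, scaled n (path (networkStep act) k₀ ω t) ∉ domainG z := by
      by_contra! hall
      refine htop ?_
      simp only [exitTime, iInf_eq_top]
      exact fun t ht => absurd (hall t) ht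
    obtain ⟨t, ht⟩ := hex
    obtain ⟨m, hm, -⟩ := exists_mem_firstExit (G := G) hω ht
    refine le_trans ?_ (ENNReal.le_tsum m)
    have h2 : F m ω = ENNReal.ofReal (Real.exp (-(n * c * (jumpTime ω m : ℝ)))) :=
      Set.indicator_of_mem hm _
    refine le_trans ?_ (le_of_eq h2.symm)
    refine ENNReal.ofReal_le_ofReal (Real.exp_le_exp.2 (neg_le_neg ?_))
    refine mul_le_mul_of_nonneg_left ?_ hθ
    have h3 : ((jumpTime ω m : ℝ≥0) : ℝ≥0∞) ≤
        exitTime z (feedbackProcess hlam hmu hn act k₀) ω := by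
      refine le_iInf₂ fun s hs => ?_
      obtain ⟨l, hl, hls⟩ := exists_mem_firstExit (G := G) hω hs
      rw [eq_of_mem_firstExit hm hl]
      exact_mod_cast hls
    exact (ENNReal.toReal_mono htop h3)

theorem le_valueFun_of_feedback {J : ℕ} [NeZero J] {c lam : ℝ} {mu : Fin J → ℝ} {z : State J}
    (hc : 0 < c) (hlam : 0 < lam) (hmu : ∀ i, 0 < mu i) {n : ℕ} (hn : 1 ≤ n)
    (act : (Fin J → ℕ) → Set (Fin J)) {k₀ : Fin J → ℕ} (hk₀ : scaled n k₀ ∈ domainG z)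
    {φ : State J → ℝ}
    (hgen : ∀ k, scaled n k ∈ domainG z → generator lam mu (feedbackControl act k)
      (fun k => Real.exp (-(n * φ (scaled n k)))) k ≤ c * Real.exp (-(n * φ (scaled n k))))
    (hexit : ∀ k, scaled n k ∈ domainG z → ∀ a, scaled n (networkStep act k a) ∉ domainG z →
      φ (scaled n (networkStep act k a)) ≤ 0) :
    ((φ (scaled n k₀) : ℝ) : EReal) ≤ valueFun c lam mu z n (scaled n k₀) := by
  have hn' : (0 : ℝ) < n := by exact_mod_cast hn
  have h1 := ENNReal.log_monotone (cost_feedbackProcess_le hc hlam hmu hn act hk₀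
    (g := fun k => Real.exp (-(n * φ (scaled n k)))) (fun k => (Real.exp_pos _).le) hgen
    fun k hk a ha => Real.one_le_exp (by
      have := hexit k hk a ha
      have := mul_nonneg hn'.le (neg_nonneg.2 this)
      linarith))
  rw [ENNReal.log_ofReal_of_pos (Real.exp_pos _), Real.log_exp] at h1
  unfold valueFun
  rw [EReal.le_neg, ← EReal.coe_neg]
  refine (iInf_le _ (feedbackProcess hlam hmu hn act k₀)).trans ?_
  have h2 := mul_le_mul_of_nonneg_left h1
    (show (0 : EReal) ≤ (((n : ℝ)⁻¹ : ℝ) : EReal) by exact_mod_cast (inv_pos.2 hn').le)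
  refine h2.trans (le_of_eq ?_)
  rw [← EReal.coe_mul]
  congr 1
  field_simp

/-! ### The feedback control of a smooth strict subsolution -/

theorem gammaVec_apply {J : ℕ} (i j : Fin J) :
    gammaVec i j = (if j = i then 1 else 0) - (if j.val = i.val + 1 then 1 else 0) := by
  unfold gammaVec
  rw [PiLp.sub_apply, unitVec_apply]
  congr 1
  split_ifs with h1 h2 h2
  · rw [unitVec_apply, if_pos (Fin.ext h2)]
  · rw [unitVec_apply, if_neg fun h => h2 (congrArg Fin.val h)]
  · exact absurd (h2 ▸ j.isLt) h1
  · rfl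

theorem norm_gammaVec_le {J : ℕ} (i : Fin J) : ‖(gammaVec i : State J)‖ ≤ 2 := by
  unfold gammaVec
  refine (norm_sub_le _ _).trans ?_
  rw [norm_unitVec]
  split_ifs
  · rw [norm_unitVec]; norm_num
  · rw [norm_zero]; norm_num

theorem scaled_arrive {J : ℕ} [NeZero J] (n : ℕ) (k : Fin J → ℕ) :
    scaled n (arrive k) = scaled n k + (n : ℝ)⁻¹ • unitVec 0 := by
  ext j
  rw [PiLp.add_apply, PiLp.smul_apply, unitVec_apply, scaled_apply, scaled_apply, arrive]
  split_ifs
  · push_cast; simp; ring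
  · simp

theorem scaled_serve {J : ℕ} (n : ℕ) {k : Fin J → ℕ} {i : Fin J} (hi : 1 ≤ k i) :
    scaled n (serve i k) = scaled n k - (n : ℝ)⁻¹ • gammaVec i := by
  ext j
  rw [PiLp.sub_apply, PiLp.smul_apply, gammaVec_apply, scaled_apply, scaled_apply, serve]
  by_cases h1 : j = i
  · subst h1
    rw [if_pos rfl, if_pos rfl, if_neg (by omega), Nat.cast_sub hi]
    simp; ring
  · by_cases h2 : j.val = i.val + 1
    · rw [if_neg h1, if_neg h1, if_pos h2, if_pos h2]
      push_cast; simp; ring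
    · rw [if_neg h1, if_neg h1, if_neg h2, if_neg h2]
      simp

/-- A service that would leave the box is one into a full queue. -/
theorem exists_lt_of_serve_notMem {J : ℕ} {z : State J} {n : ℕ} {k : Fin J → ℕ}
    {i : Fin J} (hk : scaled n k ∈ closedBox z) (h : scaled n (serve i k) ∉ closedBox z) :
    ∃ j : Fin J, j.val = i.val + 1 ∧ z j < scaled n k j + (n : ℝ)⁻¹ := by
  by_contra! hall
  refine h fun j => ⟨by rw [scaled_apply]; positivity, ?_⟩
  rw [scaled_apply, serve]
  split_ifs with h1 h2
  · refine le_trans ?_ (hk j).2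
    rw [scaled_apply]
    gcongr
    exact Nat.sub_le _ _
  · have := hall j h2
    rw [scaled_apply] at this
    push_cast
    rw [add_div, one_div]
    exact this
  · exact (hk j).2

namespace SmoothSubsolution

variable {J : ℕ} [NeZero J] {c lam : ℝ} {mu β : Fin J → ℝ} {z : State J} {e K : ℝ}

/-- On the box, small displacements change the subsolution by nearly their product with the gradient,
uniformly in the base point. -/
theorem exists_uniform (φ : SmoothSubsolution c lam mu β z e K) {ε : ℝ} (hε : 0 < ε) :
    ∃ δ > 0, ∀ x ∈ closedBox z, ∀ y, ‖y - x‖ ≤ δ → ‖φ.grad y - φ.grad x‖ ≤ ε ∧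
      |φ.toFun y - φ.toFun x - inner ℝ (φ.grad x) (y - x)| ≤ ε * ‖y - x‖ := by
  have hcpt : IsCompact (Metric.cthickening 1 (closedBox z)) := (isCompact_closedBox z).cthickening
  have huc := hcpt.uniformContinuousOn_of_continuous φ.continuous_grad.continuousOn
  obtain ⟨δ, hδ, hδ'⟩ := Metric.uniformContinuousOn_iff_le.1 huc ε hε
  have hgrad : ∀ x ∈ closedBox z, ∀ y, ‖y - x‖ ≤ min δ 1 → ‖φ.grad y - φ.grad x‖ ≤ ε := by
    intro x hx y hy
    rw [← dist_eq_norm] at hy ⊢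
    exact hδ' y (Metric.mem_cthickening_of_dist_le y x 1 _ hx (hy.trans (min_le_right _ _))) x
      (Metric.self_subset_cthickening _ hx) (hy.trans (min_le_left _ _))
  refine ⟨min δ 1, lt_min hδ one_pos, fun x hx y hy => ⟨hgrad x hx y hy, ?_⟩⟩
  have h1 := (convex_closedBall x (min δ 1)).norm_image_sub_le_of_norm_hasFDerivWithin_le'
    (f := φ.toFun) (f' := fun w => innerSL ℝ (φ.grad w)) (φ := innerSL ℝ (φ.grad x)) (C := ε)
    (x := x) (y := y) (fun w _ => (φ.hasFDerivAt w).hasFDerivWithinAt) (fun w hw => ?_)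
    (Metric.mem_closedBall_self (lt_min hδ one_pos).le)
    (by rwa [Metric.mem_closedBall, dist_eq_norm])
  · simpa using h1
  · rw [Metric.mem_closedBall, dist_eq_norm] at hw
    rw [← map_sub, innerSL_apply_norm]
    exact hgrad x hx w hw

/-- The feedback control derived from the gradient: serve where this decreases the subsolution,
unless the service leads out of the box. -/
def act (φ : SmoothSubsolution c lam mu β z e K) (n : ℕ) (k : Fin J → ℕ) : Set (Fin J) :=
  {i | coord (φ.grad (scaled n k)) i < coord (φ.grad (scaled n k)) (i + 1) ∧
    scaled n (serve i k) ∈ closedBox z}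

theorem toFun_networkStep_nonpos (φ : SmoothSubsolution c lam mu β z e K) {n : ℕ} {k : Fin J → ℕ}
    (hk : scaled n k ∈ domainG z) (a : Fin (J + 1))
    (ha : scaled n (networkStep (φ.act n) k a) ∉ domainG z) :
    φ.toFun (scaled n (networkStep (φ.act n) k a)) ≤ 0 := by
  refine φ.nonpos _ ?_
  revert ha
  refine Fin.cases (fun ha => ?_) (fun i ha => ?_) a
  · simp only [networkStep, Fin.cons_zero] at ha ⊢
    by_contra! h0
    refine ha ⟨fun i => by rw [scaled_apply]; positivity, h0, fun i hi => ?_⟩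
    rw [scaled_apply, arrive, if_neg hi]
    exact hk.2.2 i hi
  · simp only [networkStep, Fin.cons_succ] at ha ⊢
    split_ifs at ha ⊢ with h
    · by_contra! h0
      exact ha (mem_domainG_iff.2 ⟨h.1.2, h0⟩)
    · exact absurd hk ha

/-- Where a service is prevented, it would not have decreased the subsolution by much: this is what
the slopes of the subsolution at the faces are made for. -/
theorem coord_sub_le_of_notMem_act (φ : SmoothSubsolution c lam mu β z e K) {ε δ : ℝ} (hε : 0 < ε)
    (hδ : ∀ x ∈ closedBox z, ∀ y, ‖y - x‖ ≤ δ → ‖φ.grad y - φ.grad x‖ ≤ ε) {n : ℕ}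
    (hnδ : (n : ℝ)⁻¹ ≤ δ) {k : Fin J → ℕ} (hk : scaled n k ∈ domainG z) {i : Fin J}
    (hi : ¬ (i ∈ φ.act n k ∧ 1 ≤ k i)) :
    coord (φ.grad (scaled n k)) (i + 1) - coord (φ.grad (scaled n k)) i ≤ 2 * ε := by
  have hkb := domainG_subset_closedBox z hk
  by_cases h0 : k i = 0
  · have := (φ.lower_face _ hkb i (by rw [scaled_apply, h0]; simp)).2
    linarith
  by_cases h1 : coord (φ.grad (scaled n k)) i < coord (φ.grad (scaled n k)) (i + 1)
  swap
  · linarith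
  have h2 : scaled n (serve i k) ∉ closedBox z := fun h => hi ⟨⟨h1, h⟩, Nat.one_le_iff_ne_zero.2 h0⟩
  obtain ⟨j, hj, hjz⟩ := exists_lt_of_serve_notMem hkb h2
  set x := scaled n k with hx
  set y : State J := x + (z j - x j) • unitVec j with hy
  have hxj : x j ≤ z j := (hkb j).2
  have hyj : ∀ l, y l = if l = j then z j else x l := by
    intro l
    rw [hy, PiLp.add_apply, PiLp.smul_apply, unitVec_apply]
    split_ifs with h
    · rw [h]; simp
    · simp
  have hyb : y ∈ closedBox z := by
    intro l
    rw [hyj]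
    split_ifs with h
    · rw [h]; exact ⟨(hkb j).1.trans hxj, le_rfl⟩
    · exact hkb l
  have hyx : ‖y - x‖ ≤ δ := by
    rw [hy, add_sub_cancel_left, norm_smul, norm_unitVec, mul_one,
      Real.norm_of_nonneg (sub_nonneg.2 hxj)]
    linarith
  have hj0 : j ≠ 0 := by
    rintro rfl
    simp at hj
  have h3 := (φ.upper_face y hyb j hj0 (by rw [hyj, if_pos rfl])).2 i hj.symm
  have h4 : ∀ l, |φ.grad y l - φ.grad x l| ≤ ε := fun l =>
    (PiLp.norm_apply_le (φ.grad y - φ.grad x) l).trans (hδ x hkb y hyx)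
  rw [← hj, coord_val, coord_val]
  have h5 := abs_le.1 (h4 j)
  have h6 := abs_le.1 (h4 i)
  linarith [h5.1, h6.2]

/-- Under its feedback control, `exp (-n φ)` is a supersolution of the discounted equation for all
large `n`: the strictness of the subsolution `φ` absorbs the discretization error. -/
theorem exists_generator_le (φ : SmoothSubsolution c lam mu β z e K) (hlam : 0 < lam)
    (hmu : ∀ i, 0 < mu i) :
    ∃ N : ℕ, ∀ n ≥ N, 1 ≤ n → ∀ k, scaled n k ∈ domainG z →
      generator lam mu (feedbackControl (φ.act n) k)
        (fun k => Real.exp (-(n * φ.toFun (scaled n k)))) k ≤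
        c * Real.exp (-(n * φ.toFun (scaled n k))) := by
  obtain ⟨L, hL⟩ := (isCompact_closedBox z).exists_bound_of_continuousOn
    (f := fun x => Real.exp (-(φ.grad x 0)))
    (Real.continuous_exp.comp ((continuous_apply 0).comp
      ((PiLp.continuous_ofLp 2 _).comp φ.continuous_grad)).neg).continuousOn
  set T := lam * max L 0 + 2 * ∑ i, mu i with hT
  have hT0 : 0 < T := by
    have : 0 < ∑ i, mu i := Finset.sum_pos (fun i _ => hmu i) Finset.univ_nonempty
    have := mul_nonneg hlam.le (le_max_right L 0)
    positivity
  -- the relative error that the margin of the subsolution can absorb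
  set κ := φ.margin / T with hκ
  have hκ0 : 0 < κ := div_pos φ.margin_pos hT0
  set ε := Real.log (1 + κ) / 2 with hε
  have hε0 : 0 < ε := half_pos (Real.log_pos (by linarith))
  have hexp : Real.exp (2 * ε) = 1 + κ := by
    rw [hε, mul_div_cancel₀ _ two_ne_zero, Real.exp_log (by linarith)]
  obtain ⟨δ, hδ, hδ'⟩ := φ.exists_uniform hε0
  obtain ⟨N, hN⟩ := exists_nat_gt (2 / δ)
  refine ⟨N, fun n hn hn1 k hk => ?_⟩
  have hn0 : (0 : ℝ) < n := by exact_mod_cast hn1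
  have hnδ : 2 * (n : ℝ)⁻¹ ≤ δ := by
    have h1 : 2 / δ < n := hN.trans_le (by exact_mod_cast hn)
    rw [div_lt_iff₀ hδ] at h1
    rw [mul_inv_le_iff₀ hn0]
    linarith
  have hnδ1 : (n : ℝ)⁻¹ ≤ δ := by
    have := inv_pos.2 hn0
    linarith
  have hkb := domainG_subset_closedBox z hk
  set x := scaled n k with hx
  set p := φ.grad x with hp
  set E := Real.exp (-(n * φ.toFun x)) with hE
  have hE0 : 0 < E := Real.exp_pos _
  -- the effect on `exp(-n φ)` of a small displacement `v / n`
  have hmove : ∀ v : State J, ‖v‖ ≤ 2 → Real.exp (-(n * φ.toFun (x + (n : ℝ)⁻¹ • v))) ≤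
      E * (Real.exp (-inner ℝ p v) * (1 + κ)) := by
    intro v hv
    have hnv : ‖x + (n : ℝ)⁻¹ • v - x‖ ≤ 2 * (n : ℝ)⁻¹ := by
      rw [add_sub_cancel_left, norm_smul, Real.norm_of_nonneg (inv_pos.2 hn0).le, mul_comm]
      exact mul_le_mul_of_nonneg_right hv (inv_pos.2 hn0).le
    have h1 := (abs_le.1 ((hδ' x hkb _ (hnv.trans hnδ)).2)).1
    rw [add_sub_cancel_left, inner_smul_right] at h1
    rw [add_sub_cancel_left] at hnv
    have h2 : -(ε * (2 * (n : ℝ)⁻¹)) ≤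
        φ.toFun (x + (n : ℝ)⁻¹ • v) - φ.toFun x - (n : ℝ)⁻¹ * inner ℝ p v :=
      le_trans (neg_le_neg (mul_le_mul_of_nonneg_left hnv hε0.le)) h1
    have h3 := mul_le_mul_of_nonneg_left h2 hn0.le
    have h4 : (n : ℝ) * (n : ℝ)⁻¹ = 1 := mul_inv_cancel₀ hn0.ne'
    rw [← hexp, hE, ← Real.exp_add, ← Real.exp_add]
    refine Real.exp_le_exp.2 ?_
    have h5 : (n : ℝ) * -(ε * (2 * (n : ℝ)⁻¹)) = -(2 * ε) := by
      linear_combination (-(2 * ε)) * h4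
    have h6 : (n : ℝ) * (φ.toFun (x + (n : ℝ)⁻¹ • v) - φ.toFun x - (n : ℝ)⁻¹ * inner ℝ p v) =
        n * φ.toFun (x + (n : ℝ)⁻¹ • v) - n * φ.toFun x - inner ℝ p v := by
      linear_combination (-(inner ℝ p v)) * h4
    rw [h5, h6] at h3
    linarith
  have harr : lam * (Real.exp (-(n * φ.toFun (scaled n (arrive k)))) - E) ≤
      E * (-(lam * (1 - Real.exp (-p 0))) + κ * (lam * max L 0)) := by
    have h1 := hmove (unitVec 0) (by rw [norm_unitVec]; norm_num)
    rw [inner_unitVec] at h1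
    rw [scaled_arrive]
    have h2 : Real.exp (-p 0) ≤ max L 0 :=
      ((le_abs_self _).trans (hL x hkb)).trans (le_max_left _ _)
    calc _ ≤ lam * (E * (Real.exp (-p 0) * (1 + κ)) - E) :=
          mul_le_mul_of_nonneg_left (sub_le_sub_right h1 _) hlam.le
      _ = E * (-(lam * (1 - Real.exp (-p 0))) + κ * (lam * Real.exp (-p 0))) := by ring
      _ ≤ _ := by gcongr
  have hserve : ∀ i, feedbackControl (φ.act n) k i * mu i * (if 1 ≤ k i then
      Real.exp (-(n * φ.toFun (scaled n (serve i k)))) - E else 0) ≤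
      E * (-(mu i * max 0 (1 - Real.exp (coord p i - coord p (i + 1)))) + κ * (2 * mu i)) := by
    intro i
    by_cases hi : i ∈ φ.act n k ∧ 1 ≤ k i
    · rw [if_pos hi.2, feedbackControl, if_pos hi.1, one_mul, scaled_serve n hi.2]
      have h1 := hmove (-gammaVec i) (by rw [norm_neg]; exact norm_gammaVec_le i)
      rw [smul_neg, ← sub_eq_add_neg, inner_neg_right, neg_neg, inner_gammaVec] at h1
      have hd : coord p i - coord p (i + 1) ≤ 0 := sub_nonpos.2 hi.1.1.le
      have h2 : Real.exp (coord p i - coord p (i + 1)) ≤ 1 := Real.exp_le_one_iff.2 hd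
      rw [max_eq_right (by linarith)]
      calc _ ≤ mu i * (E * (Real.exp (coord p i - coord p (i + 1)) * (1 + κ)) - E) :=
            mul_le_mul_of_nonneg_left (sub_le_sub_right h1 _) (hmu i).le
        _ = E * (-(mu i * (1 - Real.exp (coord p i - coord p (i + 1)))) +
              κ * (Real.exp (coord p i - coord p (i + 1)) * mu i)) := by ring
        _ ≤ _ := by
            have := (hmu i).le
            gcongr
            linarith
    · have h0 : feedbackControl (φ.act n) k i * mu i * (if 1 ≤ k i then
          Real.exp (-(n * φ.toFun (scaled n (serve i k)))) - E else 0) = 0 := by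
        rcases not_and_or.1 hi with h | h
        · rw [feedbackControl, if_neg h]; simp
        · rw [if_neg h, mul_zero]
      rw [h0]
      have h1 := φ.coord_sub_le_of_notMem_act hε0 (fun x hx y hy => (hδ' x hx y hy).1) hnδ1 hk hi
      rw [← hx, ← hp] at h1
      have h2 : max 0 (1 - Real.exp (coord p i - coord p (i + 1))) ≤ κ := by
        refine max_le hκ0.le ?_
        have h3 := Real.add_one_le_exp (coord p i - coord p (i + 1))
        have h4 := Real.add_one_le_exp (2 * ε)
        linarith
      have h5 := mul_le_mul_of_nonneg_left h2 (hmu i).le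
      have h6 := mul_pos (hmu i) hκ0
      refine mul_nonneg hE0.le ?_
      linarith
  have hsum : generator lam mu (feedbackControl (φ.act n) k)
      (fun k => Real.exp (-(n * φ.toFun (scaled n k)))) k ≤
      E * (-(lam * (1 - Real.exp (-p 0))) + κ * (lam * max L 0)) +
      ∑ i, E * (-(mu i * max 0 (1 - Real.exp (coord p i - coord p (i + 1)))) + κ * (2 * mu i)) :=
    add_le_add harr (Finset.sum_le_sum fun i _ => hserve i)
  refine hsum.trans ?_
  rw [← Finset.mul_sum, Finset.sum_add_distrib, Finset.sum_neg_distrib, ← Finset.mul_sum,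
    ← Finset.mul_sum]
  have hham := φ.ham_ge x hkb
  rw [hamExp, ← hp] at hham
  have hκT : κ * T = φ.margin := div_mul_cancel₀ _ hT0.ne'
  rw [← mul_add, mul_comm c E]
  refine mul_le_mul_of_nonneg_left ?_ hE0.le
  rw [hT] at hκT
  linarith

end SmoothSubsolution

/-! ### The limit of the value functions -/

theorem eventually_lt_valueFun {J : ℕ} [NeZero J] {c lam : ℝ} {mu β : Fin J → ℝ} {z : State J}
    (hc : 0 < c) (hlam : 0 < lam) (hmu : ∀ i, 0 < mu i) (hz : ∀ i, 0 < z i)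
    (hβ : ∀ i, IsPositiveRoot c lam (mu i) (β i)) {x : State J} {xs : ℕ → State J}
    (hxs : ∀ n, 1 ≤ n → xs n ∈ latticeG z n) (hlim : Tendsto xs atTop (𝓝 x)) {a : ℝ}
    (ha : a < minFun β z x) :
    ∀ᶠ n in atTop, (a : EReal) < valueFun c lam mu z n (xs n) := by
  set e := (minFun β z x - a) / 2 with he
  have he0 : 0 < e := half_pos (sub_pos.2 ha)
  obtain ⟨φ⟩ := nonempty_smoothSubsolution (K := 0) hc hlam hmu hz hβ he0
  obtain ⟨N, hN⟩ := φ.exists_generator_le hlam hmu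
  have h1 : ∀ᶠ n in atTop, minFun β z x - e < minFun β z (xs n) :=
    ((continuous_minFun β z).tendsto x |>.comp hlim).eventually (lt_mem_nhds (by linarith))
  filter_upwards [h1, eventually_ge_atTop N, eventually_ge_atTop 1] with n hn1 hnN hn
  obtain ⟨hG, k, hk⟩ := hxs n hn
  rw [hk] at hG hn1 ⊢
  refine lt_of_lt_of_le (EReal.coe_lt_coe_iff.2 ?_) (le_valueFun_of_feedback hc hlam hmu hn (φ.act n)
    hG (φ := φ.toFun) (hN n hnN hn) fun k hk a ha => φ.toFun_networkStep_nonpos hk a ha)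
  have := φ.ge _ (domainG_subset_closedBox z hG)
  linarith

theorem eventually_valueFun_lt {J : ℕ} [NeZero J] {c lam : ℝ} {mu β : Fin J → ℝ} {z : State J}
    (hc : 0 < c) (hlam : 0 < lam) (hmu : ∀ i, 0 < mu i)
    (hβ : ∀ i, IsPositiveRoot c lam (mu i) (β i)) {x : State J} {xs : ℕ → State J}
    (hxs : ∀ n, 1 ≤ n → xs n ∈ latticeG z n) (hlim : Tendsto xs atTop (𝓝 x)) {a : ℝ}
    (ha : minFun β z x < a) :
    ∀ᶠ n in atTop, valueFun c lam mu z n (xs n) < (a : EReal) := by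
  obtain ⟨i, hi⟩ := exists_minFun_eq β z x
  rw [hi] at ha
  -- a slope slightly larger than `β i`
  have h1 : ∀ᶠ b in 𝓝[>] β i, b * ∑ j ∈ Finset.Iic i, (z j - x j) < a :=
    (tendsto_nhdsWithin_of_tendsto_nhds (Continuous.tendsto (by fun_prop) (β i))).eventually
      (gt_mem_nhds ha)
  obtain ⟨b, hb, hβb⟩ := (h1.and self_mem_nhdsWithin).exists
  have h2 : Tendsto (fun n : ℕ => b * ∑ j ∈ Finset.Iic i, (z j - xs n j) + b / n) atTop
      (𝓝 (b * ∑ j ∈ Finset.Iic i, (z j - x j) + 0)) := by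
    refine Tendsto.add ?_ (tendsto_const_div_atTop_nhds_zero_nat b)
    have hcont : Continuous fun y : State J => b * ∑ j ∈ Finset.Iic i, (z j - y j) := by fun_prop
    exact (hcont.tendsto x).comp hlim
  rw [add_zero] at h2
  filter_upwards [h2.eventually (gt_mem_nhds hb), eventually_ge_atTop 1] with n hn hn1
  exact (valueFun_le hc hlam hmu (hβ i) hβb hn1 (hxs n hn1)).trans_lt (EReal.coe_lt_coe_iff.2 hn)

theorem tendsto_valueFun {J : ℕ} [NeZero J] {c lam : ℝ} {mu β : Fin J → ℝ} {z : State J}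
    (hc : 0 < c) (hlam : 0 < lam) (hmu : ∀ i, 0 < mu i) (hz : ∀ i, 0 < z i)
    (hβ : ∀ i, IsPositiveRoot c lam (mu i) (β i)) {x : State J} {xs : ℕ → State J}
    (hxs : ∀ n, 1 ≤ n → xs n ∈ latticeG z n) (hlim : Tendsto xs atTop (𝓝 x)) :
    Tendsto (fun n => valueFun c lam mu z n (xs n)) atTop (𝓝 ((minFun β z x : ℝ) : EReal)) := by
  refine tendsto_order.2 ⟨fun a ha => ?_, fun a ha => ?_⟩
  · obtain ⟨b, hab, hb⟩ := EReal.lt_iff_exists_real_btwn.1 ha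
    filter_upwards [eventually_lt_valueFun hc hlam hmu hz hβ hxs hlim (EReal.coe_lt_coe_iff.1 hb)]
      with n hn using hab.trans hn
  · obtain ⟨b, hb, hba⟩ := EReal.lt_iff_exists_real_btwn.1 ha
    filter_upwards [eventually_valueFun_lt hc hlam hmu hβ hxs hlim (EReal.coe_lt_coe_iff.1 hb)]
      with n hn using hn.trans hba

end TandemQueue

end

theorem theorem2 (J : ℕ) [NeZero J] (c lam : ℝ) (mu : Fin J → ℝ) (z : TandemQueue.State J)
    (hc : 0 < c) (hlam : 0 < lam) (hmu : ∀ i, 0 < mu i) (hz : ∀ i, 0 < z i) :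
    (∀ i, ∃! b : ℝ, TandemQueue.IsPositiveRoot c lam (mu i) b) ∧
    ∀ β : Fin J → ℝ, (∀ i, TandemQueue.IsPositiveRoot c lam (mu i) (β i)) →
      -- the explicit function is a Lipschitz viscosity solution,
      TandemQueue.IsLipschitz z (TandemQueue.minFun β z) ∧
      TandemQueue.IsViscositySolution c lam mu z (TandemQueue.minFun β z) ∧
      -- it is the only one,
      (∀ W : TandemQueue.State J → ℝ, TandemQueue.IsLipschitz z W →
        TandemQueue.IsViscositySolution c lam mu z W →
        ∀ x ∈ closure (TandemQueue.domainG z), W x = TandemQueue.minFun β z x) ∧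
      -- and it is the large-buffer limit of the value functions.
      (∀ (x : TandemQueue.State J) (xs : ℕ → TandemQueue.State J),
        x ∈ TandemQueue.domainG z →
        (∀ n, 1 ≤ n → xs n ∈ TandemQueue.latticeG z n) →
        Tendsto xs atTop (𝓝 x) →
        Tendsto (fun n => TandemQueue.valueFun c lam mu z n (xs n)) atTop
          (𝓝 ((TandemQueue.minFun β z x : ℝ) : EReal))) := by
  refine ⟨fun i => TandemQueue.existsUnique_isPositiveRoot hc hlam (hmu i), fun β hβ =>
    ⟨TandemQueue.isLipschitz_minFun β z,
      TandemQueue.isViscositySolution_minFun hc hlam hmu hz hβ, fun W hWlip hW x hx => ?_,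
      fun x xs _ hxs hlim => TandemQueue.tendsto_valueFun hc hlam hmu hz hβ hxs hlim⟩⟩
  rw [TandemQueue.closure_domainG hz] at hx
  exact le_antisymm (TandemQueue.le_of_isViscositySolution hc hlam hmu hz hβ hWlip hW hx)
    (TandemQueue.ge_of_isViscositySolution hc hlam hmu hz hβ hWlip hW hx)
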